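/- Let $\mathbf{k}$ be a field. All simplicial complexes are finite and contain the empty face; $\dim\tau=|\tau|-1$, and $\dim\Delta$ is the maximal dimension of a face. A complex $\Delta$ is Cohen–Macaulay over $\mathbf{k}$ if $\widetilde H_i(|\mathrm{lk}_\Delta(\tau)|;\mathbf{k})=0$ for all faces $\tau\in\Delta$ (including $\tau=\emptyset$) and all $i<\dim \mathrm{lk}_\Delta(\tau)$, where $\mathrm{lk}_\Delta(\tau)=\{\sigma\in\Delta:\sigma\cap\tau=\emptyset,\ \sigma\cup\tau\in\Delta\}$. It is Buchsbaum over $\mathbf{k}$ if all its facets have the same dimension and $\mathrm{lk}_\Delta(v)$ is Cohen–Macaulay over $\mathbf{k}$ for every vertex $v$. A $(d-1)$-dimensional complex $\Delta$ is Buchsbaum* over $\mathbf{k}$ if it is Buchsbaum over $\mathbf{k}$ and, for every point $p\in|\Delta|$ of the geometric realization, the canonical map $\widetilde H_{d-1}(|\Delta|;\mathbf{k})\to \widetilde H_{d-1}(|\Delta|,|\Delta|-p;\mathbf{k})$ in singular homology is surjective. For an integer $m\ge 0$, a $(d-1)$-dimensional complex $\Delta$ is $m$-Buchsbaum* over $\mathbf{k}$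 if $\Delta$ is Buchsbaum over $\mathbf{k}$ and, for every set $A\subseteq V(\Delta)$ of vertices with $|A|<m$, the restriction $\Delta-A$ of $\Delta$ to $V(\Delta)\setminus A$ is Buchsbaum* over $\mathbf{k}$ of dimension $d-1$. Corollary. Let $\Delta$ be a $(d-1)$-dimensional balanced simplicial complex, that is, one equipped with a coloring $\kappa:V(\Delta)\to[d]=\{1,\dots,d\}$ such that $\kappa(u)\ne\kappa(v)$ for every edge $\{u,v\}\in\Delta$, and suppose that $\Delta$ is $m$-Buchsbaum* over $\mathbf{k}$ for some integer $m\geq 0$. Then for every $S\subseteq[d]$ the rank-selected subcomplex $\Delta_S=\{\tau\in\Delta:\kappa(\tau)\subseteq S\}$ is $m$-Buchsbaum* over $\mathbf{k}$. -/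

import Mathlib

open CategoryTheory AlgebraicTopology

universe u

noncomputable section

/-! ### Singular homology: absolute, relative and reduced -/

/-- The singular chain complex functor with coefficients in the field `k`. -/
abbrev singularChains (k : Type u) [Field k] :
    TopCat.{u} ⥤ ChainComplex (ModuleCat.{u} k) ℕ :=
  (singularChainComplexFunctor (ModuleCat.{u} k)).obj (ModuleCat.of k k)

/-- The singular homology `H_n(X; k)`. -/
abbrev singularHomology (k : Type u) [Field k] (n : ℕ) (X : TopCat.{u}) : ModuleCat.{u} k :=
  ((singularChains k).obj X).homology n

/-- The reduced singular homology `H̃_n(X; k)` in degree `n ≥ 0`: the kernel of the map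
`H_n(X; k) → H_n(pt; k)` induced by the map from `X` to a point. -/
def reducedHomology (k : Type u) [Field k] (n : ℕ) (X : TopCat.{u}) :
    Submodule k (singularHomology k n X) :=
  LinearMap.ker (HomologicalComplex.homologyMap ((singularChains k).map
    (TopCat.ofHom (ContinuousMap.const X PUnit.unit) : X ⟶ TopCat.of PUnit.{u + 1})) n).hom

/-- The inclusion of a subspace. -/
def subspaceInclusion {X : TopCat.{u}} (A : Set X) : TopCat.of A ⟶ X :=
  TopCat.ofHom ⟨Subtype.val, continuous_subtype_val⟩

/-- The relative singular chain complex of the pair `(X, A)`: the quotient of the singular chains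
of `X` by the singular chains of `A`. -/
def relativeChains (k : Type u) [Field k] {X : TopCat.{u}} (A : Set X) :
    ChainComplex (ModuleCat.{u} k) ℕ :=
  Limits.cokernel ((singularChains k).map (subspaceInclusion A))

/-- The relative singular homology `H_n(X, A; k)`. -/
abbrev relativeHomology (k : Type u) [Field k] (n : ℕ) {X : TopCat.{u}} (A : Set X) :
    ModuleCat.{u} k :=
  (relativeChains k A).homology n

/-- The canonical map `H_n(X; k) → H_n(X, A; k)`. -/
def toRelativeHomology (k : Type u) [Field k] (n : ℕ) {X : TopCat.{u}} (A : Set X) :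
    singularHomology k n X →ₗ[k] relativeHomology k n A :=
  (HomologicalComplex.homologyMap
    (Limits.cokernel.π ((singularChains k).map (subspaceInclusion A)) :
      (singularChains k).obj X ⟶ relativeChains k A) n).hom

namespace PreAbstractSimplicialComplex

/-! ### Finite simplicial complexes

In a `PreAbstractSimplicialComplex` only the nonempty faces are recorded; the empty set is
understood to be a face of every complex. Elements of `V` need not be vertices. -/

/-- The vertex set of `Δ`. -/
def vertices {V : Type u} (Δ : PreAbstractSimplicialComplex V) : Set V :=
  {v | {v} ∈ Δ}

/-- `dim Δ + 1`, the largest cardinality of a face (`0` if the empty face is the only face). -/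
def dimSucc {V : Type u} (Δ : PreAbstractSimplicialComplex V) : ℕ :=
  sSup (Finset.card '' Δ.faces)

/-- All facets (maximal faces) of `Δ` have the same dimension. -/
def IsPure {V : Type u} (Δ : PreAbstractSimplicialComplex V) : Prop :=
  ∀ s t : Finset V, Maximal (· ∈ Δ) s → Maximal (· ∈ Δ) t → s.card = t.card

open Classical in
/-- The link of `τ` in `Δ`; it equals `Δ` if `τ = ∅`. -/
def link {V : Type u} (Δ : PreAbstractSimplicialComplex V) (τ : Finset V) :
    PreAbstractSimplicialComplex V where
  faces := {s | s.Nonempty ∧ Disjoint s τ ∧ s ∪ τ ∈ Δ.faces}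
  isRelLowerSet_faces := fun _ hs => ⟨hs.1, fun _ hts ht => ⟨ht, hs.2.1.mono_left hts,
    (Δ.isRelLowerSet_faces hs.2.2).2 (Finset.union_subset_union_left hts)
      (ht.mono Finset.subset_union_left)⟩⟩

/-- The restriction `Δ - A` of `Δ` to the vertices that are not in `A`. -/
def deletion {V : Type u} (Δ : PreAbstractSimplicialComplex V) (A : Finset V) :
    PreAbstractSimplicialComplex V where
  faces := {s | s ∈ Δ.faces ∧ Disjoint s A}
  isRelLowerSet_faces := fun _ hs => ⟨(Δ.isRelLowerSet_faces hs.1).1, fun _ hts ht =>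
    ⟨(Δ.isRelLowerSet_faces hs.1).2 hts ht, hs.2.mono_left hts⟩⟩

/-- The geometric realization `|Δ|`: the points of the standard simplex on `V` (barycentric
coordinates) whose support lies in a face of `Δ`, with the subspace topology from `V → ℝ`. -/
def realization {V : Type u} [Fintype V] (Δ : PreAbstractSimplicialComplex V) : TopCat.{u} :=
  TopCat.of {x : V → ℝ // x ∈ stdSimplex ℝ V ∧ ∃ s ∈ Δ, ∀ v, x v ≠ 0 → v ∈ s}

/-! ### Cohen–Macaulay, Buchsbaum and Buchsbaum* complexes -/

/-- `Δ` is Cohen–Macaulay over `k`: for every face `τ` (including `τ = ∅`) the reduced homology of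
the link of `τ` vanishes in all degrees below the dimension of that link. (In degree `-1` this
holds automatically, as a complex of dimension at least `0` is not empty.) -/
def IsCohenMacaulay {V : Type u} [Fintype V] (k : Type u) [Field k]
    (Δ : PreAbstractSimplicialComplex V) : Prop :=
  ∀ τ : Finset V, τ = ∅ ∨ τ ∈ Δ → ∀ i : ℕ, i + 1 < (Δ.link τ).dimSucc →
    reducedHomology k i (Δ.link τ).realization = ⊥

/-- `Δ` is Buchsbaum over `k`: it is pure and all its vertex links are Cohen–Macaulay over `k`. -/
def IsBuchsbaum {V : Type u} [Fintype V] (k : Type u) [Field k]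
    (Δ : PreAbstractSimplicialComplex V) : Prop :=
  Δ.IsPure ∧ ∀ v ∈ Δ.vertices, (Δ.link {v}).IsCohenMacaulay k

/-- `Δ` is Buchsbaum* over `k`: it is Buchsbaum over `k` and, with `n = dim Δ`, the canonical map
`H̃_n(|Δ|; k) → H_n(|Δ|, |Δ| - p; k)` is surjective for all `p ∈ |Δ|`. (If `dim Δ = -1` there is no
such `p`.) -/
def IsBuchsbaumStar {V : Type u} [Fintype V] (k : Type u) [Field k]
    (Δ : PreAbstractSimplicialComplex V) : Prop :=
  Δ.IsBuchsbaum k ∧ ∀ n : ℕ, Δ.dimSucc = n + 1 → ∀ p : Δ.realization,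
    Function.Surjective ((toRelativeHomology k n ({p}ᶜ : Set Δ.realization)).domRestrict
      (reducedHomology k n Δ.realization))

/-- `Δ` is `m`-Buchsbaum* over `k`: it is Buchsbaum over `k`, and `Δ - A` is Buchsbaum* over `k`, of
the same dimension as `Δ`, for every set `A` of fewer than `m` vertices of `Δ`. -/
def IsMBuchsbaumStar {V : Type u} [Fintype V] (k : Type u) [Field k] (m : ℕ)
    (Δ : PreAbstractSimplicialComplex V) : Prop :=
  Δ.IsBuchsbaum k ∧ ∀ A : Finset V, (A : Set V) ⊆ Δ.vertices → A.card < m →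
    (Δ.deletion A).IsBuchsbaumStar k ∧ (Δ.deletion A).dimSucc = Δ.dimSucc

/-! ### Balanced complexes -/

open Classical in
/-- `Δ` has dimension `d - 1` and is balanced, with colouring `κ` of its vertices by `d` colours:
the two vertices of any edge have different colours. -/
def IsBalanced {V : Type u} (Δ : PreAbstractSimplicialComplex V) (d : ℕ)
    (κ : Δ.vertices → Fin d) : Prop :=
  Δ.dimSucc = d ∧ ∀ u v : Δ.vertices, u ≠ v → ({(u : V), (v : V)} : Finset V) ∈ Δ → κ u ≠ κ v

/-- The rank-selected subcomplex `Δ_S`: the faces all of whose vertices have colours in `S`. -/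
def rankSelected {V : Type u} (Δ : PreAbstractSimplicialComplex V) {d : ℕ}
    (κ : Δ.vertices → Fin d) (S : Set (Fin d)) : PreAbstractSimplicialComplex V where
  faces := {s | s ∈ Δ.faces ∧ ∀ v : Δ.vertices, (v : V) ∈ s → κ v ∈ S}
  isRelLowerSet_faces := fun _ hs => ⟨(Δ.isRelLowerSet_faces hs.1).1, fun _ hts ht =>
    ⟨(Δ.isRelLowerSet_faces hs.1).2 hts ht, fun v hv => hs.2 v (hts hv)⟩⟩

end PreAbstractSimplicialComplex

end

/-! Colours are removed one at a time, on ordinary simplicial chains. For a pure complex whose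
facets have `N` vertices, Buchsbaum becomes `LinksAcyclic` (links of nonempty faces have reduced
homology in top degree only), and the surjectivity in Buchsbaum* becomes `LocalCyclesLift` (a top
chain that is a cycle near a face `ρ` agrees near `ρ` with a global cycle). Let `K_S` be the part
with colours in `S`, and let `i ∉ S`. A face has at most one vertex of colour `i`, so the link in
`K_{S ∪ i}` of a vertex `v` of colour `i` lies in `K_S`.

Acyclicity (`LinksAcyclic.of_insert`): a cycle `c` below top degree in the link of `ρ` in `K_S`
bounds some `b` in the link in `K_{S ∪ i}`. The part `lam v b` of `b` at `v` is a cycle in the link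
of `ρ ∪ v`, again below top degree, so it is the boundary of some `a_v` there. Replacing the faces
of `b` through `v` by `a_v`, for every `v`, removes the colour `i` and keeps the boundary.

Lifting (`LocalCyclesLift.of_insert`): a local top cycle `c` of `K_S` at `ρ` is locally the boundary
of a top chain `b` of `K_{S ∪ i}`. At `ρ ∪ v` this `b` is a local cycle, so it agrees there with a
global cycle `z_v`. The sum of the `lam v z_v` is a cycle of `K_S` that agrees with `c` at `ρ`,
because a top face of `K_{S ∪ i}` has exactly one vertex of colour `i`.

Rank selection commutes with deletion of vertices, so the statement for `m` follows by applying this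
to each `Δ - A`.

The remaining work connects these conditions with singular homology. All chains live in one module
of formal sums of maps into `V → ℝ`, so that subspaces and subcomplexes become submodules.
`acyclicPair_simp` compares simplicial and singular chains by Mayer–Vietoris and small simplices;
`acyclicPair_compl_point` retracts the complement of a point onto the faces not containing its
carrier. The resulting dictionary is `linksAcyclic_iff` and `localCyclesLift_iff`. -/

noncomputable section

/-! ### Chains on tuples of points and on arbitrary maps from simplices

Chains are augmented and graded by the number of vertices, so that degree `0` is spanned by the
empty simplex. -/

/-- Formal combinations of `n`-tuples in `F`. -/
abbrev TupleChain (k : Type*) [Field k] (F : Type*) (n : ℕ) : Type _ := (Fin n → F) →₀ k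

/-- Formal combinations of (not necessarily continuous) maps from the simplex with `n` vertices. -/
abbrev MapChain (k : Type*) [Field k] (E : Type*) (n : ℕ) : Type _ :=
  (stdSimplex ℝ (Fin n) → E) →₀ k

namespace TupleChain

variable {k : Type*} [Field k] {F F' : Type*} {n : ℕ}

/-- The simplicial boundary. -/
def bd : TupleChain k F (n + 1) →ₗ[k] TupleChain k F n :=
  Finsupp.linearCombination k fun x => ∑ i : Fin (n + 1),
    (-1 : k) ^ (i : ℕ) • Finsupp.single (x ∘ i.succAbove) 1

/-- The cone with apex `b`. -/
def cone (b : F) : TupleChain k F n →ₗ[k] TupleChain k F (n + 1) :=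
  Finsupp.lmapDomain k k fun x => Fin.cons b x

/-- The map on chains induced by a map of the vertices. -/
def map (φ : F → F') : TupleChain k F n →ₗ[k] TupleChain k F' n :=
  Finsupp.lmapDomain k k fun x => φ ∘ x

lemma bd_single (x : Fin (n + 1) → F) (a : k) : bd (Finsupp.single x a) =
    a • ∑ i : Fin (n + 1), (-1 : k) ^ (i : ℕ) • Finsupp.single (x ∘ i.succAbove) (1 : k) := by
  simp [bd, Finsupp.linearCombination_single]

@[simp]
lemma cone_single (b : F) (x : Fin n → F) (a : k) :
    cone b (Finsupp.single x a) = Finsupp.single (Fin.cons b x : Fin (n + 1) → F) a := by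
  simp [cone]

@[simp]
lemma map_single (φ : F → F') (x : Fin n → F) (a : k) :
    map φ (Finsupp.single x a) = Finsupp.single (φ ∘ x) a := by
  simp [map]

lemma bd_cone_zero (b : F) (c : TupleChain k F 0) : bd (cone b c) = c := by
  induction c using Finsupp.induction_linear with
  | zero => simp
  | add f g hf hg => simp [hf, hg]
  | single x a => simp [bd_single, Subsingleton.elim _ x]

lemma bd_cone (b : F) (c : TupleChain k F (n + 1)) : bd (cone b c) = c - cone b (bd c) := by
  induction c using Finsupp.induction_linear with
  | zero => simp
  | add f g hf hg => rw [map_add, map_add, hf, hg, map_add, map_add]; abel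
  | single x a =>
    have h (i : Fin (n + 1)) : (Fin.cons b x : Fin (n + 2) → F) ∘ i.succ.succAbove =
        (Fin.cons b (x ∘ i.succAbove) : Fin (n + 1) → F) := by
      funext j
      refine Fin.cases ?_ (fun j => ?_) j <;> simp
    rw [cone_single, bd_single, Fin.sum_univ_succ, bd_single, map_smul, map_sum, smul_add,
      sub_eq_add_neg, ← smul_neg, ← Finset.sum_neg_distrib]
    congr 1
    · simp [show (Fin.cons b x : Fin (n + 2) → F) ∘ Fin.succ = x from rfl]
    · congr 1
      refine Finset.sum_congr rfl fun i _ => ?_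
      rw [h, map_smul, cone_single, Fin.val_succ, pow_succ]
      simp

lemma cons_tail (x : Fin (n + 1) → F) : (Fin.cons (x 0) (Fin.tail x) : Fin (n + 1) → F) = x :=
  Fin.cons_self_tail x

/-- A tuple is the cone from its first vertex over its tail, so the cone formula lowers the degree
by one. -/
lemma bd_bd (c : TupleChain k F (n + 2)) : bd (bd c) = 0 := by
  induction n with
  | zero =>
    induction c using Finsupp.induction_linear with
    | zero => simp
    | add f g hf hg => simp [hf, hg]
    | single x a =>
      rw [← cons_tail x, ← cone_single, bd_cone, map_sub, bd_cone_zero, sub_self]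
  | succ n ih =>
    induction c using Finsupp.induction_linear with
    | zero => simp
    | add f g hf hg => simp [hf, hg]
    | single x a =>
      rw [← cons_tail x, ← cone_single, bd_cone, map_sub, bd_cone, ih]
      simp

lemma bd_map (φ : F → F') (c : TupleChain k F (n + 1)) : bd (map φ c) = map φ (bd c) := by
  induction c using Finsupp.induction_linear with
  | zero => simp
  | add f g hf hg => simp [hf, hg]
  | single x a => simp [bd_single, Function.comp_assoc]

lemma map_cone (φ : F → F') (b : F) (c : TupleChain k F n) :
    map φ (cone b c) = cone (φ b) (map φ c) := by
  induction c using Finsupp.induction_linear with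
  | zero => simp
  | add f g hf hg => simp [hf, hg]
  | single x a =>
    rw [cone_single, map_single, map_single, cone_single]
    congr 1
    funext j
    refine Fin.cases ?_ (fun j => ?_) j <;> simp

lemma map_map {F'' : Type*} (φ : F → F') (ψ : F' → F'') (c : TupleChain k F n) :
    map ψ (map φ c) = map (ψ ∘ φ) c := by
  induction c using Finsupp.induction_linear with
  | zero => simp
  | add f g hf hg => simp [hf, hg]
  | single x a => simp [Function.comp_assoc]

end TupleChain

/-! ### Maps from simplices, and tuples pushed forward to such maps -/

namespace MapChain

variable {k : Type*} [Field k] {E E' : Type*} {n : ℕ}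

/-- The simplicial boundary. -/
def bd : MapChain k E (n + 1) →ₗ[k] MapChain k E n :=
  Finsupp.linearCombination k fun σ => ∑ i : Fin (n + 1),
    (-1 : k) ^ (i : ℕ) • Finsupp.single (σ ∘ stdSimplex.map i.succAbove) 1

lemma bd_single (σ : stdSimplex ℝ (Fin (n + 1)) → E) (a : k) : bd (Finsupp.single σ a) =
    a • ∑ i : Fin (n + 1), (-1 : k) ^ (i : ℕ) •
      Finsupp.single (σ ∘ stdSimplex.map i.succAbove) (1 : k) := by
  simp [bd, Finsupp.linearCombination_single]

section Push

variable {F F' : Type*} [AddCommGroup F] [Module ℝ F] [AddCommGroup F'] [Module ℝ F']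

/-- The point with barycentric coordinates `t` with respect to the tuple `x`. -/
def comb {n : ℕ} (x : Fin n → F) (t : stdSimplex ℝ (Fin n)) : F := ∑ j, t j • x j

lemma comb_map {m : ℕ} (f : Fin m → Fin n) (x : Fin n → F) (t : stdSimplex ℝ (Fin m)) :
    comb x (stdSimplex.map f t) = comb (x ∘ f) t := by
  classical
  simp only [comb, stdSimplex.map_coe, FunOnFinite.linearMap_apply_apply, Finset.sum_smul,
    Function.comp_apply]
  rw [← Finset.sum_fiberwise Finset.univ f fun i => t i • x (f i)]
  refine Finset.sum_congr rfl fun j _ => Finset.sum_congr rfl fun i hi => ?_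
  rw [(Finset.mem_filter.1 hi).2]

lemma map_comb (φ : F →ₗ[ℝ] F') (x : Fin n → F) (t : stdSimplex ℝ (Fin n)) :
    φ (comb x t) = comb (φ ∘ x) t := by
  simp [comb]

lemma comb_mem {C : Set F} (hC : Convex ℝ C) {x : Fin n → F} (hx : ∀ j, x j ∈ C)
    (t : stdSimplex ℝ (Fin n)) : comb x t ∈ C :=
  hC.sum_mem (fun i _ => stdSimplex.zero_le t i) (stdSimplex.sum_eq_one t) fun i _ => hx i

lemma comb_single (t : stdSimplex ℝ (Fin n)) :
    comb (fun j => Pi.single j (1 : ℝ)) t = (t : Fin n → ℝ) := by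
  funext i
  simp only [comb, Finset.sum_apply, Pi.smul_apply, smul_eq_mul, Pi.single_apply, mul_ite, mul_one,
    mul_zero, Finset.sum_ite_eq, Finset.mem_univ, if_true]

/-- The image under `g` of the affine simplices spanned by tuples. -/
def push (g : F → E) : TupleChain k F n →ₗ[k] MapChain k E n :=
  Finsupp.lmapDomain k k fun x t => g (comb x t)

@[simp]
lemma push_single (g : F → E) (x : Fin n → F) (a : k) :
    push g (Finsupp.single x a) = Finsupp.single (fun t => g (comb x t)) a := by
  simp [push]

lemma bd_push (g : F → E) (c : TupleChain k F (n + 1)) :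
    bd (push g c) = push g (TupleChain.bd c) := by
  induction c using Finsupp.induction_linear with
  | zero => simp
  | add f g hf hg => simp [hf, hg]
  | single x a =>
    simp only [push_single, bd_single, TupleChain.bd_single, map_smul, map_sum]
    congr 1
    refine Finset.sum_congr rfl fun i _ => ?_
    congr 2
    funext t
    simp [comb_map]

lemma push_map (g : F' → E) (φ : F →ₗ[ℝ] F') (c : TupleChain k F n) :
    push g (TupleChain.map φ c) = push (g ∘ φ) c := by
  induction c using Finsupp.induction_linear with
  | zero => simp
  | add f g hf hg => simp [hf, hg]
  | single x a => simp [map_comb]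

variable (k) in
/-- The tuple of the vertices of the standard simplex. -/
def verts (n : ℕ) : TupleChain k (Fin n → ℝ) n :=
  Finsupp.single (fun j => Pi.single j 1) 1

/-- The extension by zero of a map on the standard simplex. -/
def ext [Zero E] (σ : stdSimplex ℝ (Fin n) → E) (y : Fin n → ℝ) : E :=
  open Classical in if h : y ∈ stdSimplex ℝ (Fin n) then σ ⟨y, h⟩ else 0

@[simp]
lemma ext_coe [Zero E] (σ : stdSimplex ℝ (Fin n) → E) (t : stdSimplex ℝ (Fin n)) :
    ext σ t.1 = σ t := by
  simp [ext, t.2]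

/-- The tuple `verts` is the universal simplex: a natural operator on tuples extends to maps once
its value on `verts` is known. -/
lemma push_verts [Zero E] (σ : stdSimplex ℝ (Fin n) → E) :
    push (ext σ) (verts k n) = Finsupp.single σ 1 := by
  rw [verts, push_single]
  congr 1
  funext t
  rw [comb_single]
  exact ext_coe σ t

/-- The linear map sending the vertices of the standard simplex to `x`. -/
def spanMap (x : Fin n → F) : (Fin n → ℝ) →ₗ[ℝ] F := Fintype.linearCombination ℝ x

lemma map_spanMap_verts (x : Fin n → F) :
    TupleChain.map (spanMap x) (verts k n) = Finsupp.single x 1 := by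
  rw [verts, TupleChain.map_single]
  congr 1
  funext j
  simp [spanMap]

end Push

lemma bd_bd [Zero E] (c : MapChain k E (n + 2)) : bd (bd c) = 0 := by
  induction c using Finsupp.induction_linear with
  | zero => simp
  | add f g hf hg => simp [hf, hg]
  | single σ a =>
    rw [show Finsupp.single σ a = a • push (ext σ) (verts k (n + 2)) by simp [push_verts],
      map_smul, map_smul, bd_push, bd_push, TupleChain.bd_bd]
    simp

end MapChain

lemma Finsupp.map_mem_of_mem_supported {k α M : Type*} [Semiring k] [AddCommMonoid M] [Module k M]
    {s : Set α} {N : Submodule k M} (L : (α →₀ k) →ₗ[k] M)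
    (h : ∀ x ∈ s, L (Finsupp.single x 1) ∈ N) {c : α →₀ k} (hc : c ∈ Finsupp.supported k k s) :
    L c ∈ N := by
  have : Finsupp.supported k k s ≤ N.comap L := by
    rw [Finsupp.supported_eq_span_single, Submodule.span_le]
    rintro _ ⟨x, hx, rfl⟩
    exact h x hx
  exact this hc

/-! ### Chains with vertices in a subset, and null homotopies built from cones -/

namespace TupleChain

variable {k : Type*} [Field k] {F F' : Type*} {n : ℕ}

variable (k) in
/-- The chains all of whose vertices are in `C`. -/
def tuplesIn (C : Set F) (n : ℕ) : Submodule k (TupleChain k F n) :=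
  Finsupp.supported k k {x | ∀ j, x j ∈ C}

lemma single_mem_tuplesIn {C : Set F} {x : Fin n → F} (hx : ∀ j, x j ∈ C) (a : k) :
    Finsupp.single x a ∈ tuplesIn k C n :=
  Finsupp.single_mem_supported k a hx

lemma bd_mem_tuplesIn {C : Set F} {c : TupleChain k F (n + 1)} (hc : c ∈ tuplesIn k C (n + 1)) :
    bd c ∈ tuplesIn k C n := by
  refine Finsupp.map_mem_of_mem_supported bd (fun x hx => ?_) hc
  rw [bd_single, one_smul]
  exact Submodule.sum_mem _ fun i _ => Submodule.smul_mem _ _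
    (single_mem_tuplesIn (fun j => hx _) 1)

lemma cone_mem_tuplesIn {C : Set F} {b : F} (hb : b ∈ C) {c : TupleChain k F n}
    (hc : c ∈ tuplesIn k C n) : cone b c ∈ tuplesIn k C (n + 1) := by
  refine Finsupp.map_mem_of_mem_supported (cone b) (fun x hx => ?_) hc
  rw [cone_single]
  refine single_mem_tuplesIn (fun j => ?_) 1
  refine Fin.cases ?_ (fun j => ?_) j
  · simpa using hb
  · simpa using hx j

lemma map_mem_tuplesIn {C : Set F} {C' : Set F'} {φ : F → F'} (hφ : Set.MapsTo φ C C')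
    {c : TupleChain k F n} (hc : c ∈ tuplesIn k C n) : map φ c ∈ tuplesIn k C' n := by
  refine Finsupp.map_mem_of_mem_supported (map φ) (fun x hx => ?_) hc
  rw [map_single]
  exact single_mem_tuplesIn (fun j => hφ (hx j)) 1

/-- The operator with `contraction x = cone (b x) (f x - contraction (bd x))` on tuples `x`; it is
a null homotopy of `f`. -/
def contraction (f : ∀ n, TupleChain k F n →ₗ[k] TupleChain k F' n) (b : ∀ n, (Fin n → F) → F') :
    ∀ n, TupleChain k F n →ₗ[k] TupleChain k F' (n + 1)
  | 0 => 0
  | n + 1 => Finsupp.linearCombination k fun x =>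
      cone (b (n + 1) x) (f (n + 1) (Finsupp.single x 1) -
        contraction f b n (bd (Finsupp.single x 1)))

lemma contraction_single (f : ∀ n, TupleChain k F n →ₗ[k] TupleChain k F' n)
    (b : ∀ n, (Fin n → F) → F') (x : Fin (n + 1) → F) :
    contraction f b (n + 1) (Finsupp.single x 1) = cone (b (n + 1) x)
      (f (n + 1) (Finsupp.single x 1) - contraction f b n (bd (Finsupp.single x 1))) := by
  simp [contraction, Finsupp.linearCombination_single]

/-- By induction the chain under the cone is a cycle, and a cone over a cycle bounds that cycle. The
condition `f 0 = 0` starts the induction. -/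
lemma bd_contraction (f : ∀ n, TupleChain k F n →ₗ[k] TupleChain k F' n)
    (b : ∀ n, (Fin n → F) → F') (hf0 : f 0 = 0) (hf : ∀ n c, bd (f (n + 1) c) = f n (bd c))
    (c : TupleChain k F (n + 1)) :
    bd (contraction f b (n + 1) c) + contraction f b n (bd c) = f (n + 1) c := by
  induction n with
  | zero =>
    induction c using Finsupp.induction_linear with
    | zero => simp
    | add g g' hg hg' => simp only [map_add, ← hg, ← hg']; abel
    | single x a =>
      rw [← Finsupp.smul_single_one]
      simp only [map_smul, contraction_single, bd_cone, map_sub, hf, hf0]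
      simp [contraction]
  | succ n ih =>
    induction c using Finsupp.induction_linear with
    | zero => simp
    | add g g' hg hg' => simp only [map_add, ← hg, ← hg']; abel
    | single x a =>
      have h := ih (bd (Finsupp.single x 1))
      rw [bd_bd, map_zero, add_zero] at h
      rw [← Finsupp.smul_single_one]
      simp only [map_smul, contraction_single, bd_cone, map_sub, hf, h]
      rw [← smul_add]
      simp

lemma map_contraction {F₂ F₂' : Type*} {f : ∀ n, TupleChain k F n →ₗ[k] TupleChain k F' n}
    {b : ∀ n, (Fin n → F) → F'} {f₂ : ∀ n, TupleChain k F₂ n →ₗ[k] TupleChain k F₂' n}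
    {b₂ : ∀ n, (Fin n → F₂) → F₂'} {φ : F → F₂} {φ' : F' → F₂'}
    (hf : ∀ n c, map φ' (f n c) = f₂ n (map φ c)) (hb : ∀ n x, φ' (b (n + 1) x) = b₂ (n + 1) (φ ∘ x))
    (c : TupleChain k F n) :
    map φ' (contraction f b n c) = contraction f₂ b₂ n (map φ c) := by
  induction n with
  | zero => simp [contraction]
  | succ n ih =>
    induction c using Finsupp.induction_linear with
    | zero => simp
    | add g g' hg hg' => simp only [map_add, hg, hg']
    | single x a =>
      rw [← Finsupp.smul_single_one]
      simp only [map_smul, map_single, contraction_single, map_cone, map_sub, hf, ih, ← bd_map, hb]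

lemma contraction_mem_tuplesIn {f : ∀ n, TupleChain k F n →ₗ[k] TupleChain k F' n}
    {b : ∀ n, (Fin n → F) → F'} {C : Set F} {C' : Set F'}
    (hf : ∀ n, ∀ c ∈ tuplesIn k C n, f n c ∈ tuplesIn k C' n)
    (hb : ∀ n (x : Fin (n + 1) → F), (∀ j, x j ∈ C) → b (n + 1) x ∈ C')
    {c : TupleChain k F n} (hc : c ∈ tuplesIn k C n) :
    contraction f b n c ∈ tuplesIn k C' (n + 1) := by
  induction n with
  | zero => simp [contraction]
  | succ n ih =>
    refine Finsupp.map_mem_of_mem_supported _ (fun x hx => ?_) hc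
    rw [contraction_single]
    have h1 := single_mem_tuplesIn (k := k) hx 1
    exact cone_mem_tuplesIn (hb _ _ hx) (Submodule.sub_mem _ (hf _ _ h1) (ih (bd_mem_tuplesIn h1)))

/-! ### Barycentric subdivision and the prism operator on tuples -/

section Barycentric

variable [AddCommGroup F] [Module ℝ F] [AddCommGroup F'] [Module ℝ F']

/-- The barycentre of a tuple. -/
def bary (n : ℕ) (x : Fin n → F) : F := (n : ℝ)⁻¹ • ∑ j, x j

lemma map_bary (φ : F →ₗ[ℝ] F') (x : Fin n → F) : φ (bary n x) = bary n (φ ∘ x) := by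
  simp [bary]

lemma bary_mem {C : Set F} (hC : Convex ℝ C) {x : Fin (n + 1) → F} (hx : ∀ j, x j ∈ C) :
    bary (n + 1) x ∈ C := by
  rw [bary, Finset.smul_sum]
  refine hC.sum_mem (fun i _ => by positivity) ?_ fun i _ => hx i
  simp only [Finset.sum_const, Finset.card_univ, Fintype.card_fin, nsmul_eq_mul]
  exact mul_inv_cancel₀ (by positivity)

/-- Barycentric subdivision. -/
def sd : ∀ n, TupleChain k F n →ₗ[k] TupleChain k F n
  | 0 => LinearMap.id
  | n + 1 => Finsupp.linearCombination k fun x =>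
      cone (bary (n + 1) x) (sd n (bd (Finsupp.single x 1)))

lemma sd_single (x : Fin (n + 1) → F) : sd (k := k) (n + 1) (Finsupp.single x 1) =
    cone (bary (n + 1) x) (sd n (bd (Finsupp.single x 1))) := by
  simp [sd, Finsupp.linearCombination_single]

lemma bd_sd (c : TupleChain k F (n + 1)) : bd (sd (n + 1) c) = sd n (bd c) := by
  induction n with
  | zero =>
    induction c using Finsupp.induction_linear with
    | zero => simp
    | add g g' hg hg' => simp only [map_add, hg, hg']
    | single x a =>
      rw [← Finsupp.smul_single_one]
      simp only [map_smul, sd_single, bd_cone_zero]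
  | succ n ih =>
    induction c using Finsupp.induction_linear with
    | zero => simp
    | add g g' hg hg' => simp only [map_add, hg, hg']
    | single x a =>
      rw [← Finsupp.smul_single_one]
      simp only [map_smul, sd_single, bd_cone, ih, bd_bd, map_zero, sub_zero]

lemma map_sd (φ : F →ₗ[ℝ] F') (c : TupleChain k F n) : map φ (sd n c) = sd n (map φ c) := by
  induction n with
  | zero => simp [sd]
  | succ n ih =>
    induction c using Finsupp.induction_linear with
    | zero => simp
    | add g g' hg hg' => simp only [map_add, hg, hg']
    | single x a =>
      rw [← Finsupp.smul_single_one]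
      simp only [map_smul, map_single, sd_single, map_cone, ih, ← bd_map, map_bary]

lemma sd_mem_tuplesIn {C : Set F} (hC : Convex ℝ C) {c : TupleChain k F n}
    (hc : c ∈ tuplesIn k C n) : sd n c ∈ tuplesIn k C n := by
  induction n with
  | zero => exact hc
  | succ n ih =>
    refine Finsupp.map_mem_of_mem_supported _ (fun x hx => ?_) hc
    rw [sd_single]
    exact cone_mem_tuplesIn (bary_mem hC hx) (ih (bd_mem_tuplesIn (single_mem_tuplesIn hx 1)))

/-- The null homotopy of `id - sd`. -/
def sdHomotopy (n : ℕ) : TupleChain k F n →ₗ[k] TupleChain k F (n + 1) :=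
  contraction (fun n => LinearMap.id - sd n) bary n

lemma bd_sdHomotopy (c : TupleChain k F (n + 1)) :
    bd (sdHomotopy (n + 1) c) + sdHomotopy n (bd c) = c - sd (n + 1) c := by
  refine bd_contraction _ _ ?_ ?_ c
  · simp only [sd]; exact sub_self (LinearMap.id : TupleChain k F 0 →ₗ[k] TupleChain k F 0)
  · intro n c; simp [bd_sd]

lemma map_sdHomotopy (φ : F →ₗ[ℝ] F') (c : TupleChain k F n) :
    map φ (sdHomotopy n c) = sdHomotopy n (map φ c) :=
  map_contraction (by intro n c; simp [map_sd]) (fun n x => map_bary φ x) c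

lemma sdHomotopy_mem_tuplesIn {C : Set F} (hC : Convex ℝ C) {c : TupleChain k F n}
    (hc : c ∈ tuplesIn k C n) : sdHomotopy n c ∈ tuplesIn k C (n + 1) := by
  refine contraction_mem_tuplesIn (C := C) (fun m c h => ?_) (fun m x h => bary_mem hC h) hc
  rw [LinearMap.sub_apply, LinearMap.id_apply]
  exact Submodule.sub_mem _ h (sd_mem_tuplesIn hC h)

/-- The prism operator, a null homotopy of the difference of the inclusions at `1` and at `0`. -/
def prism (n : ℕ) : TupleChain k F n →ₗ[k] TupleChain k (F × ℝ) (n + 1) :=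
  contraction (fun _ => map (fun x => (x, 1)) - map (fun x => (x, 0))) (fun n x => (bary n x, 0)) n

lemma bd_prism (c : TupleChain k F (n + 1)) :
    bd (prism (n + 1) c) + prism n (bd c) = map (fun x => (x, 1)) c - map (fun x => (x, 0)) c := by
  refine bd_contraction _ _ ?_ ?_ c
  · ext x : 2
    simp only [LinearMap.comp_apply, LinearMap.sub_apply, Finsupp.lsingle_apply, map_single]
    rw [Subsingleton.elim ((fun x => (x, (1 : ℝ))) ∘ x) ((fun x => (x, (0 : ℝ))) ∘ x)]
    simp
  · intro n c; simp [bd_map]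

lemma map_prism (φ : F →ₗ[ℝ] F') (c : TupleChain k F n) :
    map (Prod.map φ id) (prism n c) = prism n (map φ c) :=
  map_contraction (by intro n c; simp [map_map]; rfl) (fun n x => by simp [map_bary]) c

lemma prism_mem_tuplesIn {C : Set F} (hC : Convex ℝ C) {c : TupleChain k F n}
    (hc : c ∈ tuplesIn k C n) : prism n c ∈ tuplesIn k (C ×ˢ Set.Icc (0 : ℝ) 1) (n + 1) := by
  refine contraction_mem_tuplesIn (C := C) (fun m c h => ?_) (fun m x h => ?_) hc
  · rw [LinearMap.sub_apply]
    exact Submodule.sub_mem _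
      (map_mem_tuplesIn (fun x hx => Set.mk_mem_prod hx (Set.right_mem_Icc.2 zero_le_one)) h)
      (map_mem_tuplesIn (fun x hx => Set.mk_mem_prod hx (Set.left_mem_Icc.2 zero_le_one)) h)
  · exact Set.mk_mem_prod (bary_mem hC h) (Set.left_mem_Icc.2 zero_le_one)

end Barycentric

end TupleChain

/-! ### Subdivision shrinks diameters -/

namespace TupleChain

variable {k : Type*} [Field k] {F : Type*} [NormedAddCommGroup F] [NormedSpace ℝ F] {n : ℕ}

variable (k) in
/-- The chains on tuples in `C` with pairwise distances at most `D`. -/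
def smallTuples (C : Set F) (D : ℝ) (n : ℕ) : Submodule k (TupleChain k F n) :=
  Finsupp.supported k k {x | (∀ j, x j ∈ C) ∧ ∀ i j, dist (x i) (x j) ≤ D}

lemma smallTuples_mono {C C' : Set F} {D D' : ℝ} (hC : C ⊆ C') (hD : D ≤ D') :
    smallTuples k C D n ≤ smallTuples k C' D' n :=
  Finsupp.supported_mono fun _ hx => ⟨fun j => hC (hx.1 j), fun i j => (hx.2 i j).trans hD⟩

/-- The difference from a vertex to the barycentre is the mean of `n + 1` differences of vertices,
one of which is zero. -/
lemma dist_bary_le {D : ℝ} {x : Fin (n + 1) → F} (hx : ∀ i j, dist (x i) (x j) ≤ D)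
    (j : Fin (n + 1)) : dist (x j) (bary (n + 1) x) ≤ (1 - 1 / ((n + 1 : ℕ) : ℝ)) * D := by
  have hn : ((n + 1 : ℕ) : ℝ) ≠ 0 := by positivity
  have h1 : x j - bary (n + 1) x = ((n + 1 : ℕ) : ℝ)⁻¹ • ∑ i, (x j - x i) := by
    rw [Finset.sum_sub_distrib, smul_sub, bary]
    congr 1
    simp only [Finset.sum_const, Finset.card_univ, Fintype.card_fin]
    rw [← Nat.cast_smul_eq_nsmul ℝ, smul_smul, inv_mul_cancel₀ hn, one_smul]
  have h2 : ∑ i, ‖x j - x i‖ ≤ n * D := by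
    rw [← Finset.add_sum_erase _ _ (Finset.mem_univ j), sub_self, norm_zero, zero_add]
    refine (Finset.sum_le_card_nsmul _ _ D fun i _ => ?_).trans ?_
    · rw [← dist_eq_norm]; exact hx j i
    · simp
  rw [dist_eq_norm, h1, norm_smul, norm_inv, Real.norm_natCast]
  calc ((n + 1 : ℕ) : ℝ)⁻¹ * ‖∑ i, (x j - x i)‖ ≤ ((n + 1 : ℕ) : ℝ)⁻¹ * (n * D) := by
        gcongr
        exact (norm_sum_le _ _).trans h2
    _ = (1 - 1 / ((n + 1 : ℕ) : ℝ)) * D := by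
        field_simp
        push_cast
        ring

lemma sd_mem_smallTuples {C : Set F} (hC : Convex ℝ C) {D : ℝ} (hD : 0 ≤ D) {c : TupleChain k F n}
    (hc : c ∈ smallTuples k C D n) : sd n c ∈ smallTuples k C ((1 - 1 / (n : ℝ)) * D) n := by
  induction n generalizing C with
  | zero =>
    have : smallTuples k C ((1 - 1 / ((0 : ℕ) : ℝ)) * D) 0 = ⊤ := by
      rw [smallTuples, eq_top_iff, ← Finsupp.supported_univ]
      exact Finsupp.supported_mono fun _ _ => ⟨fun j => j.elim0, fun j => j.elim0⟩
    rw [this]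
    trivial
  | succ n ih =>
    refine Finsupp.map_mem_of_mem_supported _ (fun x hx => ?_) hc
    -- Passing from `C` to the hull of the tuple lets the induction also record that the subdivided
    -- faces stay in the ball around the barycentre, which bounds the distances to the cone apex.
    set H := convexHull ℝ (Set.range x)
    have hH : H ⊆ C := convexHull_min (by rintro _ ⟨j, rfl⟩; exact hx.1 j) hC
    have hxH (j) : x j ∈ H := subset_convexHull ℝ _ ⟨j, rfl⟩
    have hb : bary (n + 1) x ∈ H := bary_mem (convex_convexHull ℝ _) hxH
    have hball : H ⊆ Metric.closedBall (bary (n + 1) x) ((1 - 1 / ((n + 1 : ℕ) : ℝ)) * D) :=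
      convexHull_min (by rintro _ ⟨j, rfl⟩; exact dist_bary_le hx.2 j) (convex_closedBall _ _)
    have hbd : bd (Finsupp.single x 1) ∈ smallTuples k H D n := by
      rw [bd_single, one_smul]
      exact Submodule.sum_mem _ fun i _ => Submodule.smul_mem _ _
        (Finsupp.single_mem_supported k _ ⟨fun j => hxH _, fun i j => hx.2 _ _⟩)
    have h2 : sd n (bd (Finsupp.single x 1)) ∈
        smallTuples k H ((1 - 1 / ((n + 1 : ℕ) : ℝ)) * D) n := by
      -- For `n = 0` the convention `1 / 0 = 0` would give the factor `1`, which is not below `1 - 1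
      -- / 1`; but the conditions on an empty tuple are vacuous.
      rcases n with _ | n
      · rw [show smallTuples k H ((1 - 1 / ((0 + 1 : ℕ) : ℝ)) * D) 0 = ⊤ by
          rw [smallTuples, eq_top_iff, ← Finsupp.supported_univ]
          exact Finsupp.supported_mono fun _ _ => ⟨fun j => j.elim0, fun j => j.elim0⟩]
        trivial
      · refine smallTuples_mono subset_rfl ?_ (ih (convex_convexHull ℝ _) hbd)
        gcongr
        simp
    rw [sd_single]
    refine smallTuples_mono hH le_rfl ?_
    refine Finsupp.map_mem_of_mem_supported (cone _) (fun y hy => ?_) h2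
    rw [cone_single]
    refine Finsupp.single_mem_supported k _ ⟨?_, ?_⟩
    · intro j
      refine Fin.cases ?_ (fun j => ?_) j
      · simpa using hb
      · simpa using hy.1 j
    · intro i j
      refine Fin.cases ?_ (fun i => ?_) i <;> refine Fin.cases ?_ (fun j => ?_) j
      · simp only [Fin.cons_zero, dist_self]
        exact dist_nonneg.trans (hball hb)
      · simpa [dist_comm] using hball (hy.1 j)
      · simpa using hball (hy.1 i)
      · simpa using hy.2 i j

lemma iterate_sd_mem_smallTuples {C : Set F} (hC : Convex ℝ C) {D : ℝ} (hD : 0 ≤ D)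
    {c : TupleChain k F n} (hc : c ∈ smallTuples k C D n) (N : ℕ) :
    (sd n)^[N] c ∈ smallTuples k C ((1 - 1 / (n : ℝ)) ^ N * D) n := by
  have hr : 0 ≤ 1 - 1 / (n : ℝ) := by
    rcases n with _ | n
    · simp
    · rw [sub_nonneg, div_le_one (by positivity)]
      simp
  induction N with
  | zero => simpa using hc
  | succ N ih =>
    rw [Function.iterate_succ_apply', pow_succ', mul_assoc]
    exact sd_mem_smallTuples hC (by positivity) ih

end TupleChain

/-! ### Transport of the operators from tuples to maps -/

namespace MapChain

variable {k : Type*} [Field k] {E : Type*} {n : ℕ}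

open TupleChain

section Algebra

variable {F F' : Type*} [AddCommGroup F] [Module ℝ F] [AddCommGroup F'] [Module ℝ F']

lemma push_congr {C : Set F} (hC : Convex ℝ C) {g g' : F → E} (h : Set.EqOn g g' C)
    {c : TupleChain k F n} (hc : c ∈ tuplesIn k C n) : push g c = push g' c := by
  rw [← sub_eq_zero, ← LinearMap.sub_apply, ← Submodule.mem_bot k]
  refine Finsupp.map_mem_of_mem_supported _ (fun x hx => ?_) hc
  rw [LinearMap.sub_apply, push_single, push_single, Submodule.mem_bot, sub_eq_zero]
  congr 1
  funext t
  exact h (comb_mem hC hx t)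

lemma verts_mem : verts k n ∈ tuplesIn k (stdSimplex ℝ (Fin n)) n :=
  single_mem_tuplesIn (fun j => single_mem_stdSimplex ℝ j) 1

/-- Composition of the simplices with a map. -/
def post {E' : Type*} (φ : E → E') : MapChain k E n →ₗ[k] MapChain k E' n :=
  Finsupp.lmapDomain k k fun σ => φ ∘ σ

@[simp]
lemma post_single {E' : Type*} (φ : E → E') (σ : stdSimplex ℝ (Fin n) → E) (a : k) :
    post φ (Finsupp.single σ a) = Finsupp.single (φ ∘ σ) a := by
  simp [post]

lemma bd_post {E' : Type*} (φ : E → E') (c : MapChain k E (n + 1)) :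
    bd (post φ c) = post φ (bd c) := by
  induction c using Finsupp.induction_linear with
  | zero => simp
  | add f g hf hg => simp [hf, hg]
  | single x a => simp [bd_single, Function.comp_assoc]

lemma post_push {E' : Type*} (φ : E → E') (g : F → E) (c : TupleChain k F n) :
    post φ (push g c) = push (φ ∘ g) c := by
  induction c using Finsupp.induction_linear with
  | zero => simp
  | add f g hf hg => simp only [map_add, hf, hg]
  | single x a => simp only [push_single, post_single]; rfl

lemma push_map_prodMk (h : E → ℝ → E) (g : F → E) (s : ℝ) (c : TupleChain k F n) :
    push (fun p : F × ℝ => h (g p.1) p.2) (map (fun x => (x, s)) c) =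
      push (fun x => h (g x) s) c := by
  induction c using Finsupp.induction_linear with
  | zero => simp
  | add f g hf hg => simp only [map_add, hf, hg]
  | single x a =>
    rw [map_single, push_single, push_single]
    congr 1
    funext t
    have : comb ((fun x => (x, s)) ∘ x) t = (comb x t, s) := by
      ext
      · simp [comb, Prod.fst_sum]
      · simp [comb, Prod.snd_sum, ← Finset.sum_mul]
    rw [this]

variable [Zero E]

/-- The operator given on each simplex by the chain `θ` on the standard simplex. -/
def op {m : ℕ} (θ : TupleChain k (Fin n → ℝ) m) : MapChain k E n →ₗ[k] MapChain k E m :=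
  Finsupp.linearCombination k fun σ => push (ext σ) θ

/-- This is the method of acyclic models: naturality under `spanMap` carries the universal chain `θ`
to `Θ` of any tuple. The chain `θ` has to stay in the simplex because `ext σ` is meaningful only
there. -/
lemma op_push {m : ℕ} {θ : TupleChain k (Fin n → ℝ) m}
    (hθ : θ ∈ tuplesIn k (stdSimplex ℝ (Fin n)) m) {Θ : TupleChain k F n →ₗ[k] TupleChain k F m}
    (h : ∀ x : Fin n → F, map (spanMap x) θ = Θ (Finsupp.single x 1)) (g : F → E)
    (c : TupleChain k F n) : op θ (push g c) = push g (Θ c) := by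
  induction c using Finsupp.induction_linear with
  | zero => simp
  | add f g hf hg => simp only [map_add, hf, hg]
  | single x a =>
    rw [← Finsupp.smul_single_one]
    simp only [map_smul, ← h, push_single, push_map, op, Finsupp.linearCombination_single, one_smul]
    congr 1
    exact push_congr (convex_stdSimplex ℝ _) (fun y hy => ext_coe _ ⟨y, hy⟩) hθ

lemma push_induction {motive : MapChain k E n → Prop} (c : MapChain k E n) (zero : motive 0)
    (add : ∀ c d, motive c → motive d → motive (c + d))
    (push : ∀ (a : k) (σ : stdSimplex ℝ (Fin n) → E), motive (a • push (ext σ) (verts k n))) :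
    motive c := by
  induction c using Finsupp.induction_linear with
  | zero => exact zero
  | add f g hf hg => exact add f g hf hg
  | single σ a =>
    have := push a σ
    rwa [push_verts, Finsupp.smul_single_one] at this

/-- Barycentric subdivision. -/
def sd (n : ℕ) : MapChain k E n →ₗ[k] MapChain k E n := op (TupleChain.sd n (verts k n))

/-- The null homotopy of `id - sd`. -/
def sdHomotopy (n : ℕ) : MapChain k E n →ₗ[k] MapChain k E (n + 1) :=
  op (TupleChain.sdHomotopy n (verts k n))

lemma sd_push (g : F → E) (c : TupleChain k F n) : sd n (push g c) = push g (TupleChain.sd n c) :=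
  op_push (sd_mem_tuplesIn (convex_stdSimplex ℝ _) verts_mem)
    (fun x => by rw [map_sd, map_spanMap_verts]) g c

lemma sdHomotopy_push (g : F → E) (c : TupleChain k F n) :
    sdHomotopy n (push g c) = push g (TupleChain.sdHomotopy n c) :=
  op_push (sdHomotopy_mem_tuplesIn (convex_stdSimplex ℝ _) verts_mem)
    (fun x => by rw [map_sdHomotopy, map_spanMap_verts]) g c

lemma bd_sd (c : MapChain k E (n + 1)) : bd (sd (n + 1) c) = sd n (bd c) := by
  induction c using push_induction with
  | zero => simp
  | add c d hc hd => simp only [map_add, hc, hd]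
  | push a σ => simp only [map_smul, sd_push, bd_push, TupleChain.bd_sd]

lemma bd_sdHomotopy (c : MapChain k E (n + 1)) :
    bd (sdHomotopy (n + 1) c) + sdHomotopy n (bd c) = c - sd (n + 1) c := by
  induction c using push_induction with
  | zero => simp
  | add c d hc hd => simp only [map_add, add_sub_add_comm, ← hc, ← hd]; abel
  | push a σ =>
    simp only [map_smul, sd_push, sdHomotopy_push, bd_push, ← smul_add, ← smul_sub, ← map_add,
      ← map_sub, TupleChain.bd_sdHomotopy]

/-- The prism operator of a homotopy `h`. -/
def prism (h : E → ℝ → E) (n : ℕ) : MapChain k E n →ₗ[k] MapChain k E (n + 1) :=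
  Finsupp.linearCombination k fun σ =>
    push (fun p : (Fin n → ℝ) × ℝ => h (ext σ p.1) p.2) (TupleChain.prism n (verts k n))

lemma prism_push (h : E → ℝ → E) (g : F → E) (c : TupleChain k F n) :
    prism h n (push g c) = push (fun p : F × ℝ => h (g p.1) p.2) (TupleChain.prism n c) := by
  induction c using Finsupp.induction_linear with
  | zero => simp
  | add f g hf hg => simp only [map_add, hf, hg]
  | single x a =>
    rw [← Finsupp.smul_single_one]
    have h1 : TupleChain.prism n (Finsupp.single x (1 : k)) =
        map (((spanMap x).prodMap LinearMap.id : (Fin n → ℝ) × ℝ →ₗ[ℝ] F × ℝ))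
          (TupleChain.prism n (verts k n)) := by
      rw [← map_spanMap_verts, ← map_prism]
      rfl
    simp only [map_smul, push_single, h1, push_map, prism, Finsupp.linearCombination_single,
      one_smul]
    congr 1
    refine push_congr ((convex_stdSimplex ℝ (Fin n)).prod (convex_Icc 0 1)) ?_
      (prism_mem_tuplesIn (convex_stdSimplex ℝ _) verts_mem)
    rintro ⟨y, s⟩ ⟨hy, -⟩
    exact congrArg (h · s) (ext_coe _ ⟨y, hy⟩)

lemma bd_prism (h : E → ℝ → E) (c : MapChain k E (n + 1)) :
    bd (prism h (n + 1) c) + prism h n (bd c) = post (h · 1) c - post (h · 0) c := by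
  induction c using push_induction with
  | zero => simp
  | add c d hc hd => simp only [map_add, add_sub_add_comm, ← hc, ← hd]; abel
  | push a σ =>
    simp only [map_smul, prism_push, bd_push, ← smul_add, ← smul_sub, ← map_add,
      TupleChain.bd_prism]
    rw [map_sub, push_map_prodMk, push_map_prodMk, post_push, post_push]
    rfl

end Algebra

end MapChain

namespace MapChain

open TupleChain

variable {k : Type*} [Field k] {E : Type*} {n : ℕ}

/-! ### Acyclic pairs of subcomplexes -/

/-- The homology of `Q` relative to `P` vanishes in positive degrees. -/
def AcyclicPair (Q P : ∀ n, Submodule k (MapChain k E n)) : Prop :=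
  ∀ n, ∀ c ∈ Q (n + 1), bd c ∈ P n → ∃ p ∈ P (n + 1), ∃ q ∈ Q (n + 2), c = p + bd q

/-- The homology of `Q` vanishes. -/
def IsExact (Q : ∀ n, Submodule k (MapChain k E n)) : Prop :=
  (∀ c ∈ Q 0, ∃ b ∈ Q 1, bd b = c) ∧ ∀ n, ∀ c ∈ Q (n + 1), bd c = 0 → ∃ b ∈ Q (n + 2), bd b = c

/-- `Q` is stable under the boundary. -/
def IsSubcomplex (Q : ∀ n, Submodule k (MapChain k E n)) : Prop :=
  ∀ n, ∀ c ∈ Q (n + 1), bd c ∈ Q n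

lemma AcyclicPair.trans {R Q P : ∀ n, Submodule k (MapChain k E n)} (h₁ : AcyclicPair R Q)
    (h₂ : AcyclicPair Q P) (hQR : ∀ n, Q n ≤ R n) (hPQ : ∀ n, P n ≤ Q n) [Zero E] :
    AcyclicPair R P := by
  intro n c hc hbd
  obtain ⟨q, hq, r, hr, rfl⟩ := h₁ n c hc (hPQ n hbd)
  rw [map_add, bd_bd, add_zero] at hbd
  obtain ⟨p, hp, q', hq', rfl⟩ := h₂ n q hq hbd
  exact ⟨p, hp, q' + r, add_mem (hQR _ hq') hr, by rw [map_add, add_assoc]⟩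

lemma AcyclicPair.of_isExact [Zero E] {Q P : ∀ n, Submodule k (MapChain k E n)} (hQ : IsExact Q)
    (hP : IsExact P) (hPQ : ∀ n, P n ≤ Q n) : AcyclicPair Q P := by
  intro n c hc hbd
  obtain ⟨b, hb, hbc⟩ : ∃ b ∈ P (n + 1), bd b = bd c := by
    cases n with
    | zero => exact hP.1 _ hbd
    | succ n => exact hP.2 n _ hbd (bd_bd c)
  obtain ⟨q, hq, hqc⟩ := hQ.2 n (c - b) (sub_mem hc (hPQ _ hb)) (by rw [map_sub, hbc, sub_self])
  exact ⟨b, hb, q, hq, by rw [hqc]; abel⟩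

lemma AcyclicPair.isExact [Zero E] {Q P : ∀ n, Submodule k (MapChain k E n)}
    (h : AcyclicPair Q P) (hP : IsExact P) (hPQ : ∀ n, P n ≤ Q n) (h0 : Q 0 ≤ P 0) :
    IsExact Q := by
  refine ⟨fun c hc => ?_, fun n c hc hbd => ?_⟩
  · obtain ⟨b, hb, rfl⟩ := hP.1 c (h0 hc)
    exact ⟨b, hPQ _ hb, rfl⟩
  · obtain ⟨p, hp, q, hq, rfl⟩ := h n c hc (hbd ▸ zero_mem _)
    rw [map_add, bd_bd, add_zero] at hbd
    obtain ⟨b, hb, rfl⟩ := hP.2 n p hp hbd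
    exact ⟨b + q, add_mem (hPQ _ hb) hq, map_add _ _ _⟩

/-- This is Mayer–Vietoris on elements. For `c = q₁ + q₂` with boundary `p₁ + p₂`, the defect `bd q₁
- p₁ = p₂ - bd q₂` lies in both `Q`s with boundary in both `P`s. The pair of intersections writes it
as `y + bd z`, and then `q₁ - z` and `q₂ + z` can be treated separately. -/
lemma AcyclicPair.sup [Zero E] {Q₁ Q₂ P₁ P₂ : ∀ n, Submodule k (MapChain k E n)}
    (h₁ : AcyclicPair Q₁ P₁) (h₂ : AcyclicPair Q₂ P₂)
    (h : AcyclicPair (fun n => Q₁ n ⊓ Q₂ n) (fun n => P₁ n ⊓ P₂ n))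
    (hP₁ : ∀ n, P₁ n ≤ Q₁ n) (hP₂ : ∀ n, P₂ n ≤ Q₂ n)
    (hQ₁ : IsSubcomplex Q₁) (hQ₂ : IsSubcomplex Q₂) (hP₁' : IsSubcomplex P₁)
    (hP₂' : IsSubcomplex P₂) (h0₁ : P₁ 0 = ⊤) (h0₂ : P₂ 0 = ⊤) :
    AcyclicPair (fun n => Q₁ n ⊔ Q₂ n) (fun n => P₁ n ⊔ P₂ n) := by
  intro n c hc hbd
  obtain ⟨q₁, hq₁, q₂, hq₂, rfl⟩ := Submodule.mem_sup.1 hc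
  obtain ⟨p₁, hp₁, p₂, hp₂, hp⟩ := Submodule.mem_sup.1 hbd
  set x := bd q₁ - p₁ with hx
  have hx' : x = p₂ - bd q₂ := by
    rw [hx, sub_eq_sub_iff_add_eq_add, ← map_add, ← hp, add_comm]
  have hxQ : x ∈ Q₁ n ⊓ Q₂ n :=
    ⟨sub_mem (hQ₁ _ _ hq₁) (hP₁ _ hp₁), hx' ▸ sub_mem (hP₂ _ hp₂) (hQ₂ _ _ hq₂)⟩
  obtain ⟨y, hy, z, hz, hyz⟩ : ∃ y ∈ P₁ n ⊓ P₂ n, ∃ z ∈ Q₁ (n + 1) ⊓ Q₂ (n + 1),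
      x = y + bd z := by
    cases n with
    -- An acyclic pair gives nothing in degree `0`, but there both `P`s are everything.
    | zero => exact ⟨x, by simp [h0₁, h0₂], 0, zero_mem _, by simp⟩
    | succ n =>
      refine h n x hxQ ⟨?_, ?_⟩
      · rw [hx, map_sub, bd_bd, zero_sub]
        exact neg_mem (hP₁' _ _ hp₁)
      · rw [hx', map_sub, bd_bd, sub_zero]
        exact hP₂' _ _ hp₂
  obtain ⟨a, ha, b, hb, hab⟩ := h₁ n (q₁ - z) (sub_mem hq₁ hz.1) (by
    rw [map_sub, show bd q₁ - bd z = p₁ + y by rw [← sub_eq_iff_eq_add'.2 hyz, hx]; abel]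
    exact add_mem hp₁ hy.1)
  obtain ⟨a', ha', b', hb', hab'⟩ := h₂ n (q₂ + z) (add_mem hq₂ hz.2) (by
    rw [map_add, show bd q₂ + bd z = p₂ - y by rw [← sub_eq_iff_eq_add'.2 hyz, hx']; abel]
    exact sub_mem hp₂ hy.2)
  refine ⟨a + a', Submodule.add_mem_sup ha ha', b + b', Submodule.add_mem_sup hb hb', ?_⟩
  rw [show q₁ + q₂ = (q₁ - z) + (q₂ + z) by abel, hab, hab', map_add]
  abel

/-! ### Continuous simplices in a subset -/

section Topology

variable [TopologicalSpace E]

variable (k) in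
/-- The singular chains of the subspace `A`. -/
def chainsIn (A : Set E) (n : ℕ) : Submodule k (MapChain k E n) :=
  Finsupp.supported k k {σ | Continuous σ ∧ ∀ t, σ t ∈ A}

lemma single_mem_chainsIn {A : Set E} {σ : stdSimplex ℝ (Fin n) → E} (h : Continuous σ)
    (h' : ∀ t, σ t ∈ A) (a : k) : Finsupp.single σ a ∈ chainsIn k A n :=
  Finsupp.single_mem_supported k a ⟨h, h'⟩

lemma chainsIn_mono {A B : Set E} (h : A ⊆ B) (n : ℕ) : chainsIn k A n ≤ chainsIn k B n :=
  Finsupp.supported_mono fun _ hσ => ⟨hσ.1, fun t => h (hσ.2 t)⟩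

lemma chainsIn_inter (A B : Set E) (n : ℕ) :
    chainsIn k (A ∩ B) n = chainsIn k A n ⊓ chainsIn k B n := by
  rw [chainsIn, chainsIn, chainsIn, ← Finsupp.supported_inter]
  congr 1
  ext σ
  simp only [Set.mem_inter_iff, Set.mem_ofPred_eq, forall_and]
  tauto

/-- The only map from the empty simplex lies in every subset, even the empty one; this augmentation
makes the homology reduced. -/
lemma chainsIn_zero (A : Set E) : chainsIn k A 0 = ⊤ := by
  have : IsEmpty (stdSimplex ℝ (Fin 0)) := by
    rw [stdSimplex_of_isEmpty_index]; infer_instance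
  rw [chainsIn, eq_top_iff, ← Finsupp.supported_univ]
  exact Finsupp.supported_mono fun σ _ => ⟨continuous_of_discreteTopology, fun t => isEmptyElim t⟩

lemma isSubcomplex_chainsIn (A : Set E) : IsSubcomplex (chainsIn k A) := by
  intro n c hc
  refine Finsupp.map_mem_of_mem_supported bd (fun σ hσ => ?_) hc
  rw [bd_single, one_smul]
  exact Submodule.sum_mem _ fun i _ => Submodule.smul_mem _ _
    (single_mem_chainsIn (hσ.1.comp (stdSimplex.continuous_map _)) (fun t => hσ.2 _) 1)

section Push

variable {F : Type*} [AddCommGroup F] [Module ℝ F] [TopologicalSpace F] [ContinuousAdd F]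
  [ContinuousSMul ℝ F]

lemma continuous_comb (x : Fin n → F) : Continuous (comb x) := by
  refine continuous_finsetSum _ fun i _ => Continuous.smul ?_ continuous_const
  exact (continuous_apply i).comp continuous_subtype_val

lemma push_mem_chainsIn {C : Set F} (hC : Convex ℝ C) {g : F → E} {A : Set E}
    (hg : ContinuousOn g C) (hA : Set.MapsTo g C A) {c : TupleChain k F n}
    (hc : c ∈ tuplesIn k C n) : push g c ∈ chainsIn k A n := by
  refine Finsupp.map_mem_of_mem_supported _ (fun x hx => ?_) hc
  rw [push_single]
  exact single_mem_chainsIn (hg.comp_continuous (continuous_comb x) fun t => comb_mem hC hx t)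
    (fun t => hA (comb_mem hC hx t)) 1

end Push

lemma post_mem_chainsIn {A B : Set E} {φ : E → E} (hφ : ContinuousOn φ A) (h : Set.MapsTo φ A B)
    {c : MapChain k E n} (hc : c ∈ chainsIn k A n) : post φ c ∈ chainsIn k B n := by
  refine Finsupp.map_mem_of_mem_supported _ (fun σ hσ => ?_) hc
  rw [post_single]
  exact single_mem_chainsIn (hφ.comp_continuous hσ.1 hσ.2) (fun t => h (hσ.2 t)) 1

variable [Zero E]

lemma continuousOn_ext {σ : stdSimplex ℝ (Fin n) → E} (hσ : Continuous σ) :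
    ContinuousOn (ext σ) (stdSimplex ℝ (Fin n)) := by
  rw [continuousOn_iff_continuous_domRestrict]
  convert hσ
  exact funext fun t => ext_coe σ t

lemma op_mem_chainsIn {m : ℕ} {θ : TupleChain k (Fin n → ℝ) m}
    (hθ : θ ∈ tuplesIn k (stdSimplex ℝ (Fin n)) m) {A : Set E} {c : MapChain k E n}
    (hc : c ∈ chainsIn k A n) : op θ c ∈ chainsIn k A m := by
  refine Finsupp.map_mem_of_mem_supported _ (fun σ hσ => ?_) hc
  rw [op, Finsupp.linearCombination_single, one_smul]
  refine push_mem_chainsIn (convex_stdSimplex ℝ _) (continuousOn_ext hσ.1) (fun y hy => ?_) hθ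
  rw [show ext σ y = σ ⟨y, hy⟩ from ext_coe σ ⟨y, hy⟩]
  exact hσ.2 _

lemma sd_mem_chainsIn {A : Set E} {c : MapChain k E n} (hc : c ∈ chainsIn k A n) :
    sd n c ∈ chainsIn k A n :=
  op_mem_chainsIn (sd_mem_tuplesIn (convex_stdSimplex ℝ _) verts_mem) hc

lemma sdHomotopy_mem_chainsIn {A : Set E} {c : MapChain k E n} (hc : c ∈ chainsIn k A n) :
    sdHomotopy n c ∈ chainsIn k A (n + 1) :=
  op_mem_chainsIn (sdHomotopy_mem_tuplesIn (convex_stdSimplex ℝ _) verts_mem) hc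

lemma prism_mem_chainsIn {h : E → ℝ → E} {A B : Set E}
    (hh : ContinuousOn (Function.uncurry h) (A ×ˢ Set.Icc 0 1))
    (hAB : ∀ x ∈ A, ∀ s ∈ Set.Icc (0 : ℝ) 1, h x s ∈ B) {c : MapChain k E n}
    (hc : c ∈ chainsIn k A n) : prism h n c ∈ chainsIn k B (n + 1) := by
  refine Finsupp.map_mem_of_mem_supported _ (fun σ hσ => ?_) hc
  rw [prism, Finsupp.linearCombination_single, one_smul]
  have hmaps : Set.MapsTo (ext σ) (stdSimplex ℝ (Fin n)) A := fun y hy => by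
    rw [show ext σ y = σ ⟨y, hy⟩ from ext_coe σ ⟨y, hy⟩]
    exact hσ.2 _
  refine push_mem_chainsIn ((convex_stdSimplex ℝ (Fin n)).prod (convex_Icc 0 1)) ?_ ?_
    (prism_mem_tuplesIn (convex_stdSimplex ℝ _) verts_mem)
  · refine hh.comp (f := fun p : (Fin n → ℝ) × ℝ => (ext σ p.1, p.2)) ?_ ?_
    · exact ((continuousOn_ext hσ.1).comp continuousOn_fst fun p hp => hp.1).prodMk continuousOn_snd
    · exact fun p hp => ⟨hmaps hp.1, hp.2⟩
  · exact fun p hp => hAB _ (hmaps hp.1) _ hp.2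

/-- The prism formula expresses `c` through its image at time `1`, the prism over `bd c`, and a
boundary; the first two lie in `B`. -/
lemma acyclicPair_of_homotopy {A B : Set E} (hBA : B ⊆ A) {h : E → ℝ → E}
    (hh : ContinuousOn (Function.uncurry h) (A ×ˢ Set.Icc 0 1))
    (hA : ∀ x ∈ A, ∀ s ∈ Set.Icc (0 : ℝ) 1, h x s ∈ A)
    (hB : ∀ x ∈ B, ∀ s ∈ Set.Icc (0 : ℝ) 1, h x s ∈ B)
    (h0 : ∀ x ∈ A, h x 0 = x) (h1 : ∀ x ∈ A, h x 1 ∈ B) :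
    AcyclicPair (chainsIn k A) (chainsIn k B) := by
  intro n c hc hbd
  have hpost : post (h · 0) c = c := by
    rw [← sub_eq_zero]
    change (post (h · 0) - LinearMap.id : _ →ₗ[k] MapChain k E (n + 1)) c = 0
    rw [← Submodule.mem_bot k]
    refine Finsupp.map_mem_of_mem_supported _ (fun σ hσ => ?_) hc
    rw [LinearMap.sub_apply, post_single, Submodule.mem_bot, LinearMap.id_apply, sub_eq_zero]
    congr 1
    exact funext fun t => h0 _ (hσ.2 t)
  have key := bd_prism h c
  rw [hpost] at key
  refine ⟨post (h · 1) c - prism h n (bd c), sub_mem ?_ ?_, - prism h (n + 1) c,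
    neg_mem (prism_mem_chainsIn hh hA hc), ?_⟩
  · refine post_mem_chainsIn ?_ (fun x hx => h1 x hx) hc
    exact hh.comp (f := fun x => (x, (1 : ℝ))) (by fun_prop) fun x hx => ⟨hx, by simp⟩
  · exact prism_mem_chainsIn (hh.mono (Set.prod_mono_left hBA)) hB hbd
  · rw [map_neg, eq_sub_of_add_eq key]
    abel

/-- Chains at a point are pushed forward from tuples of reals by a constant map, and coning from `0`
descends to the operator `L` on them. -/
lemma isExact_chainsIn_singleton (p : E) : IsExact (chainsIn k ({p} : Set E)) := by
  have hc (n : ℕ) (c : MapChain k E n) (h : c ∈ chainsIn k ({p} : Set E) n) :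
      ∃ c' : TupleChain k ℝ n, c = push (fun _ => p) c' := by
    have h' : c ∈ LinearMap.range (push (k := k) (n := n) fun _ : ℝ => p) := by
      change LinearMap.id (R := k) c ∈ _
      refine Finsupp.map_mem_of_mem_supported LinearMap.id (fun σ hσ => ?_) h
      refine ⟨Finsupp.single 0 1, ?_⟩
      rw [push_single, LinearMap.id_apply]
      congr 1
      exact funext fun t => (hσ.2 t).symm
    obtain ⟨c', rfl⟩ := h'
    exact ⟨c', rfl⟩
  have hmem (n : ℕ) (c' : TupleChain k ℝ n) :
      push (fun _ => p) c' ∈ chainsIn k ({p} : Set E) n :=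
    push_mem_chainsIn (C := Set.univ) convex_univ continuousOn_const
      (fun _ _ => Set.mem_singleton p) (by simp [tuplesIn, Finsupp.supported_univ])
  let L (n : ℕ) : MapChain k E n →ₗ[k] MapChain k E (n + 1) := Finsupp.lmapDomain k k fun _ _ => p
  have hL (n : ℕ) (c' : TupleChain k ℝ n) :
      L n (push (fun _ => p) c') = push (fun _ => p) (cone 0 c') := by
    induction c' using Finsupp.induction_linear with
    | zero => simp
    | add f g hf hg => simp only [map_add, hf, hg]
    | single x a => simp [L]
  refine ⟨fun c h => ?_, fun n c h hbd => ?_⟩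
  · obtain ⟨c', rfl⟩ := hc _ c h
    exact ⟨_, hmem _ (cone 0 c'), by rw [bd_push, bd_cone_zero]⟩
  · obtain ⟨c', rfl⟩ := hc _ c h
    refine ⟨_, hmem _ (cone 0 c'), ?_⟩
    rw [bd_push, bd_cone, map_sub, ← hL, ← bd_push, hbd, map_zero, sub_zero]

end Topology

/-! ### Small simplices -/

section Small

variable [TopologicalSpace E] [Zero E]

/-- For a single simplex, enough subdivisions bring the diameters below a Lebesgue number of the
pulled back cover. Further subdivision preserves smallness, so finitely many simplices are handled
together. -/
lemma exists_iterate_sd_mem {X U' W' : Set E} (hU : IsOpen U') (hW : IsOpen W')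
    (hX : X ⊆ U' ∪ W') {c : MapChain k E n} (hc : c ∈ chainsIn k X n) :
    ∃ N, (sd n)^[N] c ∈ chainsIn k (X ∩ U') n ⊔ chainsIn k (X ∩ W') n := by
  set M := chainsIn k (X ∩ U') n ⊔ chainsIn k (X ∩ W') n with hM
  have hsd : ∀ c ∈ M, sd n c ∈ M := by
    intro c hc
    obtain ⟨a, ha, b, hb, rfl⟩ := Submodule.mem_sup.1 hc
    rw [map_add]
    exact Submodule.add_mem_sup (sd_mem_chainsIn ha) (sd_mem_chainsIn hb)
  have hiter (N : ℕ) (c) (hc : c ∈ M) : (sd n)^[N] c ∈ M := by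
    induction N with
    | zero => exact hc
    | succ N ih => rw [Function.iterate_succ_apply']; exact hsd _ ih
  have hpow (N : ℕ) : (sd (k := k) (E := E) n)^[N] = ⇑((sd (k := k) (E := E) n) ^ N) :=
    (Module.End.coe_pow _ N).symm
  rw [chainsIn, Finsupp.supported_eq_span_single] at hc
  induction hc using Submodule.span_induction with
  | zero => exact ⟨0, zero_mem _⟩
  | add x y _ _ hx hy =>
    obtain ⟨N, hN⟩ := hx
    obtain ⟨N', hN'⟩ := hy
    refine ⟨N + N', ?_⟩
    rw [hpow, map_add, ← hpow]
    refine add_mem ?_ ?_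
    · rw [add_comm, Function.iterate_add_apply]; exact hiter _ _ hN
    · rw [Function.iterate_add_apply]; exact hiter _ _ hN'
  | smul a x _ hx =>
    obtain ⟨N, hN⟩ := hx
    refine ⟨N, ?_⟩
    rw [hpow, map_smul, ← hpow]
    exact M.smul_mem a hN
  | mem x hx =>
    obtain ⟨σ, ⟨hσc, hσX⟩, rfl⟩ := hx
    have hcov : (Set.univ : Set (stdSimplex ℝ (Fin n))) ⊆
        ⋃ i : Bool, σ ⁻¹' (if i then U' else W') := by
      intro t _
      rcases hX (hσX t) with h | h
      · exact Set.mem_iUnion.2 ⟨true, h⟩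
      · exact Set.mem_iUnion.2 ⟨false, h⟩
    obtain ⟨δ, hδ, hball⟩ := lebesgue_number_lemma_of_metric isCompact_univ
      (fun i : Bool => by
        cases i
        · exact hW.preimage hσc
        · exact hU.preimage hσc) hcov
    rcases n with _ | n
    · refine ⟨0, ?_⟩
      rw [hM, chainsIn_zero]
      simp
    have hr0 : (0 : ℝ) ≤ 1 - 1 / ((n + 1 : ℕ) : ℝ) := by
      rw [sub_nonneg, div_le_one (by positivity)]
      simp
    have hr1 : 1 - 1 / ((n + 1 : ℕ) : ℝ) < 1 := by
      rw [sub_lt_self_iff]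
      positivity
    obtain ⟨N, hN⟩ := exists_pow_lt_of_lt_one hδ hr1
    refine ⟨N, ?_⟩
    have hv : verts k (n + 1) ∈ smallTuples k (stdSimplex ℝ (Fin (n + 1))) 1 (n + 1) := by
      refine Finsupp.single_mem_supported k _ ⟨fun j => single_mem_stdSimplex ℝ j, fun i j => ?_⟩
      refine (Metric.dist_le_diam_of_mem (bounded_stdSimplex _) (single_mem_stdSimplex ℝ i)
        (single_mem_stdSimplex ℝ j)).trans diam_stdSimplex_le
    have hsmall := iterate_sd_mem_smallTuples (convex_stdSimplex ℝ _) zero_le_one hv N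
    have hpush : (sd (n + 1))^[N] (Finsupp.single σ 1) =
        push (ext σ) ((TupleChain.sd (n + 1))^[N] (verts k (n + 1))) := by
      rw [← push_verts]
      generalize verts k (n + 1) = c
      clear hN hsmall
      induction N with
      | zero => rfl
      | succ N ih => rw [Function.iterate_succ_apply', ih, Function.iterate_succ_apply', sd_push]
    rw [hpush]
    refine Finsupp.map_mem_of_mem_supported _ (fun x hx => ?_) hsmall
    rw [push_single]
    obtain ⟨i, hi⟩ := hball ⟨x 0, hx.1 0⟩ trivial
    have hin (t : stdSimplex ℝ (Fin (n + 1))) : comb x t ∈ stdSimplex ℝ (Fin (n + 1)) :=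
      comb_mem (convex_stdSimplex ℝ _) hx.1 t
    have hval (t) : ext σ (comb x t) = σ ⟨comb x t, hin t⟩ := ext_coe σ ⟨comb x t, hin t⟩
    have hcont : Continuous fun t => ext σ (comb x t) :=
      (continuousOn_ext hσc).comp_continuous (continuous_comb x) hin
    have hmem (t) : ext σ (comb x t) ∈ (if i then U' else W') := by
      rw [hval]
      refine hi ?_
      rw [Metric.mem_ball]
      refine lt_of_le_of_lt (b := (1 - 1 / ((n + 1 : ℕ) : ℝ)) ^ N * 1) ?_ (by simpa using hN)
      exact comb_mem (convex_closedBall (x 0) _) (fun j => hx.2 j 0) t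
    cases i
    · refine (le_sup_right : _ ≤ M) (single_mem_chainsIn (A := X ∩ W') hcont (fun t => ?_) 1)
      exact ⟨hval t ▸ hσX _, hmem t⟩
    · refine (le_sup_left : _ ≤ M) (single_mem_chainsIn (A := X ∩ U') hcont (fun t => ?_) 1)
      exact ⟨hval t ▸ hσX _, hmem t⟩

/-- Excision in the form of the theorem on small simplices, for two subspaces whose interiors
cover the space. -/
lemma acyclicPair_chainsIn_sup {X U W U' W' : Set E} (hU' : IsOpen U') (hW' : IsOpen W')
    (hX : X ⊆ U' ∪ W') (hU : X ∩ U' ⊆ U) (hW : X ∩ W' ⊆ W) : AcyclicPair (chainsIn k X)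
      (fun n => chainsIn k U n ⊔ chainsIn k W n) := by
  intro n c hc hbd
  have hsd : ∀ n, ∀ c ∈ chainsIn k U n ⊔ chainsIn k W n,
      sd n c ∈ chainsIn k U n ⊔ chainsIn k W n := by
    intro n c hc
    obtain ⟨a, ha, b, hb, rfl⟩ := Submodule.mem_sup.1 hc
    rw [map_add]
    exact Submodule.add_mem_sup (sd_mem_chainsIn ha) (sd_mem_chainsIn hb)
  have hH : ∀ n, ∀ c ∈ chainsIn k U n ⊔ chainsIn k W n,
      sdHomotopy n c ∈ chainsIn k U (n + 1) ⊔ chainsIn k W (n + 1) := by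
    intro n c hc
    obtain ⟨a, ha, b, hb, rfl⟩ := Submodule.mem_sup.1 hc
    rw [map_add]
    exact Submodule.add_mem_sup (sdHomotopy_mem_chainsIn ha) (sdHomotopy_mem_chainsIn hb)
  obtain ⟨N, hN⟩ := exists_iterate_sd_mem hU' hW' hX hc
  replace hN : (sd (n + 1))^[N] c ∈ chainsIn k U (n + 1) ⊔ chainsIn k W (n + 1) :=
    (sup_le_sup (chainsIn_mono hU _) (chainsIn_mono hW _) :
      chainsIn k (X ∩ U') (n + 1) ⊔ chainsIn k (X ∩ W') (n + 1) ≤ _) hN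
  induction N generalizing c with
  | zero => exact ⟨c, hN, 0, zero_mem _, by simp⟩
  | succ N ih =>
    -- The homotopy from `id` to `sd` returns from `sd c` to `c`; its correction on `bd c` is small
    -- because `bd c` already is.
    obtain ⟨p, hp, q, hq, hpq⟩ := ih (sd (n + 1) c) (sd_mem_chainsIn hc)
      (by rw [bd_sd]; exact hsd _ _ hbd) hN
    refine ⟨p + sdHomotopy n (bd c), add_mem hp (hH _ _ hbd), q + sdHomotopy (n + 1) c,
      add_mem hq (sdHomotopy_mem_chainsIn hc), ?_⟩
    have := bd_sdHomotopy c
    rw [eq_sub_iff_add_eq, hpq] at this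
    refine this.symm.trans ?_
    rw [map_add]
    abel

end Small

/-- The homotopy is the straight line from each point to its image under `r`. -/
lemma acyclicPair_of_retraction [TopologicalSpace E] [AddCommGroup E] [Module ℝ E]
    [ContinuousAdd E] [ContinuousSMul ℝ E] {A B : Set E} (hBA : B ⊆ A) {r : E → E}
    (hr : ContinuousOn r A) (hrB : ∀ x ∈ A, r x ∈ B) (hr' : ∀ x ∈ B, r x = x)
    (hA : ∀ x ∈ A, ∀ s ∈ Set.Icc (0 : ℝ) 1, (1 - s) • x + s • r x ∈ A) :
    AcyclicPair (chainsIn k A) (chainsIn k B) := by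
  refine acyclicPair_of_homotopy hBA (h := fun x s => (1 - s) • x + s • r x) ?_ hA ?_ ?_ ?_
  · have : ContinuousOn (fun p : E × ℝ => r p.1) (A ×ˢ Set.Icc 0 1) :=
      hr.comp continuousOn_fst fun p hp => hp.1
    exact ((continuousOn_const.sub continuousOn_snd).smul continuousOn_fst).add
      (continuousOn_snd.smul this)
  · intro x hx s _
    rwa [hr' x hx, ← add_smul, sub_add_cancel, one_smul]
  · simp
  · intro x hx
    simpa using hrB x hx

end MapChain

/-! ### Oriented simplicial chains as functions on finite sets of vertices -/

namespace FaceChain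

variable {k : Type*} [Field k] {V : Type*}

variable (k) in
/-- The functions supported on `K`. -/
def suppIn (K : Set (Finset V)) : Submodule k (Finset V → k) where
  carrier := {f | ∀ s, f s ≠ 0 → s ∈ K}
  zero_mem' := by simp
  add_mem' {f g} hf hg s hs := by
    by_cases h : f s = 0
    · exact hg s (by simpa [h] using hs)
    · exact hf s h
  smul_mem' a f hf s hs := hf s (right_ne_zero_of_mul hs)

variable (k V) in
/-- The chains of degree `n`: functions supported on sets with `n` elements. -/
def hom (n : ℕ) : Submodule k (Finset V → k) := suppIn k {s | s.card = n}

lemma suppIn_mono {K L : Set (Finset V)} (h : K ⊆ L) : suppIn k K ≤ suppIn k L :=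
  fun _ hf s hs => h (hf s hs)

lemma eq_zero_of_notMem {K : Set (Finset V)} {f : Finset V → k} (hf : f ∈ suppIn k K)
    {s : Finset V} (hs : s ∉ K) : f s = 0 := by
  by_contra h
  exact hs (hf s h)

variable [LinearOrder V]

/-- The sign of inserting `v` into the increasing enumeration of `s`. -/
def eps (k : Type*) [Field k] (v : V) (s : Finset V) : k := (-1) ^ (s.filter (· < v)).card

lemma eps_ne_zero (v : V) (s : Finset V) : eps k v s ≠ 0 := by simp [eps]

lemma eps_mul_self (v : V) (s : Finset V) : eps k v s * eps k v s = 1 := by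
  rw [eps, ← mul_pow]; simp

lemma eps_insert {v w : V} {s : Finset V} (hw : w ∉ s) :
    eps k v (insert w s) = if w < v then - eps k v s else eps k v s := by
  unfold eps
  rw [Finset.filter_insert]
  split_ifs
  · rw [Finset.card_insert_of_notMem (by simp [hw]), pow_succ, mul_neg_one]
  · rfl

/-- Inserting the smaller vertex flips the sign of the larger one, and not conversely, so exactly
one of the two factors changes. -/
lemma eps_mul_eps {v w : V} (hvw : v ≠ w) {s : Finset V} (hv : v ∉ s) (hw : w ∉ s) :
    eps k v s * eps k w (insert v s) = - (eps k w s * eps k v (insert w s)) := by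
  rw [eps_insert hv, eps_insert hw]
  rcases lt_or_gt_of_ne hvw with h | h
  · rw [if_pos h, if_neg h.not_gt]; ring
  · rw [if_neg h.not_gt, if_pos h]; ring

/-- Contraction with the vertex `v`. -/
def lam (v : V) : (Finset V → k) →ₗ[k] (Finset V → k) where
  toFun f s := if v ∈ s then 0 else eps k v s * f (insert v s)
  map_add' f g := by ext s; simp only [Pi.add_apply]; split_ifs <;> ring
  map_smul' a f := by
    ext s; simp only [Pi.smul_apply, smul_eq_mul, RingHom.id_apply]; split_ifs <;> ring

/-- Multiplication with the vertex `v`. -/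
def mu (v : V) : (Finset V → k) →ₗ[k] (Finset V → k) where
  toFun f s := if v ∈ s then eps k v (s.erase v) * f (s.erase v) else 0
  map_add' f g := by ext s; simp only [Pi.add_apply]; split_ifs <;> ring
  map_smul' a f := by
    ext s; simp only [Pi.smul_apply, smul_eq_mul, RingHom.id_apply]; split_ifs <;> ring

lemma lam_apply (v : V) (f : Finset V → k) (s : Finset V) :
    lam v f s = if v ∈ s then 0 else eps k v s * f (insert v s) := rfl

lemma mu_apply (v : V) (f : Finset V → k) (s : Finset V) :
    mu v f s = if v ∈ s then eps k v (s.erase v) * f (s.erase v) else 0 := rfl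

lemma lam_lam_self (v : V) (f : Finset V → k) : lam v (lam v f) = 0 := by
  ext s
  simp [lam_apply]

lemma lam_lam (v w : V) (f : Finset V → k) : lam v (lam w f) = - lam w (lam v f) := by
  rcases eq_or_ne v w with rfl | hvw
  · simp [lam_lam_self]
  ext s
  simp only [lam_apply, Pi.neg_apply, Finset.mem_insert, hvw, hvw.symm, false_or]
  by_cases hv : v ∈ s <;> by_cases hw : w ∈ s <;> simp only [hv, hw, if_true, if_false, mul_zero,
    neg_zero]
  rw [← mul_assoc, ← mul_assoc, eps_mul_eps hvw hv hw, Finset.insert_comm, neg_mul]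

lemma mu_lam (v : V) (f : Finset V → k) (s : Finset V) :
    mu v (lam v f) s = if v ∈ s then f s else 0 := by
  rw [mu_apply]
  split_ifs with h
  · rw [lam_apply, if_neg (by simp), ← mul_assoc, eps_mul_self, one_mul, Finset.insert_erase h]
  · rfl

lemma lam_mu (v : V) (f : Finset V → k) (s : Finset V) :
    lam v (mu v f) s = if v ∈ s then 0 else f s := by
  rw [lam_apply]
  split_ifs with h
  · rfl
  · rw [mu_apply, if_pos (by simp), Finset.erase_insert h, ← mul_assoc, eps_mul_self, one_mul]

lemma lam_mu_of_ne {v w : V} (hvw : v ≠ w) (f : Finset V → k) :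
    lam w (mu v f) = - mu v (lam w f) := by
  ext s
  simp only [lam_apply, mu_apply, Pi.neg_apply, Finset.mem_insert, hvw, false_or,
    Finset.mem_erase, hvw.symm, ne_eq, not_false_eq_true, true_and]
  by_cases hv : v ∈ s <;> by_cases hw : w ∈ s <;> simp only [hv, hw, if_true, if_false, mul_zero,
    neg_zero]
  obtain ⟨t, ht, rfl⟩ : ∃ t, v ∉ t ∧ s = insert v t :=
    ⟨s.erase v, by simp, (Finset.insert_erase hv).symm⟩
  have hwt : w ∉ t := fun h => hw (Finset.mem_insert_of_mem h)
  rw [Finset.insert_comm, Finset.erase_insert ht, Finset.erase_insert (by simp [ht, hvw]),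
    ← mul_assoc, ← mul_assoc, ← neg_mul]
  congr 1
  have h1 := eps_mul_eps (k := k) hvw ht hwt
  have h2 := eps_mul_self (k := k) v t
  have h3 := eps_mul_self (k := k) v (insert w t)
  linear_combination (eps k v t * eps k v (insert w t)) * h1 -
    (eps k v (insert w t) * eps k w (insert v t)) * h2 - (eps k v t * eps k w t) * h3

lemma lam_mem_suppIn {K L : Set (Finset V)} {v : V} {f : Finset V → k} (hf : f ∈ suppIn k K)
    (h : ∀ s, v ∉ s → insert v s ∈ K → s ∈ L) : lam v f ∈ suppIn k L := by
  intro s hs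
  rw [lam_apply] at hs
  split_ifs at hs with hv
  · exact absurd rfl hs
  · exact h s hv (hf _ (right_ne_zero_of_mul hs))

lemma mu_mem_suppIn {K L : Set (Finset V)} {v : V} {f : Finset V → k} (hf : f ∈ suppIn k K)
    (h : ∀ s, v ∉ s → s ∈ K → insert v s ∈ L) : mu v f ∈ suppIn k L := by
  intro s hs
  rw [mu_apply] at hs
  split_ifs at hs with hv
  · have := h (s.erase v) (by simp) (hf _ (right_ne_zero_of_mul hs))
    rwa [Finset.insert_erase hv] at this
  · exact absurd rfl hs

lemma lam_mem_hom {v : V} {n : ℕ} {f : Finset V → k} (hf : f ∈ hom k V (n + 1)) :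
    lam v f ∈ hom k V n :=
  lam_mem_suppIn hf fun s hv hs => by simpa [Finset.card_insert_of_notMem hv] using hs

lemma mu_mem_hom {v : V} {n : ℕ} {f : Finset V → k} (hf : f ∈ hom k V n) :
    mu v f ∈ hom k V (n + 1) :=
  mu_mem_suppIn hf fun s hv hs => by
    rw [Set.mem_ofPred_eq] at hs ⊢
    rw [Finset.card_insert_of_notMem hv, hs]

variable [Fintype V]

/-- The boundary. -/
def bd : (Finset V → k) →ₗ[k] (Finset V → k) := ∑ v, lam v

lemma bd_apply (f : Finset V → k) : bd f = ∑ v, lam v f := by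
  simp [bd]

lemma bd_lam (v : V) (f : Finset V → k) : bd (lam v f) = - lam v (bd f) := by
  rw [bd_apply, bd_apply, map_sum, ← Finset.sum_neg_distrib]
  exact Finset.sum_congr rfl fun w _ => lam_lam w v f

/-- Contraction with `w ≠ v` anticommutes with `mu v`, while `lam v` and `mu v` satisfy `lam v ∘ mu
v + mu v ∘ lam v = id`. Hence `mu v` behaves as the cone with apex `v`. -/
lemma bd_mu (v : V) (f : Finset V → k) : bd (mu v f) = f - mu v (bd f) := by
  rw [bd_apply, bd_apply, ← Finset.add_sum_erase _ _ (Finset.mem_univ v),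
    ← Finset.add_sum_erase _ (fun w => lam w f) (Finset.mem_univ v), map_add, map_sum,
    Finset.sum_congr rfl fun w hw => lam_mu_of_ne (Finset.ne_of_mem_erase hw).symm f,
    Finset.sum_neg_distrib]
  have : lam v (mu v f) = f - mu v (lam v f) := by
    ext s
    rw [lam_mu, Pi.sub_apply, mu_lam]
    split_ifs <;> simp
  rw [this]
  abel

lemma bd_mem_suppIn {K L : Set (Finset V)} {f : Finset V → k} (hf : f ∈ suppIn k K)
    (h : ∀ s, ∀ v, v ∉ s → insert v s ∈ K → s ∈ L) : bd f ∈ suppIn k L := by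
  rw [bd_apply]
  exact Submodule.sum_mem _ fun v _ => lam_mem_suppIn hf fun s => h s v

lemma bd_mem_hom {n : ℕ} {f : Finset V → k} (hf : f ∈ hom k V (n + 1)) : bd f ∈ hom k V n := by
  rw [bd_apply]
  exact Submodule.sum_mem _ fun v _ => lam_mem_hom hf

/-- Contracting with all vertices of `ρ` identifies, up to signs and a shift by `#ρ`, the chains
modulo the faces not containing `ρ` with the chains of the link of `ρ`. -/
lemma exists_contraction (ρ : Finset V) : ∃ (Λ : (Finset V → k) →ₗ[k] (Finset V → k))
    (η : Finset V → k) (e : k), (∀ s, η s ≠ 0) ∧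
      (∀ f s, Λ f s = if Disjoint s ρ then η s * f (s ∪ ρ) else 0) ∧
      ∀ f, bd (Λ f) = e • Λ (bd f) := by
  induction ρ using Finset.induction_on with
  | empty => exact ⟨LinearMap.id, 1, 1, by simp, by simp, by simp⟩
  | insert v ρ hv ih =>
    obtain ⟨Λ, η, e, hη, hΛ, hbd⟩ := ih
    refine ⟨Λ ∘ₗ lam v, fun s => η s * eps k v (s ∪ ρ), -e,
      fun s => mul_ne_zero (hη s) (eps_ne_zero _ _), fun f s => ?_, fun f => ?_⟩
    · rw [LinearMap.comp_apply, hΛ, lam_apply]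
      simp only [Finset.disjoint_insert_right, Finset.mem_union, hv, or_false,
        Finset.union_insert]
      by_cases h1 : v ∈ s <;> by_cases h2 : Disjoint s ρ <;> simp [h1, h2, mul_assoc]
    · rw [LinearMap.comp_apply, LinearMap.comp_apply, hbd, bd_lam]
      simp

end FaceChain

namespace FaceChain

variable {k : Type*} [Field k] {V : Type*} [LinearOrder V]

/-! ### Rank selection for chains -/

/-- The link of `ρ` in the set of faces `K`. -/
def linkOf (K : Set (Finset V)) (ρ : Finset V) : Set (Finset V) := {s | Disjoint s ρ ∧ s ∪ ρ ∈ K}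

/-- The faces in `K` with colours in `S`. -/
def selectOf (K : Set (Finset V)) (κ : V → ℕ) (S : Finset ℕ) : Set (Finset V) :=
  {s | s ∈ K ∧ ∀ v ∈ s, κ v ∈ S}

section

variable {K : Set (Finset V)} {κ : V → ℕ} {S : Finset ℕ} {i : ℕ}

lemma selectOf_subset : selectOf K κ S ⊆ selectOf K κ (insert i S) :=
  fun _ hs => ⟨hs.1, fun v hv => Finset.mem_insert_of_mem (hs.2 v hv)⟩

lemma mem_selectOf_of_ne {s : Finset V} (hs : s ∈ selectOf K κ (insert i S))
    (h : ∀ v ∈ s, κ v ≠ i) : s ∈ selectOf K κ S :=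
  ⟨hs.1, fun v hv => (Finset.mem_insert.1 (hs.2 v hv)).resolve_left (h v hv)⟩

end

variable [Fintype V]

variable (k) in
/-- The links of the nonempty faces `ρ` have no homology in degrees below `N - #ρ`. -/
def LinksAcyclic (K : Set (Finset V)) (N : ℕ) : Prop :=
  ∀ ρ ∈ K, ρ.Nonempty → ∀ j, j + ρ.card < N → ∀ c ∈ suppIn k (linkOf K ρ) ⊓ hom k V j, bd c = 0 →
    ∃ b ∈ suppIn k (linkOf K ρ) ⊓ hom k V (j + 1), bd b = c

variable (k) in
/-- The chains of degree `N` whose boundary vanishes on the faces containing `ρ` agree on these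
faces with cycles, for all nonempty faces `ρ`. -/
def LocalCyclesLift (K : Set (Finset V)) (N : ℕ) : Prop :=
  ∀ ρ ∈ K, ρ.Nonempty → ∀ c ∈ suppIn k K ⊓ hom k V N, (∀ s, ρ ⊆ s → bd c s = 0) →
    ∃ z ∈ suppIn k K ⊓ hom k V N, bd z = 0 ∧ ∀ s, ρ ⊆ s → z s = c s

/-- Homology of `K` relative to the faces not containing `ρ` is the homology of the link of `ρ`
shifted by `#ρ`, so it vanishes in degrees `j < N`. -/
lemma LinksAcyclic.exists_relative {K : Set (Finset V)} {N : ℕ} (hQ : LinksAcyclic k K N)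
    {ρ : Finset V} (hρ : ρ ∈ K) (hρ' : ρ.Nonempty) {j : ℕ} (hj : j < N) {c : Finset V → k}
    (hc : c ∈ suppIn k K ⊓ hom k V j) (hbd : ∀ s, ρ ⊆ s → bd c s = 0) :
    ∃ b ∈ suppIn k K ⊓ hom k V (j + 1), ∀ s, ρ ⊆ s → bd b s = c s := by
  by_cases hjρ : j < ρ.card
  · refine ⟨0, zero_mem _, fun s hs => ?_⟩
    rw [map_zero]
    refine (eq_zero_of_notMem hc.2 fun h : s.card = j => ?_).symm
    exact absurd (Finset.card_le_card hs) (by omega)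
  obtain ⟨j, rfl⟩ := Nat.exists_eq_add_of_le' (not_lt.1 hjρ)
  obtain ⟨Λ, η, e, hη, hΛ, hΛbd⟩ := exists_contraction (k := k) ρ
  have hΛc : Λ c ∈ suppIn k (linkOf K ρ) ⊓ hom k V j := by
    refine ⟨fun s hs => ?_, fun s hs => ?_⟩
    · rw [hΛ] at hs
      split_ifs at hs with h
      · exact ⟨h, hc.1 _ (right_ne_zero_of_mul hs)⟩
      · exact absurd rfl hs
    · rw [hΛ] at hs
      split_ifs at hs with h
      · have h1 : (s ∪ ρ).card = j + ρ.card := hc.2 _ (right_ne_zero_of_mul hs)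
        rw [Finset.card_union_of_disjoint h] at h1
        exact Nat.add_right_cancel h1
      · exact absurd rfl hs
  have hΛc' : bd (Λ c) = 0 := by
    rw [hΛbd]
    have : Λ (bd c) = 0 := by
      ext s
      rw [hΛ, hbd _ Finset.subset_union_right]
      simp
    rw [this, smul_zero]
  obtain ⟨a, ha, hac⟩ := hQ ρ hρ hρ' j hj _ hΛc hΛc'
  -- The preimage of `a` under `Λ` that is supported on the faces containing `ρ`; the sign `e` is
  -- corrected afterwards.
  let b (s : Finset V) : k := if ρ ⊆ s then (η (s \ ρ))⁻¹ * a (s \ ρ) else 0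
  have hb : ∀ s, b s ≠ 0 → ρ ⊆ s ∧ a (s \ ρ) ≠ 0 := by
    intro s hs
    simp only [b] at hs
    split_ifs at hs with h
    · exact ⟨h, right_ne_zero_of_mul hs⟩
    · exact absurd rfl hs
  have hΛb : Λ b = a := by
    ext s
    rw [hΛ]
    split_ifs with h
    · simp only [b, Finset.subset_union_right, if_true, Finset.union_sdiff_right,
        Finset.sdiff_eq_self_of_disjoint h]
      rw [← mul_assoc, mul_inv_cancel₀ (hη s), one_mul]
    · exact (eq_zero_of_notMem ha.1 fun h' => h h'.1).symm
  refine ⟨e • b, Submodule.smul_mem _ _ ⟨fun s hs => ?_, fun s hs => ?_⟩, fun s hs => ?_⟩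
  · have := (ha.1 _ (hb s hs).2).2
    rwa [Finset.sdiff_union_of_subset (hb s hs).1] at this
  · have h1 : (s \ ρ).card = j + 1 := ha.2 _ (hb s hs).2
    rw [Finset.card_sdiff_of_subset (hb s hs).1] at h1
    have := Finset.card_le_card (hb s hs).1
    change s.card = _
    omega
  · have h1 : Λ (bd (e • b)) = Λ c := by
      rw [map_smul, map_smul, ← hΛbd, hΛb, hac]
    have h2 := congrFun h1 (s \ ρ)
    rw [hΛ, hΛ, if_pos Finset.sdiff_disjoint, if_pos Finset.sdiff_disjoint,
      Finset.sdiff_union_of_subset hs] at h2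
    exact mul_left_cancel₀ (hη _) h2

/-! ### Removing one colour -/

section Step

variable {K : Set (Finset V)} {κ : V → ℕ} {S : Finset ℕ} {i : ℕ}

lemma LinksAcyclic.of_insert (hK : ∀ s ∈ K, ∀ t ⊆ s, t ∈ K) (hκ : ∀ s ∈ K, Set.InjOn κ s)
    (hi : i ∉ S) (hQ : LinksAcyclic k (selectOf K κ (insert i S)) (S.card + 1)) :
    LinksAcyclic k (selectOf K κ S) S.card := by
  intro ρ hρ hρ' j hj c hc hbd
  obtain ⟨b, hb, rfl⟩ := hQ ρ (selectOf_subset hρ) hρ' j (by omega) c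
    ⟨suppIn_mono (L := linkOf (selectOf K κ (insert i S)) ρ)
      (fun s hs => ⟨hs.1, selectOf_subset hs.2⟩) hc.1, hc.2⟩ hbd
  -- The cycle `bd b` avoids colour `i`, so `lam v b` is a cycle too.
  have hci (v : V) (hv : κ v = i) : lam v (bd b) = 0 := by
    ext s
    rw [lam_apply]
    split_ifs
    · rfl
    · rw [eq_zero_of_notMem hc.1 fun h => ?_, mul_zero]
      · rfl
      · exact hi (hv ▸ h.2.2 v (by simp))
  -- Passing from `ρ` to `insert v ρ` costs one vertex, exactly what the extra colour adds to the
  -- bound. The chain `a` found in that link avoids colour `i`, since `v` already has it.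
  have ha (v : V) (hv : κ v = i) : ∃ a ∈ suppIn k (linkOf (selectOf K κ S) ρ) ⊓ hom k V (j + 1),
      bd a = lam v b := by
    by_cases hvρ : insert v ρ ∈ selectOf K κ (insert i S)
    · have hvρ' : v ∉ ρ := fun h => hi (hv ▸ hρ.2 v h)
      have hlink : lam v b ∈ suppIn k (linkOf (selectOf K κ (insert i S)) (insert v ρ)) := by
        refine lam_mem_suppIn hb.1 fun s hs hs' => ⟨?_, ?_⟩
        · rw [Finset.disjoint_insert_right]
          exact ⟨hs, (Finset.disjoint_insert_left.1 hs'.1).2⟩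
        · rw [Finset.union_insert, ← Finset.insert_union]
          exact hs'.2
      obtain ⟨a, ha, hab⟩ := hQ (insert v ρ) hvρ (Finset.insert_nonempty _ _) j
        (by rw [Finset.card_insert_of_notMem hvρ']; omega) (lam v b)
        ⟨hlink, lam_mem_hom hb.2⟩ (by rw [bd_lam, hci v hv, neg_zero])
      · refine ⟨a, ⟨fun s hs => ?_, ha.2⟩, hab⟩
        obtain ⟨h1, h2⟩ := ha.1 s hs
        rw [Finset.disjoint_insert_right] at h1
        refine ⟨h1.2, hK _ h2.1 _ (Finset.union_subset_union_right (Finset.subset_insert _ _)), ?_⟩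
        intro w hw
        rcases Finset.mem_union.1 hw with hw | hw
        · refine (Finset.mem_insert.1 (h2.2 w (Finset.mem_union_left _ hw))).resolve_left fun h => ?_
          have := hκ _ h2.1 (Finset.mem_coe.2 (Finset.mem_union_left _ hw))
            (Finset.mem_coe.2 (Finset.mem_union_right _ (Finset.mem_insert_self v ρ)))
            (h.trans hv.symm)
          exact h1.1 (this ▸ hw)
        · exact hρ.2 w hw
    · refine ⟨0, zero_mem _, ?_⟩
      rw [map_zero]
      ext s
      rw [lam_apply]
      split_ifs with h
      · rfl
      · rw [eq_zero_of_notMem hb.1 fun h' => hvρ ?_, mul_zero]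
        · rfl
        · have h2 := h'.2
          exact ⟨hK _ h2.1 _ (by rw [Finset.insert_union]; exact
              Finset.insert_subset_insert _ Finset.subset_union_right), fun w hw => h2.2 w (by
              rw [Finset.insert_union]
              exact Finset.insert_subset_insert _ Finset.subset_union_right hw)⟩
  choose! a ha hab using ha
  set T := Finset.univ.filter fun v => κ v = i with hT
  have hTm (v) : v ∈ T ↔ κ v = i := by simp [hT]
  -- The term `mu v (lam v b)` is the part of `b` on faces through `v`, and its boundary is `lam v b
  -- = bd (a v)`. A face has at most one vertex of colour `i`, so nothing is subtracted twice.
  refine ⟨(b - ∑ v ∈ T, mu v (lam v b)) + ∑ v ∈ T, a v,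
    add_mem ⟨fun s hs => ?_, sub_mem hb.2 (Submodule.sum_mem _ fun v _ => mu_mem_hom
      (lam_mem_hom hb.2))⟩ (Submodule.sum_mem _ fun v hv => ha v ((hTm v).1 hv)), ?_⟩
  · simp only [Pi.sub_apply, Finset.sum_apply, mu_lam] at hs
    have hbs : b s ≠ 0 := by
      intro h
      simp [h] at hs
    have hsK := hb.1 s hbs
    refine ⟨hsK.1, mem_selectOf_of_ne hsK.2 fun v hv hvi => ?_⟩
    rcases Finset.mem_union.1 hv with hv | hv
    · rw [Finset.sum_eq_single v, if_pos hv, sub_self] at hs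
      · exact hs rfl
      · intro w hw hwv
        rw [if_neg]
        intro hws
        exact hwv (hκ _ hsK.2.1 (Finset.mem_coe.2 (Finset.mem_union_left _ hws))
          (Finset.mem_coe.2 (Finset.mem_union_left _ hv)) (((hTm w).1 hw).trans hvi.symm))
      · exact fun h => absurd ((hTm v).2 hvi) h
    · exact hi (hvi ▸ hρ.2 v hv)
  · have h1 : ∀ v ∈ T, bd (mu v (lam v b)) = lam v b := by
      intro v hv
      rw [bd_mu, bd_lam, hci v ((hTm v).1 hv)]
      simp
    rw [map_add, map_sub, map_sum, map_sum, Finset.sum_congr rfl h1,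
      Finset.sum_congr rfl fun v hv => hab v ((hTm v).1 hv), sub_add_cancel]

lemma LocalCyclesLift.of_insert (hK : ∀ s ∈ K, ∀ t ⊆ s, t ∈ K) (hκ : ∀ s ∈ K, Set.InjOn κ s)
    (hi : i ∉ S) (hQ : LinksAcyclic k (selectOf K κ (insert i S)) (S.card + 1))
    (hR : LocalCyclesLift k (selectOf K κ (insert i S)) (S.card + 1)) :
    LocalCyclesLift k (selectOf K κ S) S.card := by
  intro ρ hρ hρ' c hc hbd
  obtain ⟨b, hb, hbc⟩ := hQ.exists_relative (selectOf_subset hρ) hρ' (Nat.lt_succ_self _)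
    ⟨suppIn_mono selectOf_subset hc.1, hc.2⟩ hbd
  have hz (v : V) (hv : κ v = i) : ∃ z ∈ suppIn k (selectOf K κ (insert i S)) ⊓
      hom k V (S.card + 1), bd z = 0 ∧ ∀ s, insert v ρ ⊆ s → z s = b s := by
    by_cases hvρ : insert v ρ ∈ selectOf K κ (insert i S)
    · refine hR (insert v ρ) hvρ (Finset.insert_nonempty _ _) b hb fun s hs => ?_
      rw [hbc s ((Finset.subset_insert _ _).trans hs)]
      refine eq_zero_of_notMem hc.1 fun h => hi (hv ▸ h.2 v (hs (Finset.mem_insert_self _ _)))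
    · refine ⟨0, zero_mem _, map_zero _, fun s hs => (eq_zero_of_notMem hb.1 fun h => hvρ ?_).symm⟩
      exact ⟨hK _ h.1 _ hs, fun w hw => h.2 w (hs hw)⟩
  choose! z hz hz0 hzb using hz
  set T := Finset.univ.filter fun v => κ v = i with hT
  have hTm (v) : v ∈ T ↔ κ v = i := by simp [hT]
  have hzT : ∑ v ∈ T, lam v (z v) ∈ suppIn k (selectOf K κ S) := by
    refine Submodule.sum_mem _ fun v hv => lam_mem_suppIn (hz v ((hTm v).1 hv)).1 fun s hs hs' => ?_
    refine mem_selectOf_of_ne ⟨hK _ hs'.1 _ (Finset.subset_insert _ _),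
      fun w hw => hs'.2 w (Finset.mem_insert_of_mem hw)⟩ fun w hw hwi => ?_
    have := hκ _ hs'.1 (Finset.mem_coe.2 (Finset.mem_insert_of_mem hw))
      (Finset.mem_coe.2 (Finset.mem_insert_self v s)) (hwi.trans ((hTm v).1 hv).symm)
    exact hs (this ▸ hw)
  have hzh : ∑ v ∈ T, lam v (z v) ∈ hom k V S.card :=
    Submodule.sum_mem _ fun v hv => lam_mem_hom (hz v ((hTm v).1 hv)).2
  refine ⟨∑ v ∈ T, lam v (z v), ⟨hzT, hzh⟩, ?_, fun s hs => ?_⟩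
  · rw [map_sum]
    refine Finset.sum_eq_zero fun v hv => ?_
    rw [bd_lam, hz0 v ((hTm v).1 hv), map_zero, neg_zero]
  · by_cases hsc : s.card = S.card
    · by_cases hsi : ∃ w ∈ s, κ w = i
      · obtain ⟨w, hw, hwi⟩ := hsi
        rw [eq_zero_of_notMem hzT fun h => hi (hwi ▸ h.2 w hw),
          eq_zero_of_notMem hc.1 fun h => hi (hwi ▸ h.2 w hw)]
      · push Not at hsi
        rw [← hbc s hs, bd_apply, Finset.sum_apply, Finset.sum_apply,
          ← Finset.sum_subset (Finset.subset_univ T)]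
        · refine Finset.sum_congr rfl fun v hv => ?_
          rw [lam_apply, lam_apply, hzb v ((hTm v).1 hv) _ (Finset.insert_subset_insert _ hs)]
        · intro v _ hv
          rw [hTm] at hv
          rw [lam_apply]
          split_ifs with hvs
          · rfl
          · rw [eq_zero_of_notMem hb.1 fun h => ?_, mul_zero]
            -- If neither `v` nor `s` had colour `i`, a face with `S.card + 1` vertices would use
            -- only colours in `S`. So only the `v` of colour `i` contribute to `bd b s`.
            have h1 : (insert v s).image κ ⊆ S := by
              intro x hx
              obtain ⟨w, hw, rfl⟩ := Finset.mem_image.1 hx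
              refine (Finset.mem_insert.1 (h.2 w hw)).resolve_left ?_
              rcases Finset.mem_insert.1 hw with rfl | hw
              · exact hv
              · exact hsi w hw
            have h2 := Finset.card_le_card h1
            rw [Finset.card_image_of_injOn (hκ _ h.1), Finset.card_insert_of_notMem hvs] at h2
            omega
    · rw [eq_zero_of_notMem hzh hsc, eq_zero_of_notMem hc.2 hsc]

end Step

/-- Acyclicity must be carried along with lifting, because removing a colour from the lifting
condition uses acyclicity at that stage. -/
theorem rankSelection {K : Set (Finset V)} {κ : V → ℕ} (hK : ∀ s ∈ K, ∀ t ⊆ s, t ∈ K)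
    (hκ : ∀ s ∈ K, Set.InjOn κ s) {S T : Finset ℕ} (hST : S ⊆ T)
    (hQ : LinksAcyclic k (selectOf K κ T) T.card) :
    LinksAcyclic k (selectOf K κ S) S.card ∧
      (LocalCyclesLift k (selectOf K κ T) T.card → LocalCyclesLift k (selectOf K κ S) S.card) := by
  obtain ⟨U, hU, rfl⟩ : ∃ U, Disjoint U S ∧ T = U ∪ S :=
    ⟨T \ S, Finset.sdiff_disjoint, (Finset.sdiff_union_of_subset hST).symm⟩
  clear hST
  induction U using Finset.induction_on generalizing S with
  | empty =>
    rw [Finset.empty_union] at hQ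
    rw [Finset.empty_union]
    exact ⟨hQ, id⟩
  | insert i U hi ih =>
    rw [Finset.disjoint_insert_left] at hU
    rw [Finset.insert_union, ← Finset.union_insert] at hQ ⊢
    obtain ⟨h1, h2⟩ := ih (Finset.disjoint_insert_right.2 ⟨hi, hU.2⟩) hQ
    rw [Finset.card_insert_of_notMem hU.1] at h1 h2
    exact ⟨h1.of_insert hK hκ hU.1, fun hR => LocalCyclesLift.of_insert hK hκ hU.1 h1 (h2 hR)⟩

end FaceChain

/-! ### Simplicial chains as singular chains -/

namespace FaceChain

variable {k : Type*} [Field k] {V : Type*} [LinearOrder V] [Fintype V] {n : ℕ}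

variable (k V) in
/-- A face as the increasing tuple of its vertices. -/
def toTuple (n : ℕ) : (Finset V → k) →ₗ[k] TupleChain k V n :=
  ∑ s : Finset V, if h : s.card = n then
    Finsupp.lsingle (s.orderEmbOfFin h : Fin n → V) ∘ₗ LinearMap.proj s else 0

lemma toTuple_apply (f : Finset V → k) : toTuple k V n f = ∑ s : Finset V,
    if h : s.card = n then Finsupp.single (s.orderEmbOfFin h : Fin n → V) (f s) else 0 := by
  rw [toTuple, LinearMap.sum_apply]
  refine Finset.sum_congr rfl fun s _ => ?_
  split_ifs <;> simp

lemma toTuple_apply_apply (f : Finset V → k) (s : Finset V) (h : s.card = n) :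
    toTuple k V n f (s.orderEmbOfFin h) = f s := by
  rw [toTuple_apply, Finsupp.finsetSum_apply, Finset.sum_eq_single s]
  · rw [dif_pos h, Finsupp.single_eq_same]
  · intro t _ hts
    split_ifs with ht
    · refine Finsupp.single_eq_of_ne' fun heq => hts ?_
      rw [← Finset.coe_inj, ← Finset.range_orderEmbOfFin t ht, heq, Finset.range_orderEmbOfFin]
    · rfl
  · simp

lemma toTuple_single (s : Finset V) (a : k) : toTuple k V n (Pi.single s a) =
    if h : s.card = n then Finsupp.single (s.orderEmbOfFin h : Fin n → V) a else 0 := by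
  rw [toTuple_apply, Finset.sum_eq_single s]
  · simp
  · intro t _ hts
    simp [hts]
  · simp

lemma lam_single (v : V) (s : Finset V) (a : k) : lam v (Pi.single s a) =
    if v ∈ s then Pi.single (s.erase v) (eps k v (s.erase v) * a) else 0 := by
  ext t
  rw [lam_apply]
  by_cases hvt : v ∈ t
  · rw [if_pos hvt]
    split_ifs with hvs
    · rw [Pi.single_eq_of_ne]
      rintro rfl
      simp at hvt
    · rfl
  · rw [if_neg hvt]
    by_cases hts : insert v t = s
    · subst hts
      simp [hvt]
    · rw [Pi.single_eq_of_ne hts, mul_zero]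
      split_ifs with hvs
      · rw [Pi.single_eq_of_ne]
        rintro rfl
        exact hts (Finset.insert_erase hvs)
      · rfl

lemma orderEmbOfFin_erase {s : Finset V} (h : s.card = n + 1) (i : Fin (n + 1))
    (h' : (s.erase (s.orderEmbOfFin h i)).card = n) :
    ((s.erase (s.orderEmbOfFin h i)).orderEmbOfFin h' : Fin n → V) =
      s.orderEmbOfFin h ∘ i.succAbove := by
  refine (Finset.orderEmbOfFin_unique h' (fun j => ?_) ?_).symm
  · rw [Finset.mem_erase]
    exact ⟨fun hj => Fin.succAbove_ne i j ((s.orderEmbOfFin h).injective hj),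
      Finset.orderEmbOfFin_mem s h _⟩
  · exact (s.orderEmbOfFin h).strictMono.comp (Fin.strictMono_succAbove i)

/-- Exactly `i` vertices precede the one at position `i`; this matches the signs of the two
boundaries. -/
lemma eps_orderEmbOfFin {s : Finset V} (h : s.card = n + 1) (i : Fin (n + 1)) :
    eps k (s.orderEmbOfFin h i) (s.erase (s.orderEmbOfFin h i)) = (-1) ^ (i : ℕ) := by
  rw [eps]
  congr 1
  have : (s.erase (s.orderEmbOfFin h i)).filter (· < s.orderEmbOfFin h i) =
      (Finset.Iio i).map (s.orderEmbOfFin h).toEmbedding := by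
    ext w
    simp only [Finset.mem_filter, Finset.mem_erase, Finset.mem_map, Finset.mem_Iio,
      RelEmbedding.coe_toEmbedding]
    constructor
    · rintro ⟨⟨-, hw⟩, hlt⟩
      obtain ⟨j, rfl⟩ : w ∈ Set.range (s.orderEmbOfFin h) := by
        rw [Finset.range_orderEmbOfFin]; exact hw
      exact ⟨j, (s.orderEmbOfFin h).lt_iff_lt.1 hlt, rfl⟩
    · rintro ⟨j, hj, rfl⟩
      have := (s.orderEmbOfFin h).lt_iff_lt.2 hj
      exact ⟨⟨this.ne, Finset.orderEmbOfFin_mem s h j⟩, this⟩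
  rw [this, Finset.card_map, Fin.card_Iio]

lemma bd_toTuple (f : Finset V → k) :
    TupleChain.bd (toTuple k V (n + 1) f) = toTuple k V n (bd f) := by
  suffices h : TupleChain.bd ∘ₗ toTuple k V (n + 1) = toTuple k V n ∘ₗ bd from
    LinearMap.congr_fun h f
  refine LinearMap.pi_ext' fun s => LinearMap.ext_ring ?_
  simp only [LinearMap.comp_apply, LinearMap.single_apply]
  rw [toTuple_single, bd_apply, map_sum]
  simp only [lam_single, mul_one]
  by_cases h : s.card = n + 1
  · rw [dif_pos h, TupleChain.bd_single, one_smul,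
      ← Finset.sum_subset (Finset.subset_univ s) (fun v _ hv => by rw [if_neg hv, map_zero])]
    have hs : s = Finset.univ.map (s.orderEmbOfFin h).toEmbedding := by
      ext w
      simp only [Finset.mem_map, Finset.mem_univ, true_and, RelEmbedding.coe_toEmbedding]
      rw [← Finset.mem_coe, ← Finset.range_orderEmbOfFin s h]
      rfl
    conv_rhs => rw [hs]
    rw [Finset.sum_map]
    refine Finset.sum_congr rfl fun i _ => ?_
    rw [RelEmbedding.coe_toEmbedding]
    have hmem := Finset.orderEmbOfFin_mem s h i
    have h' : (s.erase (s.orderEmbOfFin h i)).card = n := by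
      rw [Finset.card_erase_of_mem hmem, h]; rfl
    rw [← hs, if_pos hmem, toTuple_single, dif_pos h', orderEmbOfFin_erase, eps_orderEmbOfFin]
    simp
  · rw [dif_neg h, map_zero]
    refine (Finset.sum_eq_zero fun v _ => ?_).symm
    split_ifs with hv
    · rw [toTuple_single, dif_neg]
      rw [Finset.card_erase_of_mem hv]
      have := Finset.card_pos.2 ⟨v, hv⟩
      omega
    · rw [map_zero]

variable (k V) in
/-- A face as an affine simplex. -/
def toMap (n : ℕ) : (Finset V → k) →ₗ[k] MapChain k (V → ℝ) n :=
  MapChain.push id ∘ₗ TupleChain.map (fun v => Pi.single v 1) ∘ₗ toTuple k V n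

lemma bd_toMap (f : Finset V → k) : MapChain.bd (toMap k V (n + 1) f) = toMap k V n (bd f) := by
  simp only [toMap, LinearMap.comp_apply, MapChain.bd_push, TupleChain.bd_map, bd_toTuple]

/-- An affine simplex determines its tuple by its values at the vertices, and an increasing tuple
determines its face. -/
lemma toMap_eq_zero {f : Finset V → k} (hf : f ∈ hom k V n) (h : toMap k V n f = 0) : f = 0 := by
  have hinj : Function.Injective fun (x : Fin n → V) (t : stdSimplex ℝ (Fin n)) =>
      (id (MapChain.comb ((fun v => Pi.single v (1 : ℝ)) ∘ x) t) : V → ℝ) := by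
    intro x y hxy
    funext j
    have h1 := congrFun hxy (stdSimplex.vertex j)
    simp only [id, MapChain.comb, stdSimplex.vertex_coe, Pi.single_apply, ite_smul, one_smul,
      zero_smul, Finset.sum_ite_eq', Finset.mem_univ, if_true, Function.comp_apply] at h1
    by_contra hne
    have h2 := congrFun h1 (x j)
    rw [Pi.single_eq_same, Pi.single_eq_of_ne hne] at h2
    exact one_ne_zero h2
  have h0 : toTuple k V n f = 0 := by
    refine Finsupp.mapDomain_injective hinj ?_
    rw [Finsupp.mapDomain_zero, ← h]
    simp only [toMap, LinearMap.comp_apply, MapChain.push, TupleChain.map,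
      Finsupp.lmapDomain_apply]
    rw [← Finsupp.mapDomain_comp]
    rfl
  ext s
  by_cases hs : s.card = n
  · rw [← toTuple_apply_apply f s hs, h0]
    rfl
  · exact eq_zero_of_notMem hf hs

lemma toMap_injOn {f g : Finset V → k} (hf : f ∈ hom k V n) (hg : g ∈ hom k V n)
    (h : toMap k V n f = toMap k V n g) : f = g :=
  sub_eq_zero.1 (toMap_eq_zero (sub_mem hf hg) (by rw [map_sub, h, sub_self]))

variable (k) in
/-- The simplicial chains of `K` as singular chains. -/
def simp (K : Set (Finset V)) (n : ℕ) : Submodule k (MapChain k (V → ℝ) n) :=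
  (suppIn k K ⊓ hom k V n).map (toMap k V n)

/-- The geometric realization of `K`. -/
def real (K : Set (Finset V)) : Set (V → ℝ) :=
  {x | x ∈ stdSimplex ℝ V ∧ ∃ s ∈ K, ∀ v, x v ≠ 0 → v ∈ s}

/-- `K` contains the empty face and all subsets of its elements. -/
structure IsDownClosed (K : Set (Finset V)) : Prop where
  empty_mem : ∅ ∈ K
  down : ∀ s ∈ K, ∀ t ⊆ s, t ∈ K

lemma mem_real_iff {K : Set (Finset V)} (hK : IsDownClosed K) {x : V → ℝ} :
    x ∈ real K ↔ x ∈ stdSimplex ℝ V ∧ Finset.univ.filter (fun v => x v ≠ 0) ∈ K := by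
  refine and_congr_right fun _ => ⟨fun ⟨s, hs, h⟩ => hK.down s hs _ fun v hv => h v ?_, fun h =>
    ⟨_, h, fun v hv => by simpa using hv⟩⟩
  simpa using hv

lemma real_mono {K L : Set (Finset V)} (h : K ⊆ L) : real K ⊆ real L :=
  fun _ hx => ⟨hx.1, hx.2.imp fun _ hs => ⟨h hs.1, hs.2⟩⟩

lemma simp_mono {K L : Set (Finset V)} (h : K ⊆ L) (n : ℕ) : simp k K n ≤ simp k L n :=
  Submodule.map_mono (inf_le_inf_right _ (suppIn_mono h))

lemma simp_le_chainsIn (K : Set (Finset V)) (n : ℕ) :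
    simp k K n ≤ MapChain.chainsIn k (real K) n := by
  rintro _ ⟨f, hf, rfl⟩
  simp only [toMap, LinearMap.comp_apply, toTuple_apply, map_sum]
  refine Submodule.sum_mem _ fun s _ => ?_
  split_ifs with h
  · by_cases hfs : f s = 0
    · simp [hfs]
    · rw [TupleChain.map_single, MapChain.push_single]
      refine MapChain.single_mem_chainsIn (A := real K) (MapChain.continuous_comb _) (fun t => ?_) _
      refine ⟨?_, s, hf.1 s hfs, fun v hv => ?_⟩
      · exact MapChain.comb_mem (convex_stdSimplex ℝ V) (fun j => single_mem_stdSimplex ℝ _) t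
      · by_contra hvs
        refine hv ?_
        simp only [MapChain.comb, Finset.sum_apply, Pi.smul_apply, Function.comp_apply]
        refine Finset.sum_eq_zero fun j _ => ?_
        rw [Pi.single_eq_of_ne, smul_zero]
        rintro rfl
        exact hvs (Finset.orderEmbOfFin_mem s h j)
  · simp

lemma isSubcomplex_simp {K : Set (Finset V)} (hK : IsDownClosed K) :
    MapChain.IsSubcomplex (simp k K) := by
  rintro n _ ⟨f, hf, rfl⟩
  rw [bd_toMap]
  exact ⟨_, ⟨bd_mem_suppIn hf.1 fun s v _ hs => hK.down _ hs _ (Finset.subset_insert _ _),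
    bd_mem_hom hf.2⟩, rfl⟩

lemma simp_zero {K : Set (Finset V)} (hK : IsDownClosed K) : simp k K 0 = ⊤ := by
  rw [eq_top_iff]
  rintro c -
  have : IsEmpty (stdSimplex ℝ (Fin 0)) := by
    rw [stdSimplex_of_isEmpty_index]; infer_instance
  induction c using Finsupp.induction_linear with
  | zero => exact zero_mem _
  | add f g hf hg => exact add_mem hf hg
  | single σ a =>
    have h0 (s : Finset V) (hs : (Pi.single ∅ a : Finset V → k) s ≠ 0) : s = ∅ := by
      by_contra h
      exact hs (Pi.single_eq_of_ne h _)
    refine ⟨Pi.single ∅ a, ⟨fun s hs => h0 s hs ▸ hK.empty_mem, fun s hs => ?_⟩, ?_⟩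
    · simp [h0 s hs]
    · rw [toMap, LinearMap.comp_apply, LinearMap.comp_apply, toTuple_single,
        dif_pos Finset.card_empty, TupleChain.map_single, MapChain.push_single]
      congr 1
      exact Subsingleton.elim _ _

lemma simp_inter (K L : Set (Finset V)) (n : ℕ) : simp k (K ∩ L) n = simp k K n ⊓ simp k L n := by
  refine le_antisymm (le_inf (simp_mono Set.inter_subset_left n)
    (simp_mono Set.inter_subset_right n)) ?_
  rintro _ ⟨⟨f, hf, rfl⟩, ⟨g, hg, hfg⟩⟩
  have := toMap_injOn hg.2 hf.2 hfg
  subst this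
  exact ⟨g, ⟨fun s hs => ⟨hf.1 s hs, hg.1 s hs⟩, hf.2⟩, rfl⟩

lemma simp_union (K L : Set (Finset V)) (n : ℕ) : simp k (K ∪ L) n = simp k K n ⊔ simp k L n := by
  classical
  refine le_antisymm ?_ (sup_le (simp_mono Set.subset_union_left n)
    (simp_mono Set.subset_union_right n))
  rintro _ ⟨f, hf, rfl⟩
  have h1 : f = (fun s => if s ∈ K then f s else 0) + fun s => if s ∈ K then 0 else f s := by
    ext s
    simp only [Pi.add_apply]
    split_ifs <;> simp
  rw [h1, map_add]
  refine Submodule.add_mem_sup ⟨_, ⟨fun s hs => ?_, fun s hs => ?_⟩, rfl⟩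
    ⟨_, ⟨fun s hs => ?_, fun s hs => ?_⟩, rfl⟩ <;>
  · try simp only at hs
    split_ifs at hs with h
    all_goals first
      | exact h
      | exact hf.2 s hs
      | exact absurd rfl hs
      | exact (hf.1 s hs).resolve_left h

/-- The star of `v` is a cone, contracted by `mu v`. -/
lemma isExact_simp_star {K : Set (Finset V)} {v : V} :
    MapChain.IsExact (simp k {s | insert v s ∈ K}) := by
  have hmu (n : ℕ) (f : Finset V → k) (hf : f ∈ suppIn k {s | insert v s ∈ K} ⊓ hom k V n) :
      mu v f ∈ suppIn k {s | insert v s ∈ K} ⊓ hom k V (n + 1) :=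
    ⟨mu_mem_suppIn hf.1 fun s _ hs => by simpa using hs, mu_mem_hom hf.2⟩
  refine ⟨?_, ?_⟩
  · rintro _ ⟨f, hf, rfl⟩
    refine ⟨_, ⟨_, hmu 0 f hf, rfl⟩, ?_⟩
    rw [bd_toMap]
    congr 1
    ext s
    rw [bd_mu, Pi.sub_apply, mu_apply]
    split_ifs with h
    · have hb : bd f = 0 := by
        ext t
        rw [bd_apply, Finset.sum_apply]
        refine Finset.sum_eq_zero fun w _ => ?_
        rw [lam_apply]
        split_ifs
        · rfl
        · rw [eq_zero_of_notMem hf.2 (by simp), mul_zero]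
          
      simp [hb]
    · rw [sub_zero]
  · rintro n _ ⟨f, hf, rfl⟩ hbd
    refine ⟨_, ⟨_, hmu _ f hf, rfl⟩, ?_⟩
    rw [bd_toMap] at hbd ⊢
    rw [bd_mu, toMap_eq_zero (bd_mem_hom hf.2) hbd, map_zero, sub_zero]

end FaceChain

namespace FaceChain

variable {k : Type*} [Field k] {V : Type*} [LinearOrder V] [Fintype V] {n : ℕ}

/-! ### Comparison of simplicial and singular chains -/

/-- The projection of a simplex from the vertex `v` to the opposite face. -/
def projFrom (v : V) (x : V → ℝ) : V → ℝ := (1 - x v)⁻¹ • (x - x v • Pi.single v 1)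

lemma projFrom_self (v : V) (x : V → ℝ) : projFrom v x v = 0 := by
  simp [projFrom]

lemma projFrom_of_ne {v w : V} (h : w ≠ v) (x : V → ℝ) :
    projFrom v x w = (1 - x v)⁻¹ * x w := by
  simp [projFrom, h]

lemma projFrom_of_eq_zero {v : V} {x : V → ℝ} (h : x v = 0) : projFrom v x = x := by
  simp [projFrom, h]

lemma projFrom_mem {v : V} {x : V → ℝ} (hx : x ∈ stdSimplex ℝ V) (h : x v < 1) :
    projFrom v x ∈ stdSimplex ℝ V := by
  refine ⟨fun w => ?_, ?_⟩
  · rcases eq_or_ne w v with rfl | hw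
    · rw [projFrom_self]
    · rw [projFrom_of_ne hw]
      exact mul_nonneg (inv_nonneg.2 (by linarith)) (hx.1 w)
  · simp only [projFrom, Pi.smul_apply, smul_eq_mul, ← Finset.mul_sum, Pi.sub_apply,
      Finset.sum_sub_distrib, hx.2, Finset.sum_pi_single', Finset.mem_univ, if_true, mul_one]
    rw [inv_mul_cancel₀ (by linarith)]

lemma continuousOn_projFrom (v : V) : ContinuousOn (projFrom v) {x | x v < 1} := by
  have h : ContinuousOn (fun x : V → ℝ => (1 - x v)⁻¹) {x | x v < 1} := by
    refine ContinuousOn.inv₀ (by fun_prop) fun x hx => ?_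
    have : x v < 1 := hx
    linarith
  have h' : Continuous fun x : V → ℝ => x - x v • (Pi.single v 1 : V → ℝ) := by fun_prop
  exact h.smul h'.continuousOn

lemma convexComb_mem {x y : V → ℝ} (hx : x ∈ stdSimplex ℝ V) (hy : y ∈ stdSimplex ℝ V) {s : ℝ}
    (hs : s ∈ Set.Icc (0 : ℝ) 1) : (1 - s) • x + s • y ∈ stdSimplex ℝ V :=
  convex_stdSimplex ℝ V hx hy (by linarith [hs.2]) hs.1 (by ring)

/-- Induction on the number of vertices. For a vertex `v`, `K` is the union of the deletion `K'` and
the star `St`, which meet in the link of `v`. Thickenings `U` and `W` of the two realizations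
satisfy the small simplices theorem: `U` retracts to `K'`, `W` contracts to `v`, and `U ∩ W`
retracts to the link. Induction applies to `K'` and to the link, the star is exact on both sides,
and `MapChain.AcyclicPair.sup` glues. -/
theorem acyclicPair_simp {K : Set (Finset V)} (hK : IsDownClosed K) :
    MapChain.AcyclicPair (MapChain.chainsIn k (real K)) (simp k K) := by
  classical
  obtain ⟨N, hN⟩ : ∃ N, (Finset.univ.filter fun v => ({v} : Finset V) ∈ K).card = N := ⟨_, rfl⟩
  induction N using Nat.strong_induction_on generalizing K with
  | _ N ih =>
  by_cases hv : ∃ v, ({v} : Finset V) ∈ K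
  swap
  · intro n c hc _
    -- Without vertices the realization is empty, so there are no chains of positive degree.
    have hc0 : c = 0 := by
      rw [← Submodule.mem_bot k, ← Finsupp.supported_empty (M := k) (R := k)]
      refine Finsupp.supported_mono (fun σ hσ => ?_) hc
      obtain ⟨h1, s, hs, h2⟩ := hσ.2 (stdSimplex.vertex 0)
      obtain ⟨w, hw⟩ : ∃ w, σ (stdSimplex.vertex 0) w ≠ 0 := by
        by_contra! h
        have := h1.2
        simp [h] at this
      exact hv ⟨w, hK.down s hs _ (by simpa using h2 w hw)⟩
    exact ⟨0, zero_mem _, 0, zero_mem _, by simp [hc0]⟩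
  obtain ⟨v, hv⟩ := hv
  set K' : Set (Finset V) := {s | s ∈ K ∧ v ∉ s} with hK'
  set St : Set (Finset V) := {s | insert v s ∈ K} with hSt
  have hK'd : IsDownClosed K' := ⟨⟨hK.empty_mem, by simp⟩,
    fun s hs t hts => ⟨hK.down s hs.1 t hts, fun h => hs.2 (hts h)⟩⟩
  have hStd : IsDownClosed St := ⟨by simpa [hSt] using hv,
    fun s hs t hts => hK.down _ hs _ (Finset.insert_subset_insert _ hts)⟩
  have hLd : IsDownClosed (K' ∩ St) := ⟨⟨hK'd.empty_mem, hStd.empty_mem⟩,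
    fun s hs t hts => ⟨hK'd.down s hs.1 t hts, hStd.down s hs.2 t hts⟩⟩
  have hStK : St ⊆ K := fun s hs => hK.down _ hs _ (Finset.subset_insert _ _)
  have hKeq : K = K' ∪ St := by
    refine Set.Subset.antisymm (fun s hs => ?_) (Set.union_subset (fun s hs => hs.1) hStK)
    by_cases hvs : v ∈ s
    · exact Or.inr (by simpa [hSt, Finset.insert_eq_self.2 hvs] using hs)
    · exact Or.inl ⟨hs, hvs⟩
  have hlt (L : Set (Finset V)) (hL : L ⊆ K') :
      (Finset.univ.filter fun w => ({w} : Finset V) ∈ L).card < N := by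
    rw [← hN]
    refine Finset.card_lt_card ⟨fun w hw => ?_, fun h => ?_⟩
    · simp only [Finset.mem_filter, Finset.mem_univ, true_and] at hw ⊢
      exact (hL hw).1
    · have := h (by simpa using hv : v ∈ Finset.univ.filter fun w => ({w} : Finset V) ∈ K)
      simp only [Finset.mem_filter, Finset.mem_univ, true_and] at this
      exact (hL this).2 (by simp)
  have hK'c := ih _ (hlt K' subset_rfl) hK'd rfl
  have hLc := ih _ (hlt (K' ∩ St) Set.inter_subset_left) hLd rfl
  -- supports of points
  have hreal' {x : V → ℝ} (hx : x ∈ real K') : x v = 0 := by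
    obtain ⟨-, s, hs, h⟩ := hx
    by_contra h'
    exact hs.2 (h v h')
  have hproj {x : V → ℝ} (hx : x ∈ real K) (h1 : x v < 1) : projFrom v x ∈ real K' := by
    obtain ⟨hx, s, hs, h⟩ := hx
    refine ⟨projFrom_mem hx h1, s.erase v, ⟨hK.down s hs _ (Finset.erase_subset _ _), by simp⟩, ?_⟩
    intro w hw
    have hwv : w ≠ v := by
      rintro rfl
      exact hw (projFrom_self _ _)
    rw [projFrom_of_ne hwv] at hw
    exact Finset.mem_erase.2 ⟨hwv, h w (right_ne_zero_of_mul hw)⟩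
  have hprojL {x : V → ℝ} (hx : x ∈ real K) (h1 : x v < 1) (h0 : 0 < x v) :
      projFrom v x ∈ real (K' ∩ St) := by
    obtain ⟨hx, s, hs, h⟩ := hx
    have hvs : v ∈ s := h v h0.ne'
    refine ⟨projFrom_mem hx h1, s.erase v, ⟨⟨hK.down s hs _ (Finset.erase_subset _ _), by simp⟩,
      ?_⟩, ?_⟩
    · simpa [hSt, Finset.insert_erase hvs] using hs
    · intro w hw
      have hwv : w ≠ v := by
        rintro rfl
        exact hw (projFrom_self _ _)
      rw [projFrom_of_ne hwv] at hw
      exact Finset.mem_erase.2 ⟨hwv, h w (right_ne_zero_of_mul hw)⟩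
  have hseg {x : V → ℝ} (hx : x ∈ real K) (h1 : x v < 1) {s : ℝ} (hs : s ∈ Set.Icc (0 : ℝ) 1) :
      (1 - s) • x + s • projFrom v x ∈ real K := by
    obtain ⟨hx, t, ht, h⟩ := hx
    refine ⟨convexComb_mem hx (projFrom_mem hx h1) hs, t, ht, fun w hw => h w fun hw' => hw ?_⟩
    rcases eq_or_ne w v with rfl | hwv
    · simp [hw', projFrom_self]
    · simp [hw', projFrom_of_ne hwv]
  have hsegv {x : V → ℝ} (s : ℝ) : ((1 - s) • x + s • projFrom v x) v = (1 - s) * x v := by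
    simp [projFrom_self]
  -- the two pieces
  set U : Set (V → ℝ) := {x | x ∈ real K ∧ x v < 1} with hU
  -- The link, where `x v = 0`, is added so that `W` contains the whole star. Then `W` need not be
  -- relatively open, but it contains the open piece `0 < x v`, which is all that excision needs.
  set W : Set (V → ℝ) := {x | x ∈ real K ∧ (0 < x v ∨ x ∈ real (K' ∩ St))} with hW
  have hLK : real (K' ∩ St) ⊆ real K := real_mono fun s hs => hs.1.1
  have hL0 {x : V → ℝ} (hx : x ∈ real (K' ∩ St)) : x v = 0 :=
    hreal' (real_mono Set.inter_subset_left hx)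
  have hK'U : real K' ⊆ U := fun x hx =>
    ⟨real_mono (fun s hs => hs.1) hx, by rw [hreal' hx]; exact zero_lt_one⟩
  have hStW : real St ⊆ W := by
    rintro x ⟨hx, s, hs, h⟩
    refine ⟨⟨hx, s, hStK hs, h⟩, ?_⟩
    rcases (hx.1 v).eq_or_lt with h0 | h0
    · refine Or.inr ⟨hx, s.erase v, ⟨⟨hK.down _ hs _ ((Finset.erase_subset _ _).trans
        (Finset.subset_insert _ _)), by simp⟩, hStd.down _ hs _ (Finset.erase_subset _ _)⟩, ?_⟩
      intro w hw
      refine Finset.mem_erase.2 ⟨?_, h w hw⟩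
      rintro rfl
      exact hw h0.symm
    · exact Or.inl h0
  have hUc : MapChain.AcyclicPair (MapChain.chainsIn k U) (simp k K') := by
    refine MapChain.AcyclicPair.trans (Q := MapChain.chainsIn k (real K')) ?_ hK'c
      (MapChain.chainsIn_mono hK'U) (simp_le_chainsIn _)
    refine MapChain.acyclicPair_of_retraction hK'U (r := projFrom v)
      ((continuousOn_projFrom v).mono fun x hx => hx.2) (fun x hx => hproj hx.1 hx.2)
      (fun x hx => projFrom_of_eq_zero (hreal' hx)) fun x hx s hs => ⟨hseg hx.1 hx.2 hs, ?_⟩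
    rw [hsegv]
    have h0 := hx.1.1.1 v
    have h1 := hx.2
    nlinarith [hs.1, hs.2]
  have hWc : MapChain.AcyclicPair (MapChain.chainsIn k W) (simp k St) := by
    have hvW : Pi.single v 1 ∈ W := hStW ⟨single_mem_stdSimplex ℝ v, {v}, by simpa [hSt] using hv,
      fun w hw => by
        by_contra h
        exact hw (Pi.single_eq_of_ne (by simpa using h) _)⟩
    refine MapChain.AcyclicPair.of_isExact ?_ isExact_simp_star
      fun n => (simp_le_chainsIn _ n).trans (MapChain.chainsIn_mono hStW n)
    refine MapChain.AcyclicPair.isExact (P := MapChain.chainsIn k {Pi.single v 1}) ?_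
      (MapChain.isExact_chainsIn_singleton _)
      (MapChain.chainsIn_mono (Set.singleton_subset_iff.2 hvW)) (by simp [MapChain.chainsIn_zero])
    refine MapChain.acyclicPair_of_retraction (Set.singleton_subset_iff.2 hvW)
      (r := fun _ => Pi.single v 1) continuousOn_const (fun _ _ => rfl) (fun x hx => hx.symm) ?_
    rintro x ⟨hx, hx'⟩ s hs
    have hmem := convexComb_mem hx.1 (single_mem_stdSimplex ℝ v) hs
    obtain ⟨t, ht, hxt⟩ : ∃ t, insert v t ∈ K ∧ ∀ w, x w ≠ 0 → w ∈ insert v t := by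
      rcases hx' with h0 | ⟨-, t, ht, h⟩
      · obtain ⟨-, t, ht, h⟩ := hx
        exact ⟨t, by rwa [Finset.insert_eq_self.2 (h v h0.ne')],
          fun w hw => Finset.mem_insert_of_mem (h w hw)⟩
      · exact ⟨t, ht.2, fun w hw => Finset.mem_insert_of_mem (h w hw)⟩
    refine ⟨⟨hmem, _, ht, fun w hw => ?_⟩, ?_⟩
    · by_cases hwv : w = v
      · simp [hwv]
      · exact hxt w fun h => hw (by simp [h, hwv])
    · rcases hs.1.eq_or_lt with rfl | hs0
      · simpa using hx'
      · left
        have := hx.1.1 v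
        have : 0 ≤ (1 - s) * x v := mul_nonneg (by linarith [hs.2]) this
        simp only [Pi.add_apply, Pi.smul_apply, smul_eq_mul, Pi.single_eq_same, mul_one]
        linarith
  have hUWc : MapChain.AcyclicPair (fun n => MapChain.chainsIn k U n ⊓ MapChain.chainsIn k W n)
      (fun n => simp k K' n ⊓ simp k St n) := by
    have e1 : (fun n => MapChain.chainsIn k U n ⊓ MapChain.chainsIn k W n) =
        MapChain.chainsIn k (U ∩ W) := funext fun n => (MapChain.chainsIn_inter U W n).symm
    have e2 : (fun n => simp k K' n ⊓ simp k St n) = simp k (K' ∩ St) :=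
      funext fun n => (simp_inter K' St n).symm
    rw [e1, e2]
    have hLUW : real (K' ∩ St) ⊆ U ∩ W := Set.subset_inter
      ((real_mono Set.inter_subset_left).trans hK'U) ((real_mono Set.inter_subset_right).trans hStW)
    refine MapChain.AcyclicPair.trans (Q := MapChain.chainsIn k (real (K' ∩ St))) ?_ hLc
      (MapChain.chainsIn_mono hLUW) (simp_le_chainsIn _)
    have hr {x : V → ℝ} (hx : x ∈ U ∩ W) : projFrom v x ∈ real (K' ∩ St) := by
      rcases hx.2.2 with h0 | hL
      · exact hprojL hx.1.1 hx.1.2 h0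
      · rwa [projFrom_of_eq_zero (hL0 hL)]
    refine MapChain.acyclicPair_of_retraction hLUW (r := projFrom v)
      ((continuousOn_projFrom v).mono fun x hx => hx.1.2) (fun x hx => hr hx)
      (fun x hx => projFrom_of_eq_zero (hL0 hx)) fun x hx s hs => ?_
    -- At time `1` the coordinate at `v` is zero, so the endpoint lies in `W` only as a point of the
    -- link.
    rcases hs.2.eq_or_lt with rfl | hs1
    · simpa using hLUW (hr hx)
    rcases hx.2.2 with h0 | hL
    · refine ⟨⟨hseg hx.1.1 hx.1.2 hs, ?_⟩, ⟨hseg hx.1.1 hx.1.2 hs, Or.inl ?_⟩⟩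
      · rw [hsegv]
        nlinarith [hs.1, hs.2, hx.1.2]
      · rw [hsegv]
        exact mul_pos (by linarith) h0
    · rwa [projFrom_of_eq_zero (hL0 hL), ← add_smul, sub_add_cancel, one_smul]
  have hsup := MapChain.AcyclicPair.sup hUc hWc hUWc
    (fun n => (simp_le_chainsIn _ n).trans (MapChain.chainsIn_mono hK'U n))
    (fun n => (simp_le_chainsIn _ n).trans (MapChain.chainsIn_mono hStW n))
    (MapChain.isSubcomplex_chainsIn U) (MapChain.isSubcomplex_chainsIn W)
    (isSubcomplex_simp hK'd) (isSubcomplex_simp hStd) (simp_zero hK'd) (simp_zero hStd)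
  have e : simp k K = fun n => simp k K' n ⊔ simp k St n := by
    funext n
    rw [← simp_union, ← hKeq]
  rw [e]
  refine MapChain.AcyclicPair.trans (MapChain.acyclicPair_chainsIn_sup (U := U) (W := W)
    (U' := {x | x v < 1}) (W' := {x | 0 < x v}) ?_ ?_ ?_ ?_ ?_) hsup ?_ ?_
  · exact isOpen_lt (continuous_apply v) continuous_const
  · exact isOpen_lt continuous_const (continuous_apply v)
  · intro x _
    rcases lt_or_ge (x v) 1 with h | h
    · exact Or.inl h
    · exact Or.inr (zero_lt_one.trans_le h)
  · exact fun x hx => hx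
  · exact fun x hx => ⟨hx.1, Or.inl hx.2⟩
  · exact fun n => sup_le (MapChain.chainsIn_mono (fun x hx => hx.1) n)
      (MapChain.chainsIn_mono (fun x hx => hx.1) n)
  · exact fun n => sup_le_sup ((simp_le_chainsIn _ n).trans (MapChain.chainsIn_mono hK'U n))
      ((simp_le_chainsIn _ n).trans (MapChain.chainsIn_mono hStW n))

end FaceChain

/-! ### Vanishing and lifting conditions -/

namespace MapChain

variable {k : Type*} [Field k] {E : Type*}

/-- The cycles of positive degree `n` in `Q` bound. -/
def CyclesBound (Q : ∀ n, Submodule k (MapChain k E n)) (n : ℕ) : Prop :=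
  ∀ c ∈ Q (n + 1), bd c = 0 → ∃ b ∈ Q (n + 2), bd b = c

/-- The map from the homology of `X` to the homology of `X` relative to `A` is surjective in
degree `n + 1`. -/
def RelSurjective (X A : ∀ n, Submodule k (MapChain k E n)) (n : ℕ) : Prop :=
  ∀ c ∈ X (n + 1), bd c ∈ A n → ∃ z ∈ X (n + 1), bd z = 0 ∧
    ∃ a ∈ A (n + 1), ∃ x ∈ X (n + 2), c = z + a + bd x

variable [Zero E]

lemma AcyclicPair.cyclesBound_iff {X X' : ∀ n, Submodule k (MapChain k E n)} {n : ℕ}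
    (h : AcyclicPair X X') (hX : ∀ n, X' n ≤ X n) : CyclesBound X n ↔ CyclesBound X' n := by
  refine ⟨fun hb c hc hbd => ?_, fun hb c hc hbd => ?_⟩
  · obtain ⟨b, hb, rfl⟩ := hb c (hX _ hc) hbd
    obtain ⟨p, hp, q, _, rfl⟩ := h _ b hb hc
    exact ⟨p, hp, by rw [map_add, bd_bd, add_zero]⟩
  · obtain ⟨p, hp, q, hq, rfl⟩ := h _ c hc (hbd ▸ zero_mem _)
    rw [map_add, bd_bd, add_zero] at hbd
    obtain ⟨b, hb, rfl⟩ := hb p hp hbd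
    exact ⟨b + q, add_mem (hX _ hb) hq, map_add _ _ _⟩

/-- Replacing both members of a pair by homologically equivalent subcomplexes changes neither the
absolute nor the relative homology, and the argument follows representatives. -/
lemma AcyclicPair.relSurjective_iff {X X' A A' : ∀ n, Submodule k (MapChain k E n)} {n : ℕ}
    (hXX' : AcyclicPair X X') (hAA' : AcyclicPair A A') (hX : ∀ n, X' n ≤ X n)
    (hA : ∀ n, A' n ≤ A n) (hAX : ∀ n, A n ≤ X n) (hAX' : ∀ n, A' n ≤ X' n) (h0 : A' 0 = ⊤) :
    RelSurjective X A n ↔ RelSurjective X' A' n := by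
  refine ⟨fun h c hc hbd => ?_, fun h c hc hbd => ?_⟩
  · obtain ⟨z, hz, hz0, a, ha, x, hx, rfl⟩ := h c (hX _ hc) (hA _ hbd)
    obtain ⟨z', hz', y, hy, rfl⟩ := hXX' _ z hz (hz0 ▸ zero_mem _)
    rw [map_add, bd_bd, add_zero] at hz0
    rw [map_add, map_add, map_add, hz0, bd_bd, bd_bd, zero_add, zero_add, add_zero] at hbd
    obtain ⟨a', ha', a'', ha'', rfl⟩ := hAA' _ a ha hbd
    obtain ⟨x', hx', w, _, hw⟩ := hXX' _ (y + a'' + x)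
      (add_mem (add_mem hy (hAX _ ha'')) hx) (by
        have : bd (y + a'' + x) = (z' + bd y + (a' + bd a'') + bd x) - z' - a' := by
          rw [map_add, map_add]; abel
        rw [this]
        exact sub_mem (sub_mem hc hz') (hAX' _ ha'))
    refine ⟨z', hz', hz0, a', ha', x', hx', ?_⟩
    have : bd (y + a'' + x) = bd x' := by rw [hw, map_add, bd_bd, add_zero]
    rw [← this, map_add, map_add]
    abel
  · obtain ⟨a', ha', a, ha, haa⟩ : ∃ a' ∈ A' n, ∃ a ∈ A (n + 1), bd c = a' + bd a := by
      cases n with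
      | zero => exact ⟨bd c, by simp [h0], 0, zero_mem _, by simp⟩
      | succ n => exact hAA' n _ hbd (by rw [bd_bd]; exact zero_mem _)
    have hca : bd (c - a) = a' := by rw [map_sub, haa]; abel
    obtain ⟨x', hx', x, hx, hxx⟩ := hXX' _ (c - a) (sub_mem hc (hAX _ ha))
      (by rw [hca]; exact hAX' _ ha')
    obtain ⟨z, hz, hz0, a'', ha'', x'', hx'', rfl⟩ := h x' hx' (by
      have : bd x' = a' := by rw [← hca, hxx, map_add, bd_bd, add_zero]
      rw [this]; exact ha')
    refine ⟨z, hX _ hz, hz0, a + a'', add_mem ha (hA _ ha''), x + x'',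
      add_mem hx (hX _ hx''), ?_⟩
    rw [eq_add_of_sub_eq hxx, map_add]
    abel

end MapChain

namespace FaceChain

variable {k : Type*} [Field k] {V : Type*} [LinearOrder V] [Fintype V] {n : ℕ}

lemma cyclesBound_simp_iff {K : Set (Finset V)} : MapChain.CyclesBound (simp k K) n ↔
    ∀ c ∈ suppIn k K ⊓ hom k V (n + 1), bd c = 0 → ∃ b ∈ suppIn k K ⊓ hom k V (n + 2), bd b = c := by
  refine ⟨fun h c hc hbd => ?_, ?_⟩
  · obtain ⟨_, ⟨b, hb, rfl⟩, h⟩ := h _ ⟨c, hc, rfl⟩ (by rw [bd_toMap, hbd, map_zero])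
    rw [bd_toMap] at h
    exact ⟨b, hb, toMap_injOn (bd_mem_hom hb.2) hc.2 h⟩
  · rintro h _ ⟨c, hc, rfl⟩ hbd
    rw [bd_toMap] at hbd
    obtain ⟨b, hb, rfl⟩ := h c hc (toMap_eq_zero (bd_mem_hom hc.2) hbd)
    exact ⟨_, ⟨b, hb, rfl⟩, bd_toMap b⟩

/-- The faces of `K` that do not contain `ρ`. -/
def costar (K : Set (Finset V)) (ρ : Finset V) : Set (Finset V) := {s | s ∈ K ∧ ¬ ρ ⊆ s}

lemma IsDownClosed.costar {K : Set (Finset V)} (hK : IsDownClosed K) {ρ : Finset V}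
    (hρ : ρ.Nonempty) : IsDownClosed (costar K ρ) :=
  ⟨⟨hK.empty_mem, fun h => hρ.ne_empty (Finset.subset_empty.1 h)⟩,
    fun s hs t hts => ⟨hK.down s hs.1 t hts, fun h => hs.2 (h.trans hts)⟩⟩

/-- In top degree there are no boundaries to divide out, so a relative class is given by its values
on the faces containing `ρ`. -/
lemma relSurjective_simp_iff {K : Set (Finset V)} (hK : IsDownClosed K)
    (hn : ∀ s ∈ K, s.card ≤ n + 1) {ρ : Finset V} :
    MapChain.RelSurjective (simp k K) (simp k (costar K ρ)) n ↔
      ∀ c ∈ suppIn k K ⊓ hom k V (n + 1), (∀ s, ρ ⊆ s → bd c s = 0) →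
        ∃ z ∈ suppIn k K ⊓ hom k V (n + 1), bd z = 0 ∧ ∀ s, ρ ⊆ s → z s = c s := by
  refine ⟨fun h c hc hbd => ?_, ?_⟩
  · obtain ⟨_, ⟨z, hz, rfl⟩, hz0, _, ⟨a, ha, rfl⟩, _, ⟨x, hx, rfl⟩, h⟩ := h _ ⟨c, hc, rfl⟩ (by
      rw [bd_toMap]
      refine ⟨_, ⟨fun s hs => ⟨?_, fun h => hs (hbd s h)⟩, bd_mem_hom hc.2⟩, rfl⟩
      exact bd_mem_suppIn hc.1
        (fun s v _ hs => hK.down _ hs _ (Finset.subset_insert _ _)) s hs)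
    have hx0 : x = 0 := by
      ext s
      by_contra hs
      have h1 := hn s (hx.1 s hs)
      have h2 : s.card = n + 2 := hx.2 s hs
      omega
    rw [bd_toMap] at hz0
    rw [hx0, map_zero, map_zero, add_zero, ← map_add] at h
    have := toMap_injOn hc.2 (add_mem hz.2 ha.2) h
    refine ⟨z, hz, toMap_eq_zero (bd_mem_hom hz.2) hz0, fun s hs => ?_⟩
    rw [this, Pi.add_apply, eq_zero_of_notMem ha.1 fun h => h.2 hs, add_zero]
  · rintro h _ ⟨c, hc, rfl⟩ hbd
    rw [bd_toMap] at hbd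
    obtain ⟨d, hd, hdc⟩ := hbd
    have := toMap_injOn hd.2 (bd_mem_hom hc.2) hdc
    obtain ⟨z, hz, hz0, hzc⟩ := h c hc fun s hs => by
      rw [← this]
      exact eq_zero_of_notMem hd.1 fun h => h.2 hs
    refine ⟨_, ⟨z, hz, rfl⟩, by rw [bd_toMap, hz0, map_zero], _, ⟨c - z, ⟨fun s hs => ⟨?_, ?_⟩,
      sub_mem hc.2 hz.2⟩, rfl⟩, 0, zero_mem _, by simp⟩
    · exact (sub_mem hc.1 hz.1 : c - z ∈ suppIn k K) s hs
    · intro h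
      exact hs (by rw [Pi.sub_apply, hzc s h, sub_self])

/-! ### The complement of a point -/

section Costar

variable {K : Set (Finset V)} {p : V → ℝ}

/-- The vertices of the face that contains `p` in its interior. -/
def carrier (p : V → ℝ) : Finset V := Finset.univ.filter fun v => p v ≠ 0

lemma mem_carrier {v : V} : v ∈ carrier p ↔ p v ≠ 0 := by simp [carrier]

lemma carrier_nonempty (hp : p ∈ stdSimplex ℝ V) : (carrier p).Nonempty := by
  by_contra! h
  have h1 := hp.2
  rw [Finset.sum_eq_zero] at h1
  · exact zero_ne_one h1
  · intro v _
    by_contra hv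
    exact absurd (mem_carrier.2 hv) (by simp [h])

/-- The largest multiple of `p` below `x`. -/
def ratio (hp : (carrier p).Nonempty) (x : V → ℝ) : ℝ :=
  (carrier p).inf' hp fun v => x v / p v

/-- The radial projection from `p`. -/
def radial (hp : (carrier p).Nonempty) (x : V → ℝ) : V → ℝ :=
  (1 - ratio hp x)⁻¹ • (x - ratio hp x • p)

variable (hp : p ∈ stdSimplex ℝ V)

include hp

lemma ratio_mul_le (hc : (carrier p).Nonempty) {x : V → ℝ} (hx : x ∈ stdSimplex ℝ V) (v : V) :
    ratio hc x * p v ≤ x v := by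
  by_cases hv : p v = 0
  · rw [hv, mul_zero]; exact hx.1 v
  · rw [← le_div_iff₀ (lt_of_le_of_ne (hp.1 v) (Ne.symm hv))]
    exact Finset.inf'_le _ (mem_carrier.2 hv)

lemma exists_ratio_mul_eq (hc : (carrier p).Nonempty) (x : V → ℝ) :
    ∃ v ∈ carrier p, ratio hc x * p v = x v := by
  obtain ⟨v, hv, h⟩ := Finset.exists_mem_eq_inf' hc fun v => x v / p v
  exact ⟨v, hv, by rw [ratio, h, div_mul_cancel₀ _ (mem_carrier.1 hv)]⟩

lemma ratio_nonneg (hc : (carrier p).Nonempty) {x : V → ℝ} (hx : x ∈ stdSimplex ℝ V) :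
    0 ≤ ratio hc x :=
  (Finset.le_inf'_iff hc _).2 fun v _ => div_nonneg (hx.1 v) (hp.1 v)

/-- A ratio of at least `1` would give `p ≤ x` in every coordinate; both have coordinate sum `1`, so
they would be equal. -/
lemma ratio_lt_one (hc : (carrier p).Nonempty) {x : V → ℝ} (hx : x ∈ stdSimplex ℝ V)
    (hxp : x ≠ p) : ratio hc x < 1 := by
  by_contra! h
  refine hxp ?_
  have hle (v : V) : p v ≤ x v :=
    (le_mul_of_one_le_left (hp.1 v) h).trans (ratio_mul_le hp hc hx v)
  have := (Finset.sum_eq_sum_iff_of_le fun v _ => hle v).1 (hp.2.trans hx.2.symm)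
  exact funext fun v => (this v (Finset.mem_univ v)).symm

lemma radial_mem (hc : (carrier p).Nonempty) {x : V → ℝ} (hx : x ∈ stdSimplex ℝ V)
    (hxp : x ≠ p) : radial hc x ∈ stdSimplex ℝ V := by
  have h1 := ratio_lt_one hp hc hx hxp
  refine ⟨fun v => mul_nonneg (inv_nonneg.2 (by linarith)) ?_, ?_⟩
  · have := ratio_mul_le hp hc hx v
    simp only [Pi.sub_apply, Pi.smul_apply, smul_eq_mul]
    linarith
  · simp only [radial, Pi.smul_apply, smul_eq_mul, ← Finset.mul_sum, Pi.sub_apply,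
      Finset.sum_sub_distrib, hx.2, hp.2, mul_one]
    rw [inv_mul_cancel₀ (by linarith)]

lemma continuousOn_radial (hc : (carrier p).Nonempty) {A : Set (V → ℝ)}
    (hA : A ⊆ stdSimplex ℝ V) (hA' : p ∉ A) : ContinuousOn (radial hc) A := by
  have h0 : Continuous (ratio hc) :=
    Continuous.finset_inf'_apply hc fun v _ => (continuous_apply v).div_const _
  have h : ContinuousOn (fun x : V → ℝ => (1 - ratio hc x)⁻¹) A := by
    refine ContinuousOn.inv₀ (by fun_prop) fun x hx => ?_
    have := ratio_lt_one hp hc (hA hx) fun h => hA' (h ▸ hx)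
    linarith
  have h' : Continuous fun x : V → ℝ => x - ratio hc x • p := by fun_prop
  exact h.smul h'.continuousOn

lemma radial_eq_zero (hc : (carrier p).Nonempty) {x : V → ℝ} (hx : x ∈ stdSimplex ℝ V) {v : V}
    (hv : x v = 0) : radial hc x v = 0 := by
  have h1 := ratio_mul_le hp hc hx v
  have h2 := mul_nonneg (ratio_nonneg hp hc hx) (hp.1 v)
  have : ratio hc x * p v = 0 := by linarith
  simp [radial, hv, this]

/-- Moving away from `p` until the first coordinate in its carrier vanishes is a deformation
retraction onto the faces that do not contain the carrier. -/
lemma acyclicPair_compl_point (hK : IsDownClosed K) :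
    MapChain.AcyclicPair (MapChain.chainsIn k (real K \ {p}))
      (MapChain.chainsIn k (real (costar K (carrier p)))) := by
  have hc := carrier_nonempty hp
  have hcost {x : V → ℝ} (hx : x ∈ real (costar K (carrier p))) : ∃ v ∈ carrier p, x v = 0 := by
    obtain ⟨-, s, hs, h⟩ := hx
    obtain ⟨v, hv, hvs⟩ := Finset.not_subset.1 hs.2
    exact ⟨v, hv, by_contra fun h' => hvs (h v h')⟩
  have hratio {x : V → ℝ} (hx : x ∈ real (costar K (carrier p))) : ratio hc x = 0 := by
    obtain ⟨v, hv, hxv⟩ := hcost hx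
    refine le_antisymm ?_ (ratio_nonneg hp hc hx.1)
    have := Finset.inf'_le (fun v => x v / p v) hv
    exact this.trans_eq (by simp [hxv])
  refine MapChain.acyclicPair_of_retraction (r := radial hc) ?_
    (continuousOn_radial hp hc (fun x hx => hx.1.1) fun h => h.2 rfl) ?_ ?_ ?_
  · refine fun x hx => ⟨real_mono (fun s hs => hs.1) hx, ?_⟩
    rintro rfl
    obtain ⟨v, hv, hv'⟩ := hcost hx
    exact mem_carrier.1 hv hv'
  · rintro x ⟨⟨hx, s, hs, h⟩, hxp⟩
    refine ⟨radial_mem hp hc hx hxp, carrier (radial hc x), ⟨hK.down s hs _ fun v hv => h v ?_, ?_⟩,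
      fun v hv => mem_carrier.2 hv⟩
    · exact fun h' => mem_carrier.1 hv (radial_eq_zero hp hc hx h')
    · intro hsub
      obtain ⟨v, hv, hv'⟩ := exists_ratio_mul_eq hp hc x
      exact mem_carrier.1 (hsub hv) (by simp [radial, hv'])
  · intro x hx
    simp [radial, hratio hx]
  · rintro x ⟨⟨hx, s, hs, h⟩, hxp⟩ a ha
    refine ⟨⟨convexComb_mem hx (radial_mem hp hc hx hxp) ha, s, hs, fun v hv => h v fun h' => hv ?_⟩,
      fun hap => ?_⟩
    · simp [h', radial_eq_zero hp hc hx h']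
    -- At a coordinate attaining the ratio, the segment has value `(1 - a) * ratio hc x * p v`,
    -- which is less than `p v`; so it misses `p`.
    · obtain ⟨v, hv, hv'⟩ := exists_ratio_mul_eq hp hc x
      have h1 := congrFun hap v
      have h2 : radial hc x v = 0 := by simp [radial, hv']
      simp only [Pi.add_apply, Pi.smul_apply, h2, smul_eq_mul, mul_zero, add_zero, ← hv'] at h1
      have h3 : 0 < p v := lt_of_le_of_ne (hp.1 v) (Ne.symm (mem_carrier.1 hv))
      have h4 := ratio_lt_one hp hc hx hxp
      have h5 := ratio_nonneg hp hc hx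
      have h6 : (1 - a) * ratio hc x < 1 := by nlinarith [ha.1, ha.2]
      nlinarith

end Costar

theorem relSurjective_chainsIn_iff {K : Set (Finset V)} (hK : IsDownClosed K)
    (hn : ∀ s ∈ K, s.card ≤ n + 1) {p : V → ℝ} (hp : p ∈ real K) :
    MapChain.RelSurjective (MapChain.chainsIn k (real K)) (MapChain.chainsIn k (real K \ {p})) n ↔
      ∀ c ∈ suppIn k K ⊓ hom k V (n + 1), (∀ s, carrier p ⊆ s → bd c s = 0) →
        ∃ z ∈ suppIn k K ⊓ hom k V (n + 1), bd z = 0 ∧ ∀ s, carrier p ⊆ s → z s = c s := by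
  have hd := hK.costar (carrier_nonempty hp.1)
  have hsub : real (costar K (carrier p)) ⊆ real K \ {p} := by
    refine fun x hx => ⟨real_mono (fun s hs => hs.1) hx, ?_⟩
    rintro rfl
    obtain ⟨-, s, hs, h⟩ := hx
    exact hs.2 fun v hv => h v (mem_carrier.1 hv)
  rw [← relSurjective_simp_iff hK hn]
  refine MapChain.AcyclicPair.relSurjective_iff (acyclicPair_simp hK)
    ((acyclicPair_compl_point hp.1 hK).trans (acyclicPair_simp hd)
      (MapChain.chainsIn_mono hsub) (simp_le_chainsIn _)) (simp_le_chainsIn _) ?_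
      (MapChain.chainsIn_mono Set.sdiff_subset) (simp_mono fun s hs => hs.1) (simp_zero hd)
  exact fun n => (simp_le_chainsIn _ n).trans (MapChain.chainsIn_mono hsub n)

theorem cyclesBound_chainsIn_iff {K : Set (Finset V)} (hK : IsDownClosed K) :
    MapChain.CyclesBound (MapChain.chainsIn k (real K)) n ↔
      ∀ c ∈ suppIn k K ⊓ hom k V (n + 1), bd c = 0 →
        ∃ b ∈ suppIn k K ⊓ hom k V (n + 2), bd b = c := by
  rw [← cyclesBound_simp_iff]
  exact (acyclicPair_simp hK).cyclesBound_iff (simp_le_chainsIn _)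

end FaceChain

/-! ### Elements of the homology of a complex of modules -/

namespace HomologicalComplex

variable {k : Type u} [Field k] {C D : ChainComplex (ModuleCat.{u} k) ℕ} {n : ℕ}

lemma exists_iCycles_eq {x : C.X n} (hx : (C.sc n).g x = 0) : ∃ z : C.cycles n, C.iCycles n z = x :=
  ⟨(C.sc n).moduleCatCyclesIso.inv ⟨x, hx⟩, (C.sc n).moduleCatCyclesIso_inv_iCycles_apply ⟨x, hx⟩⟩

lemma sc_g_iCycles (z : C.cycles n) : (C.sc n).g (C.iCycles n z) = 0 := by
  have := (C.sc n).iCycles_g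
  exact congr($this z)

lemma sc_g_succ_eq_zero_iff {x : C.X (n + 1)} : (C.sc (n + 1)).g x = 0 ↔ C.d (n + 1) n x = 0 := by
  change C.d (n + 1) ((ComplexShape.down ℕ).next (n + 1)) x = 0 ↔ _
  rw [ChainComplex.next_nat_succ]

/-- Here `next 0` is a default value that is not related to `0`, so the differential vanishes. -/
lemma sc_g_zero (x : C.X 0) : (C.sc 0).g x = 0 := by
  change C.d 0 ((ComplexShape.down ℕ).next 0) x = 0
  rw [C.shape _ _ (by simp)]
  rfl

lemma homologyπ_eq_zero_iff {z : C.cycles n} :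
    C.homologyπ n z = 0 ↔ ∃ b : C.X (n + 1), C.d (n + 1) n b = C.iCycles n z := by
  have h1 : C.homologyι n (C.homologyπ n z) = C.pOpcycles n (C.iCycles n z) := by
    have := C.homology_π_ι n
    exact congr($this z)
  have h2 : Function.Injective (C.homologyι n) := (ModuleCat.mono_iff_injective _).1 inferInstance
  rw [← map_eq_zero_iff (C.homologyι n).hom h2]
  change C.homologyι n (C.homologyπ n z) = 0 ↔ _
  rw [h1]
  refine ((C.sc n).moduleCat_pOpcycles_eq_zero_iff _).trans ?_
  change (∃ b : C.X ((ComplexShape.down ℕ).prev n),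
    C.d ((ComplexShape.down ℕ).prev n) n b = C.iCycles n z) ↔ _
  rw [ChainComplex.prev]

lemma homologyπ_eq_homologyπ_iff {z w : C.cycles n} : C.homologyπ n z = C.homologyπ n w ↔
    ∃ b : C.X (n + 1), C.d (n + 1) n b = C.iCycles n z - C.iCycles n w := by
  rw [← sub_eq_zero, ← map_sub, homologyπ_eq_zero_iff, map_sub]

lemma homologyπ_surjective : Function.Surjective (C.homologyπ n) :=
  (ModuleCat.epi_iff_surjective _).1 inferInstance

lemma homologyMap_homologyπ (φ : C ⟶ D) (z : C.cycles n) :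
    homologyMap φ n (C.homologyπ n z) = D.homologyπ n (cyclesMap φ n z) := by
  have := homologyπ_naturality φ n
  exact congr($this z)

lemma iCycles_cyclesMap (φ : C ⟶ D) (z : C.cycles n) :
    D.iCycles n (cyclesMap φ n z) = φ.f n (C.iCycles n z) := by
  have := cyclesMap_i φ n
  exact congr($this z)

lemma hom_f_d (φ : C ⟶ D) (i j : ℕ) (x : C.X i) : D.d i j (φ.f i x) = φ.f j (C.d i j x) := by
  have := φ.comm i j
  exact congr($this x)

lemma cokernel_π_f_surjective (φ : C ⟶ D) (n : ℕ) :
    Function.Surjective ((Limits.cokernel.π φ).f n) :=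
  (ModuleCat.epi_iff_surjective _).1 inferInstance

lemma cokernel_π_f_eq_zero_iff (φ : C ⟶ D) {n : ℕ} {x : D.X n} :
    (Limits.cokernel.π φ).f n x = 0 ↔ ∃ a : C.X n, φ.f n a = x := by
  have h1 := (ShortComplex.exact_cokernel φ).map (HomologicalComplex.eval (ModuleCat k) _ n)
  refine ⟨fun h => (ShortComplex.moduleCat_exact_iff _).1 h1 x h, ?_⟩
  rintro ⟨a, rfl⟩
  have := congr(($(Limits.cokernel.condition φ)).f n)
  exact congr($this a)

end HomologicalComplex

/-! ### Singular chains as finitely supported functions -/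

section Sing

variable {k : Type u} [Field k]

/-- The singular chains of `X` as formal combinations of continuous maps. -/
def singToFinsupp (k : Type u) [Field k] (X : TopCat.{u}) (n : ℕ) :
    ((singularChains k).obj X).X n ⟶
      ModuleCat.of k (C(stdSimplex ℝ (Fin (n + 1)), X) →₀ k) :=
  Limits.Cofan.IsColimit.desc
    ((TopCat.toSSet.obj X).isColimitChainComplexXCofan (ModuleCat.of k k) n)
    fun σ => ModuleCat.ofHom (Finsupp.lsingle (TopCat.toSSetObjEquiv X _ σ))

/-- The generator of the singular chains that belongs to a simplex. -/
def singι (k : Type u) [Field k] (X : TopCat.{u}) {n : ℕ}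
    (σ : C(stdSimplex ℝ (Fin (n + 1)), X)) : ModuleCat.of k k ⟶ ((singularChains k).obj X).X n :=
  (TopCat.toSSet.obj X).ιChainComplex (R := ModuleCat.of k k) (n := n)
    ((TopCat.toSSetObjEquiv X (.op (SimplexCategory.mk n))).symm σ)

lemma ModuleCat.sum_neg_one_pow_smul_apply {M N : ModuleCat.{u} k} {n : ℕ} (f : Fin n → (M ⟶ N))
    (a : M) : (∑ i : Fin n, (-1 : ℤ) ^ (i : ℕ) • f i) a = ∑ i : Fin n, (-1 : k) ^ (i : ℕ) • f i a := by
  change (∑ i : Fin n, (-1 : ℤ) ^ (i : ℕ) • f i).hom a = _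
  rw [ModuleCat.hom_sum, LinearMap.sum_apply]
  refine Finset.sum_congr rfl fun i _ => ?_
  rcases Nat.even_or_odd (i : ℕ) with h | h
  · rw [h.neg_one_pow, h.neg_one_pow, one_smul, one_smul]
  · rw [h.neg_one_pow, h.neg_one_pow, neg_one_smul, neg_one_smul]
    rfl

lemma singι_d {X : TopCat.{u}} {n : ℕ} (σ : C(stdSimplex ℝ (Fin (n + 2)), X)) (a : k) :
    ((singularChains k).obj X).d (n + 1) n (singι k X σ a) =
      ∑ i : Fin (n + 2), (-1 : k) ^ (i : ℕ) •
        singι k X (σ.comp ⟨_, stdSimplex.continuous_map i.succAbove⟩) a := by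
  have h := (TopCat.toSSet.obj X).ιChainComplex_d (R := ModuleCat.of k k)
    ((TopCat.toSSetObjEquiv X (.op (SimplexCategory.mk (n + 1)))).symm σ)
  have h' := congr($h a)
  erw [ModuleCat.sum_neg_one_pow_smul_apply] at h'
  refine h'.trans ?_
  refine Finset.sum_congr rfl fun i _ => ?_
  congr 1

lemma singι_map {X Y : TopCat.{u}} (f : X ⟶ Y) {n : ℕ} (σ : C(stdSimplex ℝ (Fin (n + 1)), X))
    (a : k) : ((singularChains k).map f).f n (singι k X σ a) = singι k Y (f.hom.comp σ) a := by
  have h := SSet.ι_chainComplexMap_f (TopCat.toSSet.obj X) (TopCat.toSSet.obj Y) (TopCat.toSSet.map f) (ModuleCat.of k k)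
    ((TopCat.toSSetObjEquiv X (.op (SimplexCategory.mk n))).symm σ)
  exact congr($h a)

lemma singToFinsupp_singι {X : TopCat.{u}} {n : ℕ} (σ : C(stdSimplex ℝ (Fin (n + 1)), X)) (a : k) :
    singToFinsupp k X n (singι k X σ a) = Finsupp.single σ a := by
  have h := Limits.Cofan.IsColimit.fac
    ((TopCat.toSSet.obj X).isColimitChainComplexXCofan (ModuleCat.of k k) n)
    (fun σ => ModuleCat.ofHom (Finsupp.lsingle (R := k) (TopCat.toSSetObjEquiv X _ σ)))
    ((TopCat.toSSetObjEquiv X (.op (SimplexCategory.mk n))).symm σ)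
  refine (congr($h a)).trans ?_
  change Finsupp.single _ _ = _
  rw [Equiv.apply_symm_apply]

lemma sing_hom_ext {X : TopCat.{u}} {n : ℕ} {M : Type u} [AddCommGroup M] [Module k M]
    {f g : ((singularChains k).obj X).X n →ₗ[k] M}
    (h : ∀ σ, f (singι k X σ 1) = g (singι k X σ 1)) : f = g := by
  have := SSet.chainComplex_hom_ext (X := TopCat.toSSet.obj X) (R := ModuleCat.of k k) (n := n)
    (f := ModuleCat.ofHom f) (g := ModuleCat.ofHom g) fun x => by
      ext
      have := h (TopCat.toSSetObjEquiv X _ x)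
      rw [singι, Equiv.symm_apply_apply] at this
      exact this
  exact congr(($this).hom)

section ToMapChain

variable {E : Type u} {X Y : TopCat.{u}} {n : ℕ}

/-- The images of singular simplices under `j`. -/
def toMapChain (k : Type u) [Field k] (j : X → E) (n : ℕ) :
    ((singularChains k).obj X).X n →ₗ[k] MapChain k E (n + 1) :=
  Finsupp.lmapDomain k k (fun σ : C(stdSimplex ℝ (Fin (n + 1)), X) => fun t => j (σ t)) ∘ₗ
    (singToFinsupp k X n).hom

lemma toMapChain_singι (j : X → E) (σ : C(stdSimplex ℝ (Fin (n + 1)), X)) (a : k) :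
    toMapChain k j n (singι k X σ a) = Finsupp.single (fun t => j (σ t)) a := by
  change Finsupp.lmapDomain k k _ (singToFinsupp k X n (singι k X σ a)) = _
  rw [singToFinsupp_singι]
  exact Finsupp.mapDomain_single

lemma bd_toMapChain (j : X → E) (c : ((singularChains k).obj X).X (n + 1)) :
    MapChain.bd (toMapChain k j (n + 1) c) =
      toMapChain k j n (((singularChains k).obj X).d (n + 1) n c) := by
  have : MapChain.bd ∘ₗ toMapChain k j (n + 1) =
      toMapChain k j n ∘ₗ (((singularChains k).obj X).d (n + 1) n).hom := by
    refine sing_hom_ext fun σ => ?_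
    change MapChain.bd (toMapChain k j (n + 1) (singι k X σ 1)) =
      toMapChain k j n (((singularChains k).obj X).d (n + 1) n (singι k X σ 1))
    rw [singι_d, toMapChain_singι, MapChain.bd_single, map_sum, one_smul]
    refine Finset.sum_congr rfl fun i _ => ?_
    rw [map_smul, toMapChain_singι]
    rfl
  exact congr($this c)

lemma toMapChain_map (f : X ⟶ Y) (j : Y → E) (c : ((singularChains k).obj X).X n) :
    toMapChain k j n (((singularChains k).map f).f n c) = toMapChain k (fun x => j (f x)) n c := by
  have : toMapChain k j n ∘ₗ (((singularChains k).map f).f n).hom =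
      toMapChain k (fun x => j (f x)) n := by
    refine sing_hom_ext fun σ => ?_
    change toMapChain k j n (((singularChains k).map f).f n (singι k X σ 1)) = _
    rw [singι_map, toMapChain_singι, toMapChain_singι]
    rfl
  exact congr($this c)

lemma post_toMapChain {E' : Type u} (φ : E → E') (j : X → E)
    (c : ((singularChains k).obj X).X n) :
    MapChain.post φ (toMapChain k j n c) = toMapChain k (fun x => φ (j x)) n c := by
  have : MapChain.post φ ∘ₗ toMapChain k j n = toMapChain k (fun x => φ (j x)) n := by
    refine sing_hom_ext fun σ => ?_
    rw [LinearMap.comp_apply, toMapChain_singι, toMapChain_singι, MapChain.post_single]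
    rfl
  exact congr($this c)

lemma singToFinsupp_injective : Function.Injective (singToFinsupp k X n) := by
  have : Finsupp.linearCombination k (fun σ => singι k X σ 1) ∘ₗ (singToFinsupp k X n).hom =
      LinearMap.id := by
    refine sing_hom_ext fun σ => ?_
    change Finsupp.linearCombination k (fun σ => singι k X σ 1)
      (singToFinsupp k X n (singι k X σ 1)) = _
    rw [singToFinsupp_singι]
    exact (Finsupp.linearCombination_single ..).trans (one_smul ..)
  exact Function.LeftInverse.injective
    (g := Finsupp.linearCombination k fun σ => singι k X σ 1) fun c => congr($this c)

lemma toMapChain_injective {j : X → E} (hj : Function.Injective j) :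
    Function.Injective (toMapChain k j n) :=
  (Finsupp.mapDomain_injective fun _ _ h => ContinuousMap.ext fun t => hj (congrFun h t)).comp
    singToFinsupp_injective

lemma bd_toMapChain_eq_zero_of_sc_g [Zero E] {j : X → E} {x : ((singularChains k).obj X).X (n + 1)}
    (hx : (((singularChains k).obj X).sc (n + 1)).g x = 0) :
    MapChain.bd (toMapChain k j (n + 1) x) = 0 := by
  rw [bd_toMapChain, HomologicalComplex.sc_g_succ_eq_zero_iff.1 hx, map_zero]

lemma sc_g_eq_zero_of_bd {j : X → E} (hj : Function.Injective j)
    {x : ((singularChains k).obj X).X n} (hx : MapChain.bd (toMapChain k j n x) = 0) :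
    (((singularChains k).obj X).sc n).g x = 0 := by
  cases n with
  | zero => exact HomologicalComplex.sc_g_zero x
  | succ n =>
    rw [bd_toMapChain] at hx
    exact HomologicalComplex.sc_g_succ_eq_zero_iff.2
      (toMapChain_injective hj (hx.trans (map_zero _).symm))

lemma MapChain.post_zero_injective {E' : Type*} (φ : E → E') :
    Function.Injective (MapChain.post (k := k) (n := 0) φ) := by
  have : IsEmpty (stdSimplex ℝ (Fin 0)) := by
    rw [stdSimplex_of_isEmpty_index]; infer_instance
  exact Finsupp.mapDomain_injective fun σ τ _ => Subsingleton.elim _ _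

variable [TopologicalSpace E]

/-- A continuous simplex in the range of an embedding lifts continuously. Degrees shift by one, from
dimension to number of vertices. -/
lemma range_toMapChain {j : X → E} (hj : Topology.IsEmbedding j) :
    LinearMap.range (toMapChain k j n) = MapChain.chainsIn k (Set.range j) (n + 1) := by
  refine le_antisymm ?_ fun c hc => ?_
  · rintro _ ⟨c, rfl⟩
    change Finsupp.lmapDomain k k (fun σ : C(stdSimplex ℝ (Fin (n + 1)), X) => fun t => j (σ t))
      (singToFinsupp k X n c) ∈ _
    generalize singToFinsupp k X n c = c'
    induction c' using Finsupp.induction_linear with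
    | zero => rw [map_zero]; exact zero_mem _
    | add f g hf hg => rw [map_add]; exact add_mem hf hg
    | single σ a =>
      rw [Finsupp.lmapDomain_apply, Finsupp.mapDomain_single]
      exact MapChain.single_mem_chainsIn (k := k) (hj.continuous.comp σ.continuous)
        (fun t => Set.mem_range_self (σ t)) a
  · refine Finsupp.map_mem_of_mem_supported (LinearMap.id (R := k)) (fun σ hσ => ?_) hc
    choose x hx using hσ.2
    have hx' : Continuous x := by
      rw [hj.continuous_iff]
      exact hσ.1.congr fun t => (hx t).symm
    refine ⟨singι k X ⟨x, hx'⟩ 1, ?_⟩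
    rw [toMapChain_singι]
    exact congrArg (Finsupp.single · 1) (funext hx)

lemma toMapChain_mem {j : X → E} (hj : Topology.IsEmbedding j)
    (c : ((singularChains k).obj X).X n) :
    toMapChain k j n c ∈ MapChain.chainsIn k (Set.range j) (n + 1) :=
  range_toMapChain (k := k) (n := n) hj ▸ LinearMap.mem_range_self _ c

lemma exists_toMapChain_eq {j : X → E} (hj : Topology.IsEmbedding j) {c : MapChain k E (n + 1)}
    (hc : c ∈ MapChain.chainsIn k (Set.range j) (n + 1)) :
    ∃ x : ((singularChains k).obj X).X n, toMapChain k j n x = c := by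
  rwa [← range_toMapChain hj] at hc

/-- In degree `0` the condition says that the augmentation vanishes; in higher degrees both sides
hold automatically. The one-point space is placed at `0`, where the augmented chains are exact. -/
lemma homologyπ_mem_reducedHomology_iff [Zero E] (j : X → E)
    (z : ((singularChains k).obj X).cycles n) :
    ((singularChains k).obj X).homologyπ n z ∈ reducedHomology k n X ↔
      MapChain.bd (toMapChain k j n (((singularChains k).obj X).iCycles n z)) = 0 := by
  have hz := ((singularChains k).obj X).sc_g_iCycles z
  set x := ((singularChains k).obj X).iCycles n z with hx
  let j₀ : TopCat.of PUnit.{u + 1} → E := fun _ => 0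
  have hj₀ : Topology.IsEmbedding j₀ := Topology.IsEmbedding.of_subsingleton _
  have hr : Set.range j₀ = {0} := Set.range_const
  let f : X ⟶ TopCat.of PUnit.{u + 1} := TopCat.ofHom (ContinuousMap.const X PUnit.unit)
  have h1 : toMapChain k j₀ n (((singularChains k).map f).f n x) =
      MapChain.post (fun _ => 0) (toMapChain k j n x) := by
    rw [toMapChain_map, post_toMapChain]
  have h2 : MapChain.bd (toMapChain k j n x) = 0 ↔
      MapChain.bd (MapChain.post (fun _ => (0 : E)) (toMapChain k j n x)) = 0 := by
    rw [MapChain.bd_post]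
    cases n with
    | zero => exact (map_eq_zero_iff _ (MapChain.post_zero_injective _)).symm
    | succ n => simp [bd_toMapChain_eq_zero_of_sc_g hz]
  rw [h2, ← h1]
  change HomologicalComplex.homologyMap ((singularChains k).map f) n
    (((singularChains k).obj X).homologyπ n z) = 0 ↔ _
  rw [HomologicalComplex.homologyMap_homologyπ, HomologicalComplex.homologyπ_eq_zero_iff,
    HomologicalComplex.iCycles_cyclesMap, ← hx]
  constructor
  · rintro ⟨b, hb⟩
    rw [← hb, ← bd_toMapChain, MapChain.bd_bd]
  · intro h
    obtain ⟨b, hb, hbd⟩ := (MapChain.isExact_chainsIn_singleton (0 : E)).2 n _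
      (hr ▸ toMapChain_mem hj₀ _) h
    rw [← hr] at hb
    obtain ⟨b, rfl⟩ := exists_toMapChain_eq hj₀ hb
    rw [bd_toMapChain] at hbd
    exact ⟨b, toMapChain_injective hj₀.injective hbd⟩

lemma reducedHomology_eq_bot_iff [Zero E] {j : X → E} (hj : Topology.IsEmbedding j) :
    reducedHomology k n X = ⊥ ↔ MapChain.CyclesBound (MapChain.chainsIn k (Set.range j)) n := by
  constructor
  · intro h c hc hbd
    obtain ⟨x, rfl⟩ := exists_toMapChain_eq hj hc
    obtain ⟨z, rfl⟩ := HomologicalComplex.exists_iCycles_eq (sc_g_eq_zero_of_bd hj.injective hbd)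
    rw [← homologyπ_mem_reducedHomology_iff, h, Submodule.mem_bot,
      HomologicalComplex.homologyπ_eq_zero_iff] at hbd
    obtain ⟨b, hb⟩ := hbd
    exact ⟨_, toMapChain_mem hj b, by rw [bd_toMapChain, hb]⟩
  · intro h
    rw [eq_bot_iff]
    intro y hy
    obtain ⟨z, rfl⟩ := HomologicalComplex.homologyπ_surjective y
    obtain ⟨b, hb, hbd⟩ := h _ (toMapChain_mem hj _)
      ((homologyπ_mem_reducedHomology_iff j z).1 hy)
    obtain ⟨b, rfl⟩ := exists_toMapChain_eq hj hb
    rw [bd_toMapChain] at hbd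
    rw [Submodule.mem_bot, HomologicalComplex.homologyπ_eq_zero_iff]
    exact ⟨b, toMapChain_injective hj.injective hbd⟩

lemma surjective_toRelativeHomology_iff [Zero E] {j : X → E} (hj : Topology.IsEmbedding j)
    (A : Set X) : Function.Surjective ((toRelativeHomology k n A).domRestrict
      (reducedHomology k n X)) ↔
    MapChain.RelSurjective (MapChain.chainsIn k (Set.range j)) (MapChain.chainsIn k (j '' A)) n := by
  let C := (singularChains k).obj (TopCat.of A)
  let D := (singularChains k).obj X
  let ι : C ⟶ D := (singularChains k).map (subspaceInclusion A)
  let Q := relativeChains k A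
  let π : D ⟶ Q := Limits.cokernel.π ι
  have hπs (m : ℕ) : Function.Surjective (π.f m) :=
    HomologicalComplex.cokernel_π_f_surjective ι m
  have hπ0 {m : ℕ} {x : D.X m} : π.f m x = 0 ↔ ∃ a : C.X m, ι.f m a = x :=
    HomologicalComplex.cokernel_π_f_eq_zero_iff ι
  let jA : TopCat.of A → E := fun x => j x.1
  have hjA : Topology.IsEmbedding jA := hj.comp Topology.IsEmbedding.subtypeVal
  have hr : Set.range jA = j '' A := by
    rw [Set.image_eq_range]
  have hι (m : ℕ) (a : C.X m) : toMapChain k j m (ι.f m a) = toMapChain k jA m a :=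
    toMapChain_map _ _ _
  have hπ (z : D.cycles n) : toRelativeHomology k n A (D.homologyπ n z) =
      Q.homologyπ n (HomologicalComplex.cyclesMap π n z) :=
    HomologicalComplex.homologyMap_homologyπ π z
  have hcyc (y : D.X n) : (Q.sc n).g (π.f n y) = 0 ↔
      MapChain.bd (toMapChain k j n y) ∈ MapChain.chainsIn k (j '' A) n := by
    cases n with
    | zero =>
      rw [MapChain.chainsIn_zero]
      exact iff_of_true (HomologicalComplex.sc_g_zero _) Submodule.mem_top
    | succ n =>
      rw [HomologicalComplex.sc_g_succ_eq_zero_iff, HomologicalComplex.hom_f_d,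
        hπ0, bd_toMapChain, ← hr]
      constructor
      · rintro ⟨a, ha⟩
        rw [← ha, hι]
        exact toMapChain_mem hjA a
      · intro h
        obtain ⟨a, ha⟩ := exists_toMapChain_eq hjA h
        exact ⟨a, toMapChain_injective hj.injective ((hι _ _).trans ha)⟩
  constructor
  · intro h c hc hbd
    obtain ⟨y, rfl⟩ := exists_toMapChain_eq hj hc
    obtain ⟨w, hw⟩ := HomologicalComplex.exists_iCycles_eq ((hcyc y).2 hbd)
    obtain ⟨⟨t, ht⟩, htw⟩ := h (Q.homologyπ n w)
    obtain ⟨z, rfl⟩ := HomologicalComplex.homologyπ_surjective t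
    obtain ⟨b, hb⟩ := HomologicalComplex.homologyπ_eq_homologyπ_iff.1 ((hπ z).symm.trans htw)
    obtain ⟨x, rfl⟩ := hπs (n + 1) b
    have h0 : π.f n (D.iCycles n z - y - D.d (n + 1) n x) = 0 := by
      rw [map_sub, map_sub, sub_eq_zero, ← HomologicalComplex.hom_f_d]
      rw [HomologicalComplex.iCycles_cyclesMap, hw] at hb
      exact hb.symm
    obtain ⟨a, ha⟩ := hπ0.1 h0
    refine ⟨_, toMapChain_mem hj (D.iCycles n z), (homologyπ_mem_reducedHomology_iff j z).1 ht,
      _, hr ▸ toMapChain_mem hjA (-a), _, toMapChain_mem hj (-x), ?_⟩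
    rw [← hι, map_neg, ha, bd_toMapChain, ← map_add, ← map_add, map_neg]
    congr 1
    abel
  · intro h q
    obtain ⟨w, rfl⟩ := HomologicalComplex.homologyπ_surjective q
    obtain ⟨y, hy⟩ := hπs n (Q.iCycles n w)
    have hy' : (Q.sc n).g (Q.iCycles n w) = 0 := HomologicalComplex.sc_g_iCycles w
    rw [← hy] at hy'
    obtain ⟨z, hz, hbd, a, ha, x, hx, hyz⟩ := h _ (toMapChain_mem hj y) ((hcyc y).1 hy')
    obtain ⟨z, rfl⟩ := exists_toMapChain_eq hj hz
    obtain ⟨x, rfl⟩ := exists_toMapChain_eq hj hx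
    rw [← hr] at ha
    obtain ⟨a, rfl⟩ := exists_toMapChain_eq hjA ha
    rw [← hι, bd_toMapChain, ← map_add, ← map_add] at hyz
    have hyz := toMapChain_injective hj.injective hyz
    obtain ⟨z, rfl⟩ := HomologicalComplex.exists_iCycles_eq (sc_g_eq_zero_of_bd hj.injective hbd)
    refine ⟨⟨D.homologyπ n z, (homologyπ_mem_reducedHomology_iff j z).2 hbd⟩, (hπ z).trans
      (HomologicalComplex.homologyπ_eq_homologyπ_iff.2 ⟨π.f (n + 1) (-x), ?_⟩)⟩
    have h0 : π.f n (ι.f n a) = 0 := hπ0.2 ⟨a, rfl⟩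
    rw [HomologicalComplex.iCycles_cyclesMap, HomologicalComplex.hom_f_d, ← hy, hyz]
    rw [map_add, map_add, h0, map_neg, map_neg]
    abel

end ToMapChain

end Sing

/-! ### Homological conditions in terms of simplicial chains -/

namespace FaceChain

variable {V : Type*} [LinearOrder V] {K : Set (Finset V)} {N : ℕ}

/-- `K` is closed under subsets, and all its facets have `N` elements. -/
structure IsPureOf (K : Set (Finset V)) (N : ℕ) : Prop extends IsDownClosed K where
  card_le : ∀ s ∈ K, s.card ≤ N
  exists_facet : ∀ s ∈ K, ∃ t ∈ K, s ⊆ t ∧ t.card = N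

lemma IsPureOf.linkOf (h : IsPureOf K N) {ρ : Finset V} (hρ : ρ ∈ K) :
    IsPureOf (linkOf K ρ) (N - ρ.card) where
  empty_mem := ⟨Finset.disjoint_empty_left _, by simpa using hρ⟩
  down s hs t hts :=
    ⟨hs.1.mono_left hts, h.down _ hs.2 _ (Finset.union_subset_union_left hts)⟩
  card_le s hs := by
    have := h.card_le _ hs.2
    rw [Finset.card_union_of_disjoint hs.1] at this
    omega
  exists_facet s hs := by
    obtain ⟨t, ht, hst, htN⟩ := h.exists_facet _ hs.2
    have hρt : ρ ⊆ t := Finset.subset_union_right.trans hst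
    refine ⟨t \ ρ, ⟨Finset.sdiff_disjoint, by rwa [Finset.sdiff_union_of_subset hρt]⟩,
      fun v hv => Finset.mem_sdiff.2 ⟨hst (Finset.mem_union_left _ hv),
        Finset.disjoint_left.1 hs.1 hv⟩, ?_⟩
    rw [Finset.card_sdiff_of_subset hρt, htN]

lemma linkOf_linkOf {ρ τ : Finset V} (h : Disjoint τ ρ) :
    linkOf (linkOf K ρ) τ = linkOf K (τ ∪ ρ) := by
  ext s
  simp only [linkOf, Set.mem_ofPred_eq, Finset.disjoint_union_left, Finset.disjoint_union_right,
    Finset.union_assoc]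
  tauto

/-- All facets of the rank-selected subcomplexes of a balanced complex have all colours. -/
lemma IsPureOf.selectOf {κ : V → ℕ} {S T : Finset ℕ} (h : IsPureOf K T.card)
    (hκ : ∀ s ∈ K, Set.InjOn κ s) (hT : ∀ s ∈ K, ∀ v ∈ s, κ v ∈ T) (hST : S ⊆ T) :
    IsPureOf (selectOf K κ S) S.card where
  empty_mem := ⟨h.empty_mem, by simp⟩
  down s hs t hts := ⟨h.down s hs.1 t hts, fun v hv => hs.2 v (hts hv)⟩
  card_le s hs := by
    rw [← Finset.card_image_of_injOn (hκ s hs.1)]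
    exact Finset.card_le_card (Finset.image_subset_iff.2 hs.2)
  exists_facet s hs := by
    obtain ⟨t, ht, hst, htN⟩ := h.exists_facet s hs.1
    -- A facet has `T.card` vertices of distinct colours, so every colour occurs in it.
    have himg : t.image κ = T := by
      refine Finset.eq_of_subset_of_card_le (Finset.image_subset_iff.2 (hT t ht)) ?_
      rw [Finset.card_image_of_injOn (hκ t ht), htN]
    refine ⟨t.filter (κ · ∈ S), ⟨h.down t ht _ (Finset.filter_subset _ _), by simp⟩,
      fun v hv => Finset.mem_filter.2 ⟨hst hv, hs.2 v hv⟩, ?_⟩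
    rw [← Finset.card_image_of_injOn ((hκ t ht).mono (Finset.coe_subset.2
      (Finset.filter_subset _ _)))]
    congr 1
    ext i
    simp only [Finset.mem_image, Finset.mem_filter]
    constructor
    · rintro ⟨v, hv, rfl⟩
      exact hv.2
    · intro hi
      obtain ⟨v, hv, rfl⟩ := Finset.mem_image.1 (himg ▸ hST hi)
      exact ⟨v, ⟨hv, hi⟩, rfl⟩

end FaceChain

/-! ### Dictionary between complexes and sets of faces -/

namespace PreAbstractSimplicialComplex

open FaceChain

section

variable {V : Type u} (Δ : PreAbstractSimplicialComplex V)

/-- The faces of `Δ`, including the empty face. -/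
def allFaces : Set (Finset V) := {s | s = ∅ ∨ s ∈ Δ}

variable {Δ}

lemma nonempty_of_mem {s : Finset V} (hs : s ∈ Δ) : s.Nonempty := (Δ.isRelLowerSet_faces hs).1

lemma mem_of_subset {s t : Finset V} (hs : s ∈ Δ) (h : t ⊆ s) (ht : t.Nonempty) : t ∈ Δ :=
  (Δ.isRelLowerSet_faces hs).2 h ht

lemma mem_allFaces {s : Finset V} (hs : s ∈ Δ) : s ∈ Δ.allFaces := Or.inr hs

lemma mem_of_mem_allFaces {s : Finset V} (hs : s ∈ Δ.allFaces) (h : s.Nonempty) : s ∈ Δ :=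
  hs.resolve_left h.ne_empty

lemma isDownClosed_allFaces : IsDownClosed Δ.allFaces where
  empty_mem := Or.inl rfl
  down s hs t hts := by
    rcases t.eq_empty_or_nonempty with rfl | ht
    · exact Or.inl rfl
    · exact Or.inr (mem_of_subset (mem_of_mem_allFaces hs (ht.mono hts)) hts ht)

variable [Fintype V]

variable (Δ) in
/-- The barycentric coordinates of a point of the realization. -/
def coords (p : Δ.realization) : V → ℝ := p.1

lemma isEmbedding_coords : Topology.IsEmbedding Δ.coords := Topology.IsEmbedding.subtypeVal

lemma range_coords : Set.range Δ.coords = real Δ.allFaces := by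
  refine Subtype.range_coe.trans (Set.ext fun x => and_congr_right fun hx => ?_)
  refine ⟨fun ⟨s, hs, h⟩ => ⟨s, mem_allFaces hs, h⟩, ?_⟩
  rintro ⟨s, rfl | hs, h⟩
  -- The empty face adds no point, because coordinates sum to `1`.
  · have : x = 0 := funext fun v => by_contra fun hv => by simpa using h v hv
    simpa [this] using hx.2
  · exact ⟨s, hs, h⟩

lemma image_compl_singleton (p : Δ.realization) :
    Δ.coords '' {p}ᶜ = real Δ.allFaces \ {Δ.coords p} := by
  rw [Set.image_compl_eq_range_sdiff_image isEmbedding_coords.injective, range_coords,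
    Set.image_singleton]

end

section

variable {V : Type u} [LinearOrder V] {Δ : PreAbstractSimplicialComplex V} {N : ℕ}

lemma allFaces_link {τ : Finset V} (hτ : τ ∈ Δ.allFaces) :
    (Δ.link τ).allFaces = linkOf Δ.allFaces τ := by
  ext s
  have h : s ∈ Δ.link τ ↔ s.Nonempty ∧ Disjoint s τ ∧ s ∪ τ ∈ Δ := by
    change s.Nonempty ∧ Disjoint s τ ∧ _ ∈ Δ ↔ _
    convert Iff.rfl
  constructor
  · rintro (rfl | hs)
    · exact ⟨Finset.disjoint_empty_left _, by simpa using hτ⟩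
    · exact ⟨(h.1 hs).2.1, mem_allFaces (h.1 hs).2.2⟩
  · rintro ⟨h1, h2⟩
    rcases s.eq_empty_or_nonempty with rfl | hs
    · exact Or.inl rfl
    · exact Or.inr (h.2 ⟨hs, h1, mem_of_mem_allFaces h2 (hs.mono Finset.subset_union_left)⟩)

lemma dimSucc_eq (h : IsPureOf Δ.allFaces N) : Δ.dimSucc = N := by
  obtain ⟨t, ht, -, htN⟩ := h.exists_facet ∅ h.empty_mem
  rcases ht with rfl | ht
  -- Here `N = 0`, which agrees with the value `0` of `sSup ∅`.
  · have : Δ.faces = ∅ := Set.eq_empty_of_forall_notMem fun s hs => by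
      have h1 := h.card_le s (Or.inr hs)
      rw [← htN] at h1
      exact (Finset.card_pos.2 (nonempty_of_mem (Δ := Δ) hs)).not_ge h1
    rw [dimSucc, this, ← htN]
    simp
  · exact IsGreatest.csSup_eq ⟨⟨t, ht, htN⟩, by
      rintro _ ⟨s, hs, rfl⟩
      exact h.card_le s (Or.inr hs)⟩

lemma isPure_of_isPureOf (h : IsPureOf Δ.allFaces N) : Δ.IsPure := by
  have (s : Finset V) (hs : Maximal (· ∈ Δ) s) : s.card = N := by
    obtain ⟨t, ht, hst, htN⟩ := h.exists_facet s (Or.inr hs.prop)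
    rw [← htN, hs.eq_of_le (mem_of_mem_allFaces ht ((nonempty_of_mem hs.prop).mono hst)) hst]
  intro s t hs ht
  rw [this s hs, this t ht]

variable [Fintype V]

lemma isPureOf_of_isPure (h : Δ.IsPure) : IsPureOf Δ.allFaces Δ.dimSucc where
  toIsDownClosed := isDownClosed_allFaces
  card_le := by
    rintro s (rfl | hs)
    · simp
    · exact le_csSup (Set.toFinite _).bddAbove (Set.mem_image_of_mem _ hs)
  exists_facet := by
    rcases Set.eq_empty_or_nonempty Δ.faces with h0 | h0
    · rintro s (rfl | hs)
      · exact ⟨∅, Or.inl rfl, subset_rfl, by simp [dimSucc, h0]⟩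
      · exact absurd (show s ∈ Δ.faces from hs) (by simp [h0])
    · obtain ⟨m, hm, hmN⟩ := Nat.sSup_mem (h0.image Finset.card) (Set.toFinite _).bddAbove
      have hle (t : Finset V) (ht : t ∈ Δ) : t.card ≤ m.card := by
        rw [hmN]
        exact le_csSup (Set.toFinite _).bddAbove (Set.mem_image_of_mem _ ht)
      have hmax : Maximal (· ∈ Δ) m :=
        ⟨hm, fun t ht hmt => (Finset.eq_of_subset_of_card_le hmt (hle t ht)).ge⟩
      rintro s (rfl | hs)
      · exact ⟨m, Or.inr hm, Finset.empty_subset _, hmN⟩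
      · obtain ⟨t, hst, ht⟩ := (Set.toFinite Δ.faces).exists_le_maximal hs
        exact ⟨t, Or.inr ht.prop, hst, (h t m ht hmax).trans hmN⟩

variable {k : Type u} [Field k]

lemma reducedHomology_realization_eq_bot_iff {n : ℕ} :
    reducedHomology k n Δ.realization = ⊥ ↔ ∀ c ∈ suppIn k Δ.allFaces ⊓ hom k V (n + 1), bd c = 0 →
      ∃ b ∈ suppIn k Δ.allFaces ⊓ hom k V (n + 2), bd b = c := by
  rw [reducedHomology_eq_bot_iff isEmbedding_coords, range_coords]
  exact cyclesBound_chainsIn_iff isDownClosed_allFaces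

lemma surjective_toRelativeHomology_realization_iff {n : ℕ} (hn : ∀ s ∈ Δ.allFaces, s.card ≤ n + 1)
    (p : Δ.realization) :
    Function.Surjective ((toRelativeHomology k n ({p}ᶜ : Set Δ.realization)).domRestrict
      (reducedHomology k n Δ.realization)) ↔
    ∀ c ∈ suppIn k Δ.allFaces ⊓ hom k V (n + 1), (∀ s, carrier (Δ.coords p) ⊆ s → bd c s = 0) →
      ∃ z ∈ suppIn k Δ.allFaces ⊓ hom k V (n + 1), bd z = 0 ∧
        ∀ s, carrier (Δ.coords p) ⊆ s → z s = c s := by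
  rw [surjective_toRelativeHomology_iff isEmbedding_coords, range_coords, image_compl_singleton]
  exact relSurjective_chainsIn_iff isDownClosed_allFaces hn
    (range_coords (Δ := Δ) ▸ Set.mem_range_self p)

/-- A nonempty face is `τ ∪ {v}`, and its link is the link of `τ` in the link of `v`. Homological
degree `i` corresponds to chain degree `i + 1`. -/
lemma linksAcyclic_iff (h : IsPureOf Δ.allFaces N) :
    LinksAcyclic k Δ.allFaces N ↔ ∀ v ∈ Δ.vertices, (Δ.link {v}).IsCohenMacaulay k := by
  have key (v : V) (hv : v ∈ Δ.vertices) (τ : Finset V) (hτ : τ ∈ (Δ.link {v}).allFaces) :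
      τ ∪ {v} ∈ Δ ∧ ((Δ.link {v}).link τ).allFaces = linkOf Δ.allFaces (τ ∪ {v}) := by
    have hτ' := hτ
    rw [allFaces_link (mem_allFaces hv)] at hτ'
    rw [allFaces_link hτ, allFaces_link (mem_allFaces hv), linkOf_linkOf hτ'.1]
    exact ⟨mem_of_mem_allFaces hτ'.2 (by simp), rfl⟩
  constructor
  · intro hL v hv τ hτ i hi
    obtain ⟨hmem, hlk⟩ := key v hv τ hτ
    rw [reducedHomology_realization_eq_bot_iff, hlk]
    rw [dimSucc_eq (N := N - (τ ∪ {v}).card) (by rw [hlk]; exact h.linkOf (mem_allFaces hmem))] at hi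
    exact hL _ (mem_allFaces hmem) (by simp) (i + 1) (by omega)
  · intro hCM ρ hρ hρ' j hj c hc hbd
    cases j with
    -- This is homological degree `-1`, on which `IsCohenMacaulay` is silent. By purity the link has
    -- a vertex `w`, and coning from it bounds `c`.
    | zero =>
      obtain ⟨t, ht, hρt, htN⟩ := h.exists_facet ρ hρ
      obtain ⟨w, hwt, hwρ⟩ := Finset.exists_mem_notMem_of_card_lt_card (s := ρ) (t := t) (by omega)
      refine ⟨mu w c, ⟨mu_mem_suppIn hc.2 fun s hws hs => ?_, mu_mem_hom hc.2⟩,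
        by rw [bd_mu, hbd, map_zero, sub_zero]⟩
      rw [Finset.card_eq_zero.1 (show s.card = 0 from hs)]
      refine ⟨by simpa using hwρ, h.down t ht _ ?_⟩
      simpa [Finset.insert_subset_iff] using ⟨hwt, hρt⟩
    | succ i =>
      obtain ⟨v, hv⟩ := hρ'
      have hvρ : ρ.erase v ∪ {v} = ρ := by
        rw [Finset.union_comm, ← Finset.insert_eq, Finset.insert_erase hv]
      have hvΔ : v ∈ Δ.vertices :=
        mem_of_subset (mem_of_mem_allFaces hρ ⟨v, hv⟩) (by simpa using hv) (by simp)
      have hτ : ρ.erase v ∈ (Δ.link {v}).allFaces := by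
        rw [allFaces_link (mem_allFaces hvΔ)]
        exact ⟨by simp, by rwa [hvρ]⟩
      obtain ⟨hmem, hlk⟩ := key v hvΔ _ hτ
      rw [hvρ] at hlk
      have := hCM v hvΔ _ hτ i (by
        rw [dimSucc_eq (N := N - ρ.card) (by rw [hlk]; exact h.linkOf hρ)]
        omega)
      rw [reducedHomology_realization_eq_bot_iff, hlk] at this
      exact this c hc hbd

lemma localCyclesLift_iff (h : IsPureOf Δ.allFaces N) :
    LocalCyclesLift k Δ.allFaces N ↔ ∀ n : ℕ, Δ.dimSucc = n + 1 → ∀ p : Δ.realization,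
      Function.Surjective ((toRelativeHomology k n ({p}ᶜ : Set Δ.realization)).domRestrict
        (reducedHomology k n Δ.realization)) := by
  rw [dimSucc_eq h]
  constructor
  · rintro hL n rfl p
    rw [surjective_toRelativeHomology_realization_iff h.card_le]
    have hp : Δ.coords p ∈ real Δ.allFaces := range_coords (Δ := Δ) ▸ Set.mem_range_self p
    exact hL _ ((mem_real_iff isDownClosed_allFaces).1 hp).2 (carrier_nonempty (p := Δ.coords p) hp.1)
  · intro hS ρ hρ hρ'
    obtain ⟨n, rfl⟩ : ∃ n, N = n + 1 :=
      Nat.exists_eq_succ_of_ne_zero ((Finset.card_pos.2 hρ').trans_le (h.card_le ρ hρ)).ne'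
    -- The barycentre of `ρ`, a point whose carrier is `ρ`.
    let x : V → ℝ := fun v => if v ∈ ρ then (ρ.card : ℝ)⁻¹ else 0
    have hx : x ∈ stdSimplex ℝ V := by
      refine ⟨fun v => ?_, ?_⟩
      · simp only [x]; split_ifs <;> positivity
      · have : (ρ.card : ℝ) ≠ 0 := Nat.cast_ne_zero.2 (Finset.card_pos.2 hρ').ne'
        simp [x, this]
    have hcar : carrier x = ρ := by
      ext v
      rw [mem_carrier]
      simp [x, hρ'.ne_empty]
    let p : Δ.realization := ⟨x, hx, ρ, mem_of_mem_allFaces hρ hρ', fun v hv => by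
      rwa [← mem_carrier, hcar] at hv⟩
    have := hS n rfl p
    rw [surjective_toRelativeHomology_realization_iff h.card_le] at this
    rwa [show carrier (Δ.coords p) = ρ from hcar] at this

end

/-- Rank selection for a subset of the colours, with the colours taken in `ℕ`. -/
lemma isBuchsbaum_of_rankSelected {V : Type u} [Fintype V] {k : Type u} [Field k]
    {Γ Γ' : PreAbstractSimplicialComplex V} {κ : V → ℕ} {S T : Finset ℕ} (hST : S ⊆ T)
    (hdim : Γ.dimSucc = T.card) (hκ : ∀ s ∈ Γ, Set.InjOn κ s) (hT : ∀ s ∈ Γ, ∀ v ∈ s, κ v ∈ T)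
    (hΓ' : ∀ s, s ∈ Γ' ↔ s ∈ Γ ∧ ∀ v ∈ s, κ v ∈ S) (hB : Γ.IsBuchsbaum k) :
    Γ'.IsBuchsbaum k ∧ Γ'.dimSucc = S.card ∧ (Γ.IsBuchsbaumStar k → Γ'.IsBuchsbaumStar k) := by
  -- Any linear order will do; it only fixes the orientations of the faces.
  let e := Fintype.equivFin V
  let : LinearOrder V := LinearOrder.lift' e e.injective
  have h := isPureOf_of_isPure hB.1
  rw [hdim] at h
  have hT' : ∀ s ∈ Γ.allFaces, ∀ v ∈ s, κ v ∈ T := by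
    rintro s (rfl | hs)
    · simp
    · exact hT s hs
  have hκ' : ∀ s ∈ Γ.allFaces, Set.InjOn κ s := by
    rintro s (rfl | hs)
    · simp
    · exact hκ s hs
  have hKT : selectOf Γ.allFaces κ T = Γ.allFaces :=
    Set.ext fun s => ⟨And.left, fun hs => ⟨hs, hT' s hs⟩⟩
  have hKS : selectOf Γ.allFaces κ S = Γ'.allFaces := by
    ext s
    constructor
    · rintro ⟨rfl | hs, h⟩
      · exact Or.inl rfl
      · exact Or.inr ((hΓ' s).2 ⟨hs, h⟩)
    · rintro (rfl | hs)
      · exact ⟨Or.inl rfl, by simp⟩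
      · exact ⟨Or.inr ((hΓ' s).1 hs).1, ((hΓ' s).1 hs).2⟩
  have h' := h.selectOf hκ' hT' hST
  have hR := rankSelection (k := k) h.down hκ' hST (by rw [hKT]; exact (linksAcyclic_iff h).2 hB.2)
  rw [hKT, hKS] at hR
  rw [hKS] at h'
  have hB' : Γ'.IsBuchsbaum k := ⟨isPure_of_isPureOf h', (linksAcyclic_iff h').1 hR.1⟩
  exact ⟨hB', dimSucc_eq h', fun hS => ⟨hB', (localCyclesLift_iff h').1
    (hR.2 ((localCyclesLift_iff h).2 hS.2))⟩⟩

end PreAbstractSimplicialComplex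

end

/-! ### Rank selection for `Δ` and for its deletions -/

theorem mainTheorem3 {V : Type u} [Fintype V] (k : Type u) [Field k]
    (Δ : PreAbstractSimplicialComplex V) (d m : ℕ) (κ : Δ.vertices → Fin d)
    (hκ : Δ.IsBalanced d κ) (hΔ : Δ.IsMBuchsbaumStar k m) (S : Set (Fin d)) :
    (Δ.rankSelected κ S).IsMBuchsbaumStar k m := by
  classical
  -- The value off the vertex set is irrelevant, as only vertices occur in faces.
  let κ' : V → ℕ := fun v => if h : v ∈ Δ.vertices then κ ⟨v, h⟩ else 0
  let S' : Finset ℕ := S.toFinset.image Fin.val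
  have hvert {s : Finset V} (hs : s ∈ Δ) {v : V} (hv : v ∈ s) : v ∈ Δ.vertices :=
    PreAbstractSimplicialComplex.mem_of_subset hs (by simpa using hv) (by simp)
  have hκ' {v : V} (hv : v ∈ Δ.vertices) : κ' v = κ ⟨v, hv⟩ := dif_pos hv
  have hinj : ∀ s ∈ Δ, Set.InjOn κ' s := by
    intro s hs u hu v hv huv
    by_contra hne
    rw [hκ' (hvert hs hu), hκ' (hvert hs hv)] at huv
    refine hκ.2 ⟨u, hvert hs hu⟩ ⟨v, hvert hs hv⟩ (fun h => hne congr($(h).1)) ?_ (Fin.ext huv)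
    refine PreAbstractSimplicialComplex.mem_of_subset hs (fun w hw => ?_) ⟨u, by simp⟩
    rcases Finset.mem_insert.1 hw with rfl | hw
    · exact hu
    · rwa [Finset.mem_singleton.1 hw]
  have hT : ∀ s ∈ Δ, ∀ v ∈ s, κ' v ∈ Finset.range d := by
    intro s hs v hv
    rw [hκ' (hvert hs hv), Finset.mem_range]
    exact Fin.is_lt _
  have hS' : S' ⊆ Finset.range d := by
    intro i hi
    obtain ⟨j, -, rfl⟩ := Finset.mem_image.1 hi
    exact Finset.mem_range.2 j.is_lt
  have hmem {s : Finset V} (hs : s ∈ Δ) :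
      (∀ v ∈ s, κ' v ∈ S') ↔ ∀ v : Δ.vertices, (v : V) ∈ s → κ v ∈ S := by
    have hv' (v : Δ.vertices) : κ' v ∈ S' ↔ κ v ∈ S := by
      rw [hκ' v.2]
      simp [S', Fin.val_inj]
    exact ⟨fun h v hv => (hv' v).1 (h v hv), fun h v hv => (hv' ⟨v, hvert hs hv⟩).2 (h _ hv)⟩
  have hsel (s : Finset V) : s ∈ Δ.rankSelected κ S ↔ s ∈ Δ ∧ ∀ v ∈ s, κ' v ∈ S' :=
    and_congr_right fun hs => (hmem hs).symm
  have hdim : Δ.dimSucc = (Finset.range d).card := by rw [hκ.1, Finset.card_range]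
  obtain ⟨hB, hB', -⟩ := PreAbstractSimplicialComplex.isBuchsbaum_of_rankSelected
    hS' hdim hinj hT hsel hΔ.1
  refine ⟨hB, fun A hA hAm => ?_⟩
  obtain ⟨hD, hDdim⟩ := hΔ.2 A (fun v hv => (hA hv).1) hAm
  -- Deletion commutes with rank selection, so this is the rank selection of `Δ - A`, which by
  -- hypothesis still has dimension `d - 1`.
  obtain ⟨-, h1, h2⟩ := PreAbstractSimplicialComplex.isBuchsbaum_of_rankSelected
    (Γ' := (Δ.rankSelected κ S).deletion A) hS' (hDdim.trans hdim) (fun s hs => hinj s hs.1)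
    (fun s hs => hT s hs.1) (fun s => ((and_congr_left' (hsel s)).trans and_right_comm)) hD.1
  exact ⟨h2 hD, h1.trans hB'.symm⟩
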